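/- Let $d\ge 2$. For a finite Borel measure $\mu$ on $\mathbb R^d$ put $\widehat\mu(\xi)=\int e^{-2\pi i x\cdot\xi}\,d\mu(x)$, and let $d\omega$ be the normalized surface measure on the unit sphere $S^{d-1}$. Let $\beta:[0,d]\to\mathbb R$ be a function such that for every $s\in[0,d]$ the following holds: for every compactly supported Borel probability measure $\mu$ on $\mathbb R^d$ for which there is a constant $C$ with $$\mu(B(x,r))\le C\,r^{s}\qquad\text{for all }x\in\mathbb R^d,\ r>0,$$ and for every $\varepsilon>0$, there is a constant $C_{\mu,\varepsilon}$ with $$\int_{S^{d-1}}|\widehat\mu(r\omega)|^2\,d\omega\le C_{\mu,\varepsilon}\,r^{-\beta(s)+\varepsilon}\qquad\text{for all } r\ge 1 .$$ Let $E\subset\mathbb R^d$ be an analytic (Suslin) set, for instance a Borel set, let $\dim_{\mathcal H}E$ be its Hausdorff dimension, and for $x\in\mathbb R^d$ let $\Delta_x(E)=\{|x-y|:y\in E\}\subset\mathbb R$, with Lebesgue measure $|\Delta_x(E)|$. Then $$\dim_{\mathcal H}\{x\in\mathbb R^d:|\Delta_x(E)|=0\}\ \le\ \inf\{s\in[0,d]:\dim_{\mathcal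 H}E+\beta(s)>d\},$$ where $\inf\emptyset=+\infty$. In particular, if $\dim_{\mathcal H}E+\beta(\dim_{\mathcal H}E)>d$, then there exists $x\in E$ such that $\Delta_x(E)$ has positive Lebesgue measure. -/

import Mathlib

open MeasureTheory Metric Set
open scoped RealInnerProductSpace ENNReal

noncomputable section

/-- The pinned distance set `Δ_x(E) = {|x - y| : y ∈ E} ⊆ ℝ`. -/
def pinnedDistanceSet {d : ℕ} (x : EuclideanSpace ℝ (Fin d))
    (E : Set (EuclideanSpace ℝ (Fin d))) : Set ℝ :=
  {t | ∃ y ∈ E, t = dist x y}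

/-- The Fourier transform `∫ e^{-2πi x·ξ} dμ(x)` of a (finite) measure on `ℝ^d`. -/
def fourierMeasure {d : ℕ} (μ : Measure (EuclideanSpace ℝ (Fin d)))
    (ξ : EuclideanSpace ℝ (Fin d)) : ℂ :=
  ∫ x, Complex.exp (((-2 * Real.pi * ⟪x, ξ⟫ : ℝ) : ℂ) * Complex.I) ∂μ

/-- The normalized (total mass one) surface measure on the unit sphere of `ℝ^d`. -/
def normalizedSphereMeasure (d : ℕ) :
    Measure (sphere (0 : EuclideanSpace ℝ (Fin d)) 1) :=
  ((volume : Measure (EuclideanSpace ℝ (Fin d))).toSphere univ)⁻¹ •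
    (volume : Measure (EuclideanSpace ℝ (Fin d))).toSphere

/-- The spherical average `∫_{S^{d-1}} |μ̂(rω)|² dω`. -/
def sphericalAverage {d : ℕ} (μ : Measure (EuclideanSpace ℝ (Fin d))) (r : ℝ) : ℝ :=
  ∫ ω : sphere (0 : EuclideanSpace ℝ (Fin d)) 1,
    ‖fourierMeasure μ (r • (ω : EuclideanSpace ℝ (Fin d)))‖ ^ 2 ∂normalizedSphereMeasure d

/-- The ball condition `μ(B(x,r)) ≲ r^s` for all `x` and all `r > 0`. -/
def IsFrostman {d : ℕ} (s : ℝ) (μ : Measure (EuclideanSpace ℝ (Fin d))) : Prop :=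
  ∃ C : ℝ, ∀ (x : EuclideanSpace ℝ (Fin d)) (r : ℝ), 0 < r →
    μ (closedBall x r) ≤ ENNReal.ofReal (C * r ^ s)

/-- `b` is a spherical decay exponent for `s`-dimensional measures on `ℝ^d`: every compactly
supported probability measure with `μ(B(x,r)) ≲ r^s` satisfies
`∫_{S^{d-1}} |μ̂(rω)|² dω ≲_ε r^{-b+ε}` for `r ≥ 1` and every `ε > 0`.
The implied constant may depend on `μ` and `ε`. -/
def SphericalDecay (d : ℕ) (s b : ℝ) : Prop :=
  ∀ μ : Measure (EuclideanSpace ℝ (Fin d)), IsProbabilityMeasure μ →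
    (∃ K : Set (EuclideanSpace ℝ (Fin d)), IsCompact K ∧ μ Kᶜ = 0) →
    IsFrostman s μ →
    ∀ ε : ℝ, 0 < ε → ∃ C : ℝ, ∀ r : ℝ, 1 ≤ r →
      sphericalAverage μ r ≤ C * r ^ (-b + ε)

end

open scoped BoundedContinuousFunction FourierTransform SchwartzMap

/-! ### Contents generated by a nested family of cells -/

/-- The content of `A`: the least total weight of a cover of `A` by cells. -/
noncomputable def cellContent {X ι : Type*} (c : ι → Set X) (w : ι → ℝ≥0∞) (A : Set X) : ℝ≥0∞ :=
  ⨅ (C : Set ι) (_ : A ⊆ ⋃ p ∈ C, c p), ∑' p, C.indicator w p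

section CellContent

variable {X ι : Type*} {c : ι → Set X} {w : ι → ℝ≥0∞}

theorem cellContent_le {A : Set X} {C : Set ι} (h : A ⊆ ⋃ p ∈ C, c p) :
    cellContent c w A ≤ ∑' p, C.indicator w p :=
  iInf₂_le C h

theorem cellContent_mono {A B : Set X} (h : A ⊆ B) : cellContent c w A ≤ cellContent c w B :=
  le_iInf₂ fun _ hC => cellContent_le (h.trans hC)

theorem exists_cover_of_cellContent_lt {A : Set X} {a : ℝ≥0∞} (h : cellContent c w A < a) :
    ∃ C : Set ι, A ⊆ (⋃ p ∈ C, c p) ∧ ∑' p, C.indicator w p < a := by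
  simp only [cellContent, iInf_lt_iff] at h
  obtain ⟨C, hC, h⟩ := h
  exact ⟨C, hC, h⟩

theorem tsum_indicator_iUnion_le {κ : Type*} (C : κ → Set ι) :
    ∑' p, (⋃ n, C n).indicator w p ≤ ∑' n, ∑' p, (C n).indicator w p := by
  rw [ENNReal.tsum_comm]
  refine ENNReal.tsum_le_tsum fun p => ?_
  by_cases hp : p ∈ ⋃ n, C n
  · obtain ⟨n, hn⟩ := mem_iUnion.1 hp
    rw [indicator_of_mem hp]
    calc w p = (C n).indicator w p := (indicator_of_mem hn _).symm
      _ ≤ _ := ENNReal.le_tsum n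
  · simp [indicator_of_notMem hp]

theorem cellContent_iUnion_le {κ : Type*} [Countable κ] (A : κ → Set X) :
    cellContent c w (⋃ n, A n) ≤ ∑' n, cellContent c w (A n) := by
  refine ENNReal.le_of_forall_pos_le_add fun ε hε hfin => ?_
  obtain ⟨δ, hδ, hδε⟩ := ENNReal.exists_pos_sum_of_countable (ENNReal.coe_pos.2 hε).ne' κ
  have hfin' : ∀ n, cellContent c w (A n) ≠ ∞ :=
    fun n => ((ENNReal.le_tsum n).trans_lt hfin).ne
  choose C hC hCw using fun n => exists_cover_of_cellContent_lt
    (ENNReal.lt_add_right (hfin' n) (ENNReal.coe_pos.2 (hδ n)).ne')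
  calc cellContent c w (⋃ n, A n) ≤ ∑' p, (⋃ n, C n).indicator w p := by
        refine cellContent_le (iUnion_subset fun n x hx => ?_)
        have := hC n hx
        simp only [mem_iUnion, exists_prop] at this ⊢
        obtain ⟨p, hp, hxp⟩ := this
        exact ⟨p, ⟨n, hp⟩, hxp⟩
    _ ≤ ∑' n, ∑' p, (C n).indicator w p := tsum_indicator_iUnion_le C
    _ ≤ ∑' n, (cellContent c w (A n) + δ n) := ENNReal.tsum_le_tsum fun n => (hCw n).le
    _ = (∑' n, cellContent c w (A n)) + ∑' n, (δ n : ℝ≥0∞) := ENNReal.tsum_add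
    _ ≤ _ := by gcongr

theorem cellContent_union_le (A B : Set X) :
    cellContent c w (A ∪ B) ≤ cellContent c w A + cellContent c w B := by
  have h := cellContent_iUnion_le (c := c) (w := w) (fun b : Bool => cond b A B)
  rw [tsum_bool] at h
  simpa [← union_eq_iUnion, add_comm] using h

theorem sum_indicator_le_of_disjoint {N : ℕ} {G : ℕ → Set ι} {C : Set ι}
    (hG : ∀ n, G n ⊆ C) (hd : ∀ m n q, q ∈ G m → q ∈ G n → m = n) :
    ∑ n ∈ Finset.range N, ∑' p, (G n).indicator w p ≤ ∑' p, C.indicator w p := by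
  rw [← Summable.tsum_finsetSum fun _ _ => ENNReal.summable]
  refine ENNReal.tsum_le_tsum fun p => ?_
  by_cases hp : ∃ n, p ∈ G n
  · obtain ⟨n, hn⟩ := hp
    rw [indicator_of_mem (hG n hn)]
    refine (Finset.sum_le_sum_of_ne_zero (t := {n}) fun m _ hm => ?_).trans ?_
    · rw [Finset.mem_singleton]
      exact hd m n p (mem_of_indicator_ne_zero hm) hn
    · simp [indicator_of_mem hn]
  · push Not at hp
    simp [fun n => indicator_of_notMem (hp n) w]

/-- For a nested family of cells, the content is continuous along increasing unions. -/
theorem cellContent_iUnion_of_monotone (lev : ι → ℕ) (hne : ∀ p, (c p).Nonempty)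
    (hnest : ∀ p q, lev p ≤ lev q → (c p ∩ c q).Nonempty → c q ⊆ c p)
    (heq : ∀ p q, lev p = lev q → (c p ∩ c q).Nonempty → p = q)
    {A : ℕ → Set X} (hA : Monotone A) :
    cellContent c w (⋃ n, A n) ≤ ⨆ n, cellContent c w (A n) := by
  refine ENNReal.le_of_forall_pos_le_add fun ε' hε' hfin => ?_
  obtain ⟨ε, hε, hεε⟩ : ∃ ε : NNReal, 0 < ε ∧ ε + ε = ε' := ⟨ε' / 2, by positivity, add_halves _⟩
  obtain ⟨δ, hδ, hδε⟩ := ENNReal.exists_pos_sum_of_countable (ENNReal.coe_pos.2 hε).ne' ℕ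
  have hfin' : ∀ n, cellContent c w (A n) ≠ ∞ :=
    fun n => ((le_iSup (fun n => cellContent c w (A n)) n).trans_lt hfin).ne
  choose C hC hCw using fun n => exists_cover_of_cellContent_lt
    (ENNReal.lt_add_right (hfin' n) (ENNReal.coe_pos.2 (hδ n)).ne')
  set U : Set ι := ⋃ n, C n with hU
  set Mx : Set ι := {p | p ∈ U ∧ ∀ q ∈ U, (c q ∩ c p).Nonempty → lev p ≤ lev q} with hMx
  have hMxeq : ∀ p ∈ Mx, ∀ q ∈ Mx, (c p ∩ c q).Nonempty → p = q := fun p hp q hq h =>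
    heq p q (le_antisymm (hp.2 q hq.1 (by rwa [inter_comm])) (hq.2 p hp.1 h)) h
  have hcov : ∀ x q, q ∈ U → x ∈ c q → ∃ p ∈ Mx, x ∈ c p := by
    intro x q hq hx
    classical
    have hex : ∃ k, ∃ p ∈ U, x ∈ c p ∧ lev p = k := ⟨_, q, hq, hx, rfl⟩
    obtain ⟨p, hp, hxp, hlev⟩ := Nat.find_spec hex
    refine ⟨p, ⟨hp, fun q' hq' hne' => ?_⟩, hxp⟩
    by_contra! hlt
    have hsub := hnest q' p hlt.le hne'
    exact Nat.find_min hex (hlev ▸ hlt) ⟨q', hq', hsub hxp, rfl⟩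
  set D : ℕ → Set ι := fun n => {p | p ∈ Mx ∧ p ∈ C n ∧ ∀ m < n, p ∉ C m} with hD
  have hDU : Mx ⊆ ⋃ n, D n := by
    intro p hp
    classical
    have hex : ∃ n, p ∈ C n := mem_iUnion.1 hp.1
    exact mem_iUnion.2 ⟨Nat.find hex, hp, Nat.find_spec hex, fun m hm => Nat.find_min hex hm⟩
  have hDd : ∀ m n p, p ∈ D m → p ∈ D n → m = n := by
    intro m n p hm hn
    rcases lt_trichotomy m n with h | h | h
    · exact absurd hm.2.1 (hn.2.2 m h)
    · exact h
    · exact absurd hn.2.1 (hm.2.2 n h)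
  have hDopt : ∀ n, ∑' p, (D n).indicator w p ≤
      cellContent c w (A n ∩ ⋃ p ∈ D n, c p) + δ n := by
    intro n
    have hsplit : ∑' p, (C n \ D n).indicator w p + ∑' p, (D n).indicator w p
        = ∑' p, (C n).indicator w p := by
      rw [← ENNReal.tsum_add]
      refine tsum_congr fun p => ?_
      have hsub : D n ⊆ C n := fun p hp => hp.2.1
      by_cases h1 : p ∈ D n
      · simp [h1, hsub h1]
      · by_cases h2 : p ∈ C n <;> simp [h1, h2]
    have hfinC : ∑' p, (C n \ D n).indicator w p ≠ ∞ := by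
      refine ne_top_of_le_ne_top ?_ (le_self_add.trans hsplit.le)
      exact (hCw n).ne_top
    refine (ENNReal.add_le_add_iff_left hfinC).1 ?_
    rw [hsplit, ← add_assoc]
    refine (hCw n).le.trans ?_
    gcongr
    calc cellContent c w (A n)
        ≤ cellContent c w ((⋃ p ∈ C n \ D n, c p) ∪ (A n ∩ ⋃ p ∈ D n, c p)) := by
          refine cellContent_mono fun x hx => ?_
          have := hC n hx
          simp only [mem_iUnion, exists_prop, mem_union, mem_inter_iff, mem_sdiff] at this ⊢
          obtain ⟨p, hp, hxp⟩ := this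
          by_cases h1 : p ∈ D n
          · exact Or.inr ⟨hx, p, h1, hxp⟩
          · exact Or.inl ⟨p, ⟨hp, h1⟩, hxp⟩
      _ ≤ cellContent c w (⋃ p ∈ C n \ D n, c p) + cellContent c w (A n ∩ ⋃ p ∈ D n, c p) :=
          cellContent_union_le _ _
      _ ≤ _ := by
          gcongr
          exact cellContent_le le_rfl
  have hN : ∀ N, ∑ n ∈ Finset.range N, ∑' p, (D n).indicator w p
      ≤ (⨆ n, cellContent c w (A n)) + ε' := by
    intro N
    set G : ℕ → Set ι := fun n => {q | q ∈ C N ∧ ∃ p ∈ D n, c q ⊆ c p} with hG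
    have hGd : ∀ m n q, q ∈ G m → q ∈ G n → m = n := by
      rintro m n q ⟨-, p, hp, hpq⟩ ⟨-, p', hp', hpq'⟩
      obtain ⟨x, hx⟩ := hne q
      have := hMxeq p hp.1 p' hp'.1 ⟨x, hpq hx, hpq' hx⟩
      subst this
      exact hDd m n p hp hp'
    calc ∑ n ∈ Finset.range N, ∑' p, (D n).indicator w p
        ≤ ∑ n ∈ Finset.range N, (∑' p, (G n).indicator w p + δ n) := by
          refine Finset.sum_le_sum fun n hn => (hDopt n).trans ?_
          gcongr
          refine cellContent_le fun x hx => ?_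
          have hxN := hC N (hA (Finset.mem_range.1 hn).le hx.1)
          have hx2 := hx.2
          simp only [mem_iUnion, exists_prop] at hxN hx2 ⊢
          obtain ⟨q, hq, hxq⟩ := hxN
          obtain ⟨p, hp, hxp⟩ := hx2
          have hne' : (c q ∩ c p).Nonempty := ⟨x, hxq, hxp⟩
          exact ⟨q, ⟨hq, p, hp, hnest p q (hp.1.2 q (mem_iUnion.2 ⟨N, hq⟩) hne')
            (by rwa [inter_comm])⟩, hxq⟩
      _ = ∑ n ∈ Finset.range N, ∑' p, (G n).indicator w p
          + ∑ n ∈ Finset.range N, (δ n : ℝ≥0∞) := Finset.sum_add_distrib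
      _ ≤ ∑' p, (C N).indicator w p + ε := by
          gcongr
          · exact sum_indicator_le_of_disjoint (fun n q hq => hq.1) hGd
          · exact (ENNReal.sum_le_tsum _).trans hδε.le
      _ ≤ (cellContent c w (A N) + ε) + ε := by
          gcongr
          refine (hCw N).le.trans ?_
          gcongr
          exact_mod_cast (ENNReal.le_tsum N).trans hδε.le
      _ ≤ _ := by
          rw [add_assoc, ← hεε]
          push_cast
          gcongr
          exact le_iSup (fun n => cellContent c w (A n)) N
  calc cellContent c w (⋃ n, A n) ≤ ∑' p, Mx.indicator w p := by
        refine cellContent_le (iUnion_subset fun n x hx => ?_)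
        have := hC n hx
        simp only [mem_iUnion, exists_prop] at this ⊢
        obtain ⟨q, hq, hxq⟩ := this
        exact hcov x q (mem_iUnion.2 ⟨n, hq⟩) hxq
    _ ≤ ∑' p, (⋃ n, D n).indicator w p :=
        ENNReal.tsum_le_tsum fun p => indicator_le_indicator_of_subset hDU (fun _ => zero_le) p
    _ ≤ ∑' n, ∑' p, (D n).indicator w p := tsum_indicator_iUnion_le D
    _ ≤ _ := by
        rw [ENNReal.tsum_eq_iSup_nat]
        exact iSup_le hN

end CellContent

/-! ### Dyadic cells in Euclidean space -/

/-- The Euclidean space `ℝ^d`. -/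
abbrev Euc (d : ℕ) := EuclideanSpace ℝ (Fin d)

/-- The half-open dyadic cube of side `2^{-k}` with integer label `n`, for `p = (k, n)`. -/
def dyadicCell {d : ℕ} (p : ℕ × (Fin d → ℤ)) : Set (Euc d) :=
  {x | ∀ i, ⌊(2 : ℝ) ^ p.1 * x i⌋ = p.2 i}

/-- The label of the dyadic cube of side `2^{-k}` containing `x`. -/
noncomputable def dyadicLabel {d : ℕ} (k : ℕ) (x : Euc d) : Fin d → ℤ :=
  fun i => ⌊(2 : ℝ) ^ k * x i⌋

/-- The weight `2^{-ks}` of a dyadic cube of side `2^{-k}`. -/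
noncomputable def dyadicWeight (d : ℕ) (s : ℝ) (p : ℕ × (Fin d → ℤ)) : ℝ≥0∞ :=
  ENNReal.ofReal (((2 : ℝ)⁻¹ ^ p.1) ^ s)

/-- The `s`-dimensional dyadic content. -/
noncomputable def dyadicContent {d : ℕ} (s : ℝ) (A : Set (Euc d)) : ℝ≥0∞ :=
  cellContent dyadicCell (dyadicWeight d s) A

section Dyadic

variable {d : ℕ}

theorem mem_dyadicCell_iff {p : ℕ × (Fin d → ℤ)} {x : Euc d} :
    x ∈ dyadicCell p ↔ dyadicLabel p.1 x = p.2 :=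
  funext_iff.symm

theorem mem_dyadicCell_label (k : ℕ) (x : Euc d) : x ∈ dyadicCell (k, dyadicLabel k x) :=
  mem_dyadicCell_iff.2 rfl

theorem dyadicCell_nonempty (p : ℕ × (Fin d → ℤ)) : (dyadicCell p).Nonempty := by
  refine ⟨WithLp.toLp 2 fun i => (p.2 i : ℝ) / 2 ^ p.1, fun i => ?_⟩
  simp [mul_div_cancel₀]

theorem dyadicLabel_succ (k : ℕ) (x : Euc d) (i : Fin d) :
    dyadicLabel k x i = dyadicLabel (k + 1) x i / 2 := by
  have h := Int.floor_div_natCast ((2 : ℝ) ^ (k + 1) * x i) 2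
  simp only [dyadicLabel]
  rw [show (2 : ℝ) ^ k * x i = 2 ^ (k + 1) * x i / (2 : ℕ) by push_cast; ring, h]
  rfl

theorem dyadicLabel_eq_of_le {k l : ℕ} (h : k ≤ l) {x y : Euc d}
    (hxy : dyadicLabel l x = dyadicLabel l y) : dyadicLabel k x = dyadicLabel k y := by
  induction l, h using Nat.le_induction with
  | base => exact hxy
  | succ l _ ih => exact ih (funext fun i => by rw [dyadicLabel_succ l, dyadicLabel_succ l, hxy])

theorem dyadicCell_subset {p q : ℕ × (Fin d → ℤ)} (h : p.1 ≤ q.1)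
    (hpq : (dyadicCell p ∩ dyadicCell q).Nonempty) : dyadicCell q ⊆ dyadicCell p := by
  obtain ⟨x, hxp, hxq⟩ := hpq
  intro y hy
  rw [mem_dyadicCell_iff] at *
  rw [← hxp]
  exact dyadicLabel_eq_of_le h (hy.trans hxq.symm)

theorem dyadicCell_eq {p q : ℕ × (Fin d → ℤ)} (h : p.1 = q.1)
    (hpq : (dyadicCell p ∩ dyadicCell q).Nonempty) : p = q := by
  obtain ⟨x, hxp, hxq⟩ := hpq
  rw [mem_dyadicCell_iff] at *
  exact Prod.ext h (by rw [← hxp, ← hxq, h])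

theorem dyadicContent_iUnion_of_monotone (s : ℝ) {A : ℕ → Set (Euc d)} (hA : Monotone A) :
    dyadicContent s (⋃ n, A n) ≤ ⨆ n, dyadicContent s (A n) :=
  cellContent_iUnion_of_monotone (c := dyadicCell) Prod.fst dyadicCell_nonempty
    (fun _ _ h1 h2 => dyadicCell_subset h1 h2) (fun _ _ h1 h2 => dyadicCell_eq h1 h2) hA

theorem dyadicContent_cell_le (s : ℝ) (p : ℕ × (Fin d → ℤ)) :
    dyadicContent s (dyadicCell p) ≤ dyadicWeight d s p := by
  refine (cellContent_le (C := {p}) (by simp)).trans ?_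
  rw [tsum_eq_single p (fun q hq => by simp [hq])]
  simp

theorem norm_le_sqrt_mul {x : Euc d} {a : ℝ} (ha : 0 ≤ a) (h : ∀ i, |x i| ≤ a) :
    ‖x‖ ≤ √d * a := by
  rw [EuclideanSpace.norm_eq, ← Real.sqrt_sq ha, ← Real.sqrt_mul (Nat.cast_nonneg d)]
  refine Real.sqrt_le_sqrt ?_
  calc ∑ i, ‖x i‖ ^ 2 ≤ ∑ _i : Fin d, a ^ 2 := by
        refine Finset.sum_le_sum fun i _ => ?_
        rw [Real.norm_eq_abs]
        gcongr
        exact h i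
    _ = _ := by simp

theorem abs_apply_le_norm (x : Euc d) (i : Fin d) : |x i| ≤ ‖x‖ := by
  simpa using PiLp.norm_apply_le x i

theorem dist_le_of_mem_dyadicCell {p : ℕ × (Fin d → ℤ)} {x y : Euc d} (hx : x ∈ dyadicCell p)
    (hy : y ∈ dyadicCell p) : dist x y ≤ √d * (2 : ℝ)⁻¹ ^ p.1 := by
  rw [dist_eq_norm]
  refine norm_le_sqrt_mul (by positivity) fun i => ?_
  have h := Int.abs_sub_lt_one_of_floor_eq_floor ((hx i).trans (hy i).symm)
  rw [← mul_sub, abs_mul, abs_of_pos (by positivity : (0 : ℝ) < 2 ^ p.1)] at h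
  rw [inv_pow, ← one_div, le_div_iff₀ (by positivity)]
  simpa [mul_comm] using h.le

theorem measurableSet_dyadicCell (p : ℕ × (Fin d → ℤ)) : MeasurableSet (dyadicCell p) := by
  rw [dyadicCell, ofPred_forall]
  refine MeasurableSet.iInter fun i => ?_
  have h : Measurable fun x : Euc d => ⌊(2 : ℝ) ^ p.1 * x i⌋ := by fun_prop
  exact h (measurableSet_singleton (p.2 i))

/-- The labels of a cube and of its neighbours. -/
def neighbours (p : ℕ × (Fin d → ℤ)) : Finset (ℕ × (Fin d → ℤ)) :=
  (Fintype.piFinset fun _ : Fin d => ({-1, 0, 1} : Finset ℤ)).image fun v => (p.1, p.2 + v)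

theorem card_neighbours_le (p : ℕ × (Fin d → ℤ)) : (neighbours p).card ≤ 3 ^ d := by
  refine Finset.card_image_le.trans ?_
  simp

theorem mem_neighbours_of_dist_lt {k : ℕ} {x y : Euc d} (h : dist x y < (2 : ℝ)⁻¹ ^ k) :
    (k, dyadicLabel k y) ∈ neighbours (k, dyadicLabel k x) := by
  refine Finset.mem_image.2 ⟨dyadicLabel k y - dyadicLabel k x, ?_, by simp⟩
  rw [Fintype.mem_piFinset]
  intro i
  have h1 : |x i - y i| < (2 : ℝ)⁻¹ ^ k :=
    (abs_apply_le_norm (x - y) i).trans_lt (by rwa [← dist_eq_norm])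
  rw [inv_pow, ← one_div, lt_div_iff₀ (by positivity), ← abs_of_pos (by positivity : (0 : ℝ) < 2 ^ k),
    ← abs_mul, sub_mul, abs_lt] at h1
  simp only [dyadicLabel, Pi.sub_apply, Finset.mem_insert, Finset.mem_singleton]
  have h2 := Int.floor_le ((2 : ℝ) ^ k * x i)
  have h3 := Int.lt_floor_add_one ((2 : ℝ) ^ k * x i)
  have h4 := Int.floor_le ((2 : ℝ) ^ k * y i)
  have h5 := Int.lt_floor_add_one ((2 : ℝ) ^ k * y i)
  have h6 : ⌊(2 : ℝ) ^ k * y i⌋ < ⌊(2 : ℝ) ^ k * x i⌋ + 2 := by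
    have : (⌊(2 : ℝ) ^ k * y i⌋ : ℝ) < ⌊(2 : ℝ) ^ k * x i⌋ + 2 := by linarith
    exact_mod_cast this
  have h7 : ⌊(2 : ℝ) ^ k * x i⌋ < ⌊(2 : ℝ) ^ k * y i⌋ + 2 := by
    have : (⌊(2 : ℝ) ^ k * x i⌋ : ℝ) < ⌊(2 : ℝ) ^ k * y i⌋ + 2 := by linarith
    exact_mod_cast this
  omega

/-- A set of positive Hausdorff measure has positive dyadic content. -/
theorem dyadicContent_pos_of_lt_dimH {s : NNReal} (hs : 0 < s) {A : Set (Euc d)}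
    (h : (s : ℝ≥0∞) < dimH A) : 0 < dyadicContent s A := by
  by_contra h0
  rw [not_lt, nonpos_iff_eq_zero] at h0
  have hs' : (0 : ℝ) < s := hs
  have hcov : ∀ n : ℕ, ∃ C : Set (ℕ × (Fin d → ℤ)), A ⊆ (⋃ p ∈ C, dyadicCell p) ∧
      ∑' p, C.indicator (dyadicWeight d s) p < ENNReal.ofReal (((2 : ℝ)⁻¹ ^ n) ^ (s : ℝ)) := by
    intro n
    refine exists_cover_of_cellContent_lt ?_
    rw [show cellContent dyadicCell (dyadicWeight d s) A = dyadicContent s A from rfl, h0]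
    exact ENNReal.ofReal_pos.2 (by positivity)
  choose C hC hCw using hcov
  have hlev : ∀ n, ∀ p ∈ C n, n ≤ p.1 := by
    intro n p hp
    have h1 : dyadicWeight d s p < ENNReal.ofReal (((2 : ℝ)⁻¹ ^ n) ^ (s : ℝ)) := by
      refine lt_of_le_of_lt ?_ (hCw n)
      calc dyadicWeight d s p = (C n).indicator (dyadicWeight d s) p := (indicator_of_mem hp _).symm
        _ ≤ _ := ENNReal.le_tsum p
    rw [dyadicWeight, ENNReal.ofReal_lt_ofReal_iff (by positivity)] at h1
    by_contra! hlt
    refine absurd h1 (not_lt.2 (Real.rpow_le_rpow (by positivity) ?_ hs'.le))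
    exact pow_le_pow_of_le_one (by norm_num) (by norm_num) hlt.le
  have hdiam : ∀ p : ℕ × (Fin d → ℤ), ediam (dyadicCell p) ≤ ENNReal.ofReal (√d * (2 : ℝ)⁻¹ ^ p.1) := by
    intro p
    refine ediam_le fun x hx y hy => ?_
    rw [edist_dist]
    exact ENNReal.ofReal_le_ofReal (dist_le_of_mem_dyadicCell hx hy)
  have hpow : Filter.Tendsto (fun n : ℕ => (2 : ℝ)⁻¹ ^ n) Filter.atTop (nhds 0) :=
    tendsto_pow_atTop_nhds_zero_of_lt_one (by norm_num) (by norm_num)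
  have hH : Measure.hausdorffMeasure (s : ℝ) A ≤ 0 := by
    have hr : Filter.Tendsto (fun n : ℕ => ENNReal.ofReal (√d * (2 : ℝ)⁻¹ ^ n)) Filter.atTop
        (nhds 0) := by
      simpa using ENNReal.tendsto_ofReal (hpow.const_mul (√d))
    have hcov' : ∀ n, A ⊆ ⋃ p : C n, dyadicCell p.1 := fun n =>
      (hC n).trans (biUnion_eq_iUnion (C n) fun p _ => dyadicCell p).subset
    have hdiam' : ∀ n, ∀ p : C n, ediam (dyadicCell p.1) ≤ ENNReal.ofReal (√d * (2 : ℝ)⁻¹ ^ n) :=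
      fun n p => (hdiam p).trans <| ENNReal.ofReal_le_ofReal <|
        mul_le_mul_of_nonneg_left
          (pow_le_pow_of_le_one (by norm_num) (by norm_num) (hlev n p p.2)) (by positivity)
    have := Measure.hausdorffMeasure_le_liminf_tsum (s : ℝ) A _ hr
      (fun (n : ℕ) (p : C n) => dyadicCell p.1) (Filter.Eventually.of_forall hdiam')
      (Filter.Eventually.of_forall hcov')
    refine this.trans ?_
    have hlim : Filter.Tendsto (fun n : ℕ => ENNReal.ofReal (√d ^ (s : ℝ)) *
        ENNReal.ofReal (((2 : ℝ)⁻¹ ^ n) ^ (s : ℝ))) Filter.atTop (nhds 0) := by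
      have h1 : Filter.Tendsto (fun n : ℕ => ((2 : ℝ)⁻¹ ^ n) ^ (s : ℝ)) Filter.atTop (nhds 0) := by
        have := hpow.rpow_const (p := (s : ℝ)) (Or.inr hs'.le)
        rwa [Real.zero_rpow hs'.ne'] at this
      have := ENNReal.Tendsto.const_mul (a := ENNReal.ofReal (√d ^ (s : ℝ)))
        (ENNReal.tendsto_ofReal h1) (Or.inr ENNReal.ofReal_ne_top)
      simpa using this
    rw [← hlim.liminf_eq]
    refine Filter.liminf_le_liminf (Filter.Eventually.of_forall fun n => ?_)
    calc ∑' p : C n, ediam (dyadicCell p.1) ^ (s : ℝ)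
        ≤ ∑' p : C n, ENNReal.ofReal (√d ^ (s : ℝ)) * dyadicWeight d s p.1 := by
          refine ENNReal.tsum_le_tsum fun p => ?_
          refine (ENNReal.rpow_le_rpow (hdiam p) hs'.le).trans ?_
          rw [ENNReal.ofReal_rpow_of_nonneg (by positivity) hs'.le,
            Real.mul_rpow (by positivity) (by positivity), ENNReal.ofReal_mul (by positivity)]
          rfl
      _ = ENNReal.ofReal (√d ^ (s : ℝ)) * ∑' p, (C n).indicator (dyadicWeight d s) p := by
          rw [ENNReal.tsum_mul_left, tsum_subtype (C n) (dyadicWeight d s)]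
      _ ≤ _ := by
          gcongr
          exact (hCw n).le
  exact absurd (dimH_le_of_hausdorffMeasure_ne_top (d := s) (s := A)
    (ne_top_of_le_ne_top ENNReal.zero_ne_top hH)) (not_le.2 h)

end Dyadic

section CompactSubset

variable {d : ℕ}

/-- A cover of `K` by dyadic cubes can be enlarged to a neighbourhood of `K` at a bounded cost. -/
theorem exists_neighbourhood_cover {K : Set (Euc d)} {C : Set (ℕ × (Fin d → ℤ))} (s : ℝ)
    (hC : K ⊆ ⋃ p ∈ C, dyadicCell p) :
    ∃ C' : Set (ℕ × (Fin d → ℤ)), (∀ x ∈ K, (⋃ p ∈ C', dyadicCell p) ∈ nhds x) ∧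
      ∑' p, C'.indicator (dyadicWeight d s) p ≤
        3 ^ d * ∑' p, C.indicator (dyadicWeight d s) p := by
  refine ⟨⋃ p : C, (neighbours p.1 : Set _), fun x hx => ?_, ?_⟩
  · obtain ⟨p, hp, hxp⟩ := mem_iUnion₂.1 (hC hx)
    refine Filter.mem_of_superset (ball_mem_nhds x (by positivity : (0 : ℝ) < 2⁻¹ ^ p.1)) ?_
    intro y hy
    refine mem_iUnion₂.2 ⟨_, mem_iUnion.2 ⟨⟨p, hp⟩, ?_⟩, mem_dyadicCell_label p.1 y⟩
    have h := mem_neighbours_of_dist_lt (x := x) (y := y) (mem_ball'.1 hy)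
    rwa [mem_dyadicCell_iff.1 hxp] at h
  · refine (tsum_indicator_iUnion_le _).trans ?_
    rw [← ENNReal.tsum_mul_left, ← tsum_subtype_eq_of_support_subset (s := C) (f := fun p => 3 ^ d * C.indicator (dyadicWeight d s) p)]
    · refine ENNReal.tsum_le_tsum fun p => ?_
      rw [← tsum_subtype, indicator_of_mem p.2]
      rw [Finset.tsum_subtype' (neighbours p.1) (dyadicWeight d s)]
      refine (Finset.sum_le_card_nsmul _ _ (dyadicWeight d s p) fun q hq => ?_).trans ?_
      · obtain ⟨v, -, rfl⟩ := Finset.mem_image.1 hq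
        exact le_rfl
      · rw [nsmul_eq_mul]
        gcongr
        exact_mod_cast card_neighbours_le p.1
    · intro p hp
      by_contra h
      simp [h] at hp

/-- An analytic set of positive dyadic content has a compact subset of positive content. -/
theorem exists_isCompact_dyadicContent_pos {s : ℝ} {A : Set (Euc d)} (hA : AnalyticSet A)
    (hpos : 0 < dyadicContent s A) :
    ∃ K ⊆ A, IsCompact K ∧ 0 < dyadicContent s K := by
  rw [AnalyticSet] at hA
  rcases hA with rfl | ⟨f, hf, rfl⟩
  · exact ⟨∅, Subset.rfl, isCompact_empty, hpos⟩
  obtain ⟨c, hc0, hc⟩ := exists_between hpos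
  have hstep : ∀ (k : ℕ) (S : Set (ℕ → ℕ)), c < dyadicContent s (f '' S) →
      ∃ m : ℕ, c < dyadicContent s (f '' (S ∩ {x | x k ≤ m})) := by
    intro k S hS
    have hmono : Monotone fun m : ℕ => f '' (S ∩ {x | x k ≤ m}) := fun m n hmn =>
      image_mono (inter_subset_inter_right S fun x hx => le_trans hx hmn)
    have hun : (⋃ m : ℕ, f '' (S ∩ {x | x k ≤ m})) = f '' S := by
      rw [← image_iUnion, ← inter_iUnion]
      congr 1
      refine inter_eq_left.2 fun x _ => mem_iUnion.2 ⟨x k, le_refl (x k)⟩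
    have h := dyadicContent_iUnion_of_monotone s hmono
    rw [hun] at h
    exact lt_iSup_iff.1 (hS.trans_le h)
  choose g hg using hstep
  let T : ℕ → {S : Set (ℕ → ℕ) // c < dyadicContent s (f '' S)} := fun k =>
    Nat.rec ⟨univ, by rwa [image_univ]⟩ (fun k S => ⟨_, hg k S.1 S.2⟩) k
  let n : ℕ → ℕ := fun k => g k (T k).1 (T k).2
  have hT : ∀ k, (T k).1 = {x | ∀ i < k, x i ≤ n i} := by
    intro k
    induction k with
    | zero => simp [T]
    | succ k ih =>
      have : (T (k + 1)).1 = (T k).1 ∩ {x | x k ≤ n k} := rfl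
      rw [this, ih]
      ext x
      simp only [mem_inter_iff, mem_ofPred_eq, Nat.lt_succ_iff_lt_or_eq]
      constructor
      · rintro ⟨h1, h2⟩ i (hi | rfl)
        exacts [h1 i hi, h2]
      · exact fun h => ⟨fun i hi => h i (Or.inl hi), h k (Or.inr rfl)⟩
  set B : Set (ℕ → ℕ) := univ.pi fun i => Iic (n i) with hB
  have hBc : IsCompact B := isCompact_univ_pi fun i => (finite_Iic (n i)).isCompact
  refine ⟨f '' B, image_subset_range f B, hBc.image hf, ?_⟩
  by_contra h0
  rw [not_lt, nonpos_iff_eq_zero] at h0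
  obtain ⟨C, hC, hCw⟩ := exists_cover_of_cellContent_lt (c := dyadicCell) (w := dyadicWeight d s)
    (A := f '' B) (a := c / 3 ^ d) (by
      change dyadicContent s (f '' B) < _
      rw [h0]
      exact ENNReal.div_pos hc0.ne' (by finiteness))
  obtain ⟨C', hC', hC'w⟩ := exists_neighbourhood_cover s hC
  have hsub : ∃ k, f '' (T k).1 ⊆ ⋃ p ∈ C', dyadicCell p := by
    by_contra! hnot
    have hx : ∀ k, ∃ x ∈ (T k).1, f x ∉ ⋃ p ∈ C', dyadicCell p := by
      intro k
      obtain ⟨y, ⟨x, hx, rfl⟩, hy⟩ := not_subset.1 (hnot k)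
      exact ⟨x, hx, hy⟩
    choose x hxT hxC using hx
    obtain ⟨y, hyB, φ, hφ, hlim⟩ := hBc.tendsto_subseq (x := fun k i => min (x k i) (n i))
      (fun k i _ => min_le_right (x k i) (n i))
    have hlim' : Filter.Tendsto (x ∘ φ) Filter.atTop (nhds y) := by
      rw [tendsto_pi_nhds] at hlim ⊢
      intro i
      refine (hlim i).congr' ?_
      filter_upwards [Filter.eventually_gt_atTop i] with k hk
      have h1 := hxT (φ k)
      rw [hT] at h1
      exact min_eq_left (h1 i (hk.trans_le (hφ.le_apply)))
    have h2 := (hf.tendsto y).comp hlim' (hC' (f y) (mem_image_of_mem f hyB))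
    obtain ⟨k, hk⟩ := (Filter.mem_map.1 h2 |> Filter.Eventually.exists)
    exact hxC (φ k) hk
  obtain ⟨k, hk⟩ := hsub
  refine absurd (T k).2 (not_lt.2 ?_)
  calc dyadicContent s (f '' (T k).1) ≤ ∑' p, C'.indicator (dyadicWeight d s) p :=
        cellContent_le hk
    _ ≤ 3 ^ d * ∑' p, C.indicator (dyadicWeight d s) p := hC'w
    _ ≤ 3 ^ d * (c / 3 ^ d) := by gcongr
    _ ≤ c := ENNReal.mul_div_le

end CompactSubset

section Frostman

variable {d : ℕ}

theorem iUnion_dyadicCell (k : ℕ) : ⋃ n : Fin d → ℤ, dyadicCell (k, n) = univ :=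
  eq_univ_of_forall fun x => mem_iUnion.2 ⟨_, mem_dyadicCell_label k x⟩

theorem pairwise_disjoint_dyadicCell (k : ℕ) :
    Pairwise (Function.onFun Disjoint fun n : Fin d → ℤ => dyadicCell (k, n)) := by
  intro m n hmn
  by_contra h
  rw [Function.onFun, not_disjoint_iff_nonempty_inter] at h
  exact hmn (congrArg Prod.snd (dyadicCell_eq (p := (k, m)) (q := (k, n)) rfl h))

/-- Redistribution of a measure among the dyadic cubes of the next generation. -/
theorem exists_measure_refine {s : ℝ} {K : Set (Euc d)} (k : ℕ) (μ : Measure (Euc d))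
    (hμ : ∀ p : ℕ × (Fin d → ℤ), p.1 ≤ k → μ (dyadicCell p) ≤ dyadicContent s (K ∩ dyadicCell p)) :
    ∃ μ' : Measure (Euc d), μ' Kᶜ = 0 ∧ μ' univ = μ univ ∧
      ∀ p : ℕ × (Fin d → ℤ), p.1 ≤ k + 1 →
        μ' (dyadicCell p) ≤ dyadicContent s (K ∩ dyadicCell p) := by
  classical
  set m : ℕ × (Fin d → ℤ) → ℝ≥0∞ := fun p => dyadicContent s (K ∩ dyadicCell p) with hm
  have hmfin : ∀ p, m p ≠ ∞ := fun p => ne_top_of_le_ne_top ENNReal.ofReal_ne_top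
    ((cellContent_mono inter_subset_right).trans (dyadicContent_cell_le s p))
  have hmempty : dyadicContent s (∅ : Set (Euc d)) = 0 := by
    have := cellContent_le (c := dyadicCell (d := d)) (w := dyadicWeight d s) (A := ∅) (C := ∅) (by simp)
    exact nonpos_iff_eq_zero.1 (this.trans (by simp))
  let par : (Fin d → ℤ) → (Fin d → ℤ) := fun n i => n i / 2
  have hpar : ∀ n, dyadicCell (k + 1, n) ⊆ dyadicCell (d := d) (k, par n) := by
    intro n x hx
    rw [mem_dyadicCell_iff] at hx ⊢
    funext i
    rw [dyadicLabel_succ]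
    exact congrArg (· / 2) (congrFun hx i)
  have hx : ∀ n, ∃ x : Euc d, m (k + 1, n) ≠ 0 → x ∈ K ∩ dyadicCell (k + 1, n) := by
    intro n
    rcases (K ∩ dyadicCell (k + 1, n)).eq_empty_or_nonempty with h | ⟨x, hx⟩
    · exact ⟨0, fun h0 => absurd (by simp only [hm, h, hmempty]) h0⟩
    · exact ⟨x, fun _ => hx⟩
  choose x hx using hx
  let S : (Fin d → ℤ) → ℝ≥0∞ := fun q => ∑' n, if par n = q then m (k + 1, n) else 0
  have hmS : ∀ q, m (k, q) ≤ S q := by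
    intro q
    have hsub : K ∩ dyadicCell (k, q) ⊆
        ⋃ n : Fin d → ℤ, if par n = q then K ∩ dyadicCell (k + 1, n) else ∅ := by
      intro y hy
      refine mem_iUnion.2 ⟨dyadicLabel (k + 1) y, ?_⟩
      have h1 := hpar _ (mem_dyadicCell_label (k + 1) y)
      have h2 := dyadicCell_eq (p := (k, par (dyadicLabel (k + 1) y))) (q := (k, q)) rfl ⟨y, h1, hy.2⟩
      rw [if_pos (congrArg Prod.snd h2)]
      exact ⟨hy.1, mem_dyadicCell_label _ _⟩
    refine (cellContent_mono hsub).trans ((cellContent_iUnion_le _).trans ?_)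
    refine ENNReal.tsum_le_tsum fun n => ?_
    split_ifs
    · exact le_rfl
    · exact hmempty.le
  let a : (Fin d → ℤ) → ℝ≥0∞ := fun n =>
    μ (dyadicCell (k, par n)) * (m (k + 1, n) / S (par n))
  have ha0 : ∀ n, m (k + 1, n) = 0 → a n = 0 := fun n h => by simp [a, h]
  have hμm : ∀ q, μ (dyadicCell (k, q)) ≤ m (k, q) := fun q => hμ (k, q) le_rfl
  have hSum : ∀ q, ∑' n, (if par n = q then a n else 0) = μ (dyadicCell (k, q)) := by
    intro q
    have h1 : ∀ n, (if par n = q then a n else 0) =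
        μ (dyadicCell (k, q)) / S q * (if par n = q then m (k + 1, n) else 0) := by
      intro n
      split_ifs with h
      · simp only [a, h, div_eq_mul_inv]
        ring
      · simp
    simp_rw [h1]
    rw [ENNReal.tsum_mul_left]
    change _ * S q = _
    by_cases hS0 : S q = 0
    · rw [hS0, mul_zero]
      exact (nonpos_iff_eq_zero.1 ((hμm q).trans ((hmS q).trans hS0.le))).symm
    · refine ENNReal.div_mul_cancel hS0 ?_
      refine ne_top_of_le_ne_top (b := ∑' n : Fin d → ℤ,
        if n ∈ Fintype.piFinset (fun i => ({2 * q i, 2 * q i + 1} : Finset ℤ)) then m (k + 1, n)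
          else 0) ?_ ?_
      · rw [tsum_eq_sum (s := Fintype.piFinset (fun i => ({2 * q i, 2 * q i + 1} : Finset ℤ)))
          (fun n hn => if_neg hn)]
        refine ENNReal.sum_ne_top.2 fun n hn => ?_
        rw [if_pos hn]
        exact hmfin _
      · refine ENNReal.tsum_le_tsum fun n => ?_
        split_ifs with h1 h2
        · exact le_rfl
        · refine absurd (Fintype.mem_piFinset.2 fun i => ?_) h2
          have := congrFun h1 i
          simp only [par] at this
          simp only [Finset.mem_insert, Finset.mem_singleton]
          omega
        · exact zero_le
        · exact le_rfl
  have hgroup : ∀ g : (Fin d → ℤ) → ℝ≥0∞, ∑' n, g n = ∑' q, ∑' n, if par n = q then g n else 0 := by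
    intro g
    rw [ENNReal.tsum_comm]
    refine tsum_congr fun n => ?_
    rw [tsum_eq_single (par n) (fun q hq => if_neg hq.symm), if_pos rfl]
  let μ' : Measure (Euc d) := Measure.sum fun n => a n • Measure.dirac (x n)
  have hμ' : ∀ B, MeasurableSet B → μ' B = ∑' n, a n * B.indicator 1 (x n) := by
    intro B hB
    simp only [μ', Measure.sum_apply _ hB, Measure.smul_apply, smul_eq_mul,
      Measure.dirac_apply' _ hB]
  have hμ'K : μ' Kᶜ = 0 := by
    simp only [μ', Measure.sum_apply_eq_zero, Measure.smul_apply, smul_eq_mul, mul_eq_zero]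
    intro n
    by_cases h : m (k + 1, n) = 0
    · exact Or.inl (ha0 n h)
    · refine Or.inr ?_
      simp [Measure.dirac_apply, (hx n h).1]
  have hcells : ∑' q, μ (dyadicCell (k, q)) = μ univ := by
    rw [← iUnion_dyadicCell k, measure_iUnion (pairwise_disjoint_dyadicCell k)
      fun n => measurableSet_dyadicCell _]
  refine ⟨μ', hμ'K, ?_, fun p hp => ?_⟩
  · rw [hμ' _ MeasurableSet.univ]
    simp only [indicator_univ, Pi.one_apply, mul_one]
    rw [hgroup, ← hcells]
    exact tsum_congr hSum
  · rw [hμ' _ (measurableSet_dyadicCell p)]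
    rcases hp.lt_or_eq with hlt | heq
    · have hle : p.1 ≤ k := Nat.lt_succ_iff.1 hlt
      refine le_trans ?_ (hμ p hle)
      rw [hgroup]
      calc _ ≤ ∑' q, μ (dyadicCell (k, q) ∩ dyadicCell p) := by
            refine ENNReal.tsum_le_tsum fun q => ?_
            by_cases hq : (dyadicCell p ∩ dyadicCell (k, q)).Nonempty
            · rw [inter_eq_left.2 (dyadicCell_subset (q := (k, q)) hle hq), ← hSum q]
              refine ENNReal.tsum_le_tsum fun n => ?_
              split_ifs
              · exact mul_le_of_le_one_right' (indicator_le_self' (fun _ _ => zero_le) _)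
              · exact le_rfl
            · refine le_of_eq_of_le ?_ (zero_le (a := μ _))
              refine ENNReal.tsum_eq_zero.2 fun n => ?_
              split_ifs with h
              · by_cases hn : m (k + 1, n) = 0
                · rw [ha0 n hn, zero_mul]
                · rw [indicator_of_notMem, mul_zero]
                  intro hxp
                  exact hq ⟨x n, hxp, h ▸ hpar n (hx n hn).2⟩
              · rfl
        _ = μ (dyadicCell p) := by
            rw [← measure_iUnion (fun m n hmn => ((pairwise_disjoint_dyadicCell k hmn).mono
              inter_subset_left inter_subset_left)) fun n =>
              (measurableSet_dyadicCell _).inter (measurableSet_dyadicCell _), ← iUnion_inter,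
              iUnion_dyadicCell, univ_inter]
    · obtain ⟨l, q⟩ := p
      simp only at heq
      subst heq
      rw [tsum_eq_single q]
      · refine (mul_le_of_le_one_right' (indicator_le_self' (f := (1 : Euc d → ℝ≥0∞))
          (fun _ _ => zero_le) (x q))).trans ?_
        simp only [a]
        by_cases hS0 : S (par q) = 0
        · rw [nonpos_iff_eq_zero.1 ((hμm (par q)).trans ((hmS (par q)).trans hS0.le)), zero_mul]
          exact zero_le
        · calc μ (dyadicCell (k, par q)) * (m (k + 1, q) / S (par q))
              ≤ S (par q) * (m (k + 1, q) / S (par q)) := by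
                gcongr
                exact (hμm _).trans (hmS _)
            _ ≤ m (k + 1, q) := ENNReal.mul_div_le
      · intro n hn
        by_cases hn0 : m (k + 1, n) = 0
        · rw [ha0 n hn0, zero_mul]
        · rw [indicator_of_notMem, mul_zero]
          intro hxq
          exact hn (congrArg Prod.snd (dyadicCell_eq (p := (k + 1, n)) (q := (k + 1, q)) rfl
            ⟨x n, (hx n hn0).2, hxq⟩))

end Frostman

section Frostman

variable {d : ℕ}

theorem exists_nat_pow_half_near {x : ℝ} (hx : 0 < x) (hx1 : x ≤ 1) :
    ∃ n : ℕ, (2 : ℝ)⁻¹ ^ (n + 1) < x ∧ x ≤ (2 : ℝ)⁻¹ ^ n :=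
  exists_nat_pow_near_of_lt_one hx hx1 (by norm_num) (by norm_num)

/-- Finite-scale Frostman measures on a set of positive dyadic content. -/
theorem exists_measure_dyadicCell_le {s : ℝ} {K : Set (Euc d)} (hK : 0 < dyadicContent s K) :
    ∃ m : ℝ≥0∞, m ≠ 0 ∧ m ≠ ∞ ∧ ∀ k : ℕ, ∃ μ : Measure (Euc d), μ Kᶜ = 0 ∧ μ univ = m ∧
      ∀ p : ℕ × (Fin d → ℤ), p.1 ≤ k → μ (dyadicCell p) ≤ dyadicContent s (K ∩ dyadicCell p) := by
  classical
  obtain ⟨n₀, hn₀⟩ : ∃ n : Fin d → ℤ, 0 < dyadicContent s (K ∩ dyadicCell (0, n)) := by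
    by_contra! h
    refine absurd hK (not_lt.2 ?_)
    have hK' : K = ⋃ n : Fin d → ℤ, K ∩ dyadicCell (0, n) := by
      rw [← inter_iUnion, iUnion_dyadicCell, inter_univ]
    rw [hK']
    refine (cellContent_iUnion_le _).trans ?_
    exact (ENNReal.tsum_eq_zero.2 fun n => nonpos_iff_eq_zero.1 (h n)).le
  refine ⟨dyadicContent s (K ∩ dyadicCell (0, n₀)), hn₀.ne', ?_, fun k => ?_⟩
  · exact ne_top_of_le_ne_top ENNReal.ofReal_ne_top
      ((cellContent_mono inter_subset_right).trans (dyadicContent_cell_le s _))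
  induction k with
  | zero =>
    obtain ⟨x, hx⟩ : (K ∩ dyadicCell (0, n₀)).Nonempty := by
      by_contra h
      rw [not_nonempty_iff_eq_empty] at h
      rw [h] at hn₀
      refine absurd hn₀ (not_lt.2 ?_)
      exact (cellContent_le (C := ∅) (by simp)).trans (by simp)
    refine ⟨dyadicContent s (K ∩ dyadicCell (0, n₀)) • Measure.dirac x, ?_, ?_, ?_⟩
    · simp [Measure.dirac_apply, hx.1]
    · simp
    · rintro ⟨l, n⟩ hl
      obtain rfl : l = 0 := Nat.le_zero.1 hl
      rw [Measure.smul_apply, smul_eq_mul, Measure.dirac_apply' _ (measurableSet_dyadicCell _)]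
      by_cases h : x ∈ dyadicCell (0, n)
      · have := dyadicCell_eq (p := (0, n)) (q := (0, n₀)) rfl ⟨x, h, hx.2⟩
        rw [this]
        exact mul_le_of_le_one_right' (indicator_le_self' (f := (1 : Euc d → ℝ≥0∞))
          (fun _ _ => zero_le) x)
      · rw [indicator_of_notMem h, mul_zero]
        exact zero_le
  | succ k ih =>
    obtain ⟨μ, -, hμ, hle⟩ := ih
    obtain ⟨μ', h1, h2, h3⟩ := exists_measure_refine k μ hle
    exact ⟨μ', h1, h2.trans hμ, h3⟩

/-- **Frostman's lemma** for analytic sets. -/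
theorem exists_frostman_measure {s : NNReal} (hs : 0 < s) {A : Set (Euc d)} (hA : AnalyticSet A)
    (h : (s : ℝ≥0∞) < dimH A) :
    ∃ (K : Set (Euc d)) (μ : Measure (Euc d)), IsCompact K ∧ K ⊆ A ∧ IsProbabilityMeasure μ ∧
      μ Kᶜ = 0 ∧ IsFrostman (s : ℝ) μ := by
  have hs0 : (0 : ℝ) < s := hs
  obtain ⟨K, hKA, hK, hpos⟩ :=
    exists_isCompact_dyadicContent_pos hA (dyadicContent_pos_of_lt_dimH hs h)
  obtain ⟨m, hm0, hmt, hμ⟩ := exists_measure_dyadicCell_le hpos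
  choose μ hμK hμm hμc using hμ
  let P : ℕ → ProbabilityMeasure (Euc d) := fun k => ⟨m⁻¹ • μ k, ⟨by
    rw [Measure.smul_apply, hμm, smul_eq_mul, ENNReal.inv_mul_cancel hm0 hmt]⟩⟩
  have hP : ∀ k B, (P k : Measure (Euc d)) B = m⁻¹ * μ k B := fun k B => rfl
  have hcpt := isCompact_setOfPred_probabilityMeasure_mass_eq_compl_isCompact_le
    (E := Euc d) (u := fun _ => 0) (K := fun _ : ℕ => K) tendsto_const_nhds (fun _ => hK)
    (Or.inl inferInstance)
  obtain ⟨ν, hνK, hν⟩ := hcpt.ultrafilter_le_nhds ((Filter.hyperfilter ℕ).map P) (by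
    rw [Filter.le_principal_iff, Ultrafilter.mem_coe, Ultrafilter.mem_map]
    refine Filter.univ_mem' fun k n => ?_
    have : (P k : Measure (Euc d)) Kᶜ = 0 := by rw [hP, hμK, mul_zero]
    exact ((ProbabilityMeasure.null_iff_toMeasure_null (P k) Kᶜ).2 this).le)
  have hlim : Filter.Tendsto P (Filter.hyperfilter ℕ) (nhds ν) := hν
  have hνK' : (ν : Measure (Euc d)) Kᶜ = 0 := by
    have := hνK 0
    rw [nonpos_iff_eq_zero, ProbabilityMeasure.null_iff_toMeasure_null] at this
    exact this
  refine ⟨K, ν, hK, hKA, inferInstance, hνK', m⁻¹.toReal * 3 ^ d * 4 ^ (s : ℝ) + 2 ^ (s : ℝ), ?_⟩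
  intro x r hr
  have hA0 : 0 ≤ m⁻¹.toReal * 3 ^ d * 4 ^ (s : ℝ) * r ^ (s : ℝ) := by positivity
  have hB0 : 0 ≤ (2 : ℝ) ^ (s : ℝ) * r ^ (s : ℝ) := by positivity
  rcases le_or_gt (2 * r) 1 with h1 | h1
  · obtain ⟨l, hl1, hl2⟩ := exists_nat_pow_half_near (by positivity) h1
    have hbound : ∀ k, l ≤ k → (P k : Measure (Euc d)) (ball x (2 * r)) ≤
        ENNReal.ofReal (m⁻¹.toReal * 3 ^ d * 4 ^ (s : ℝ) * r ^ (s : ℝ)) := by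
      intro k hk
      have hsub : ball x (2 * r) ⊆ ⋃ q ∈ neighbours (l, dyadicLabel l x), dyadicCell q := by
        intro y hy
        refine mem_iUnion₂.2 ⟨_, mem_neighbours_of_dist_lt ?_, mem_dyadicCell_label l y⟩
        exact (mem_ball'.1 hy).trans_le hl2
      have hw : ∀ q ∈ neighbours (l, dyadicLabel l x),
          μ k (dyadicCell q) ≤ ENNReal.ofReal ((4 * r) ^ (s : ℝ)) := by
        intro q hq
        have hq1 : q.1 = l := by
          obtain ⟨v, -, rfl⟩ := Finset.mem_image.1 hq
          rfl
        refine (hμc k q (hq1.trans_le hk)).trans ((cellContent_mono inter_subset_right).trans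
          ((dyadicContent_cell_le _ q).trans (ENNReal.ofReal_le_ofReal ?_)))
        rw [hq1]
        refine Real.rpow_le_rpow (by positivity) ?_ hs0.le
        rw [pow_succ] at hl1
        linarith
      calc (P k : Measure (Euc d)) (ball x (2 * r)) = m⁻¹ * μ k (ball x (2 * r)) := hP _ _
        _ ≤ m⁻¹ * ((3 : ℕ) ^ d * ENNReal.ofReal ((4 * r) ^ (s : ℝ))) := by
            gcongr
            refine (measure_mono hsub).trans ((measure_biUnion_finset_le _ _).trans ?_)
            refine (Finset.sum_le_card_nsmul _ _ _ hw).trans ?_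
            rw [nsmul_eq_mul]
            gcongr
            exact_mod_cast card_neighbours_le _
        _ = _ := by
            rw [Real.mul_rpow (by positivity) hr.le]
            conv_lhs => rw [← ENNReal.ofReal_toReal (ENNReal.inv_ne_top.2 hm0)]
            rw [← ENNReal.ofReal_natCast, ← ENNReal.ofReal_pow (by positivity),
              ← ENNReal.ofReal_mul (by positivity), ← ENNReal.ofReal_mul (by positivity)]
            congr 1
            push_cast
            ring
    calc (ν : Measure (Euc d)) (closedBall x r) ≤ (ν : Measure (Euc d)) (ball x (2 * r)) :=
          measure_mono (closedBall_subset_ball (by linarith))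
      _ ≤ Filter.liminf (fun k => (P k : Measure (Euc d)) (ball x (2 * r)))
            (Filter.hyperfilter ℕ) :=
          ProbabilityMeasure.le_liminf_measure_open_of_tendsto hlim isOpen_ball
      _ ≤ ENNReal.ofReal (m⁻¹.toReal * 3 ^ d * 4 ^ (s : ℝ) * r ^ (s : ℝ)) := by
          refine Filter.liminf_le_of_frequently_le' (Filter.Eventually.frequently ?_)
          refine Filter.Eventually.filter_mono (Nat.hyperfilter_le_atTop) ?_
          filter_upwards [Filter.eventually_ge_atTop l] with k hk using hbound k hk
      _ ≤ _ := ENNReal.ofReal_le_ofReal (by rw [add_mul]; linarith)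
  · refine prob_le_one.trans ?_
    rw [← ENNReal.ofReal_one]
    refine ENNReal.ofReal_le_ofReal ?_
    have h2 : (1 : ℝ) ≤ (2 * r) ^ (s : ℝ) := Real.one_le_rpow h1.le hs0.le
    rw [Real.mul_rpow (by norm_num) hr.le] at h2
    rw [add_mul]
    linarith

end Frostman

/-! ### Fourier transforms of measures on spheres -/

theorem sq_integral_mul_le {α : Type*} [MeasurableSpace α] {μ : Measure α} {f g : α → ℝ}
    (hf0 : 0 ≤ f) (hg0 : 0 ≤ g) (hf : MemLp f 2 μ) (hg : MemLp g 2 μ) :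
    (∫ x, f x * g x ∂μ) ^ 2 ≤ (∫ x, f x ^ 2 ∂μ) * ∫ x, g x ^ 2 ∂μ := by
  have h := integral_mul_le_Lp_mul_Lq_of_nonneg (μ := μ) Real.HolderConjugate.two_two
    (ae_of_all _ hf0) (ae_of_all _ hg0) (by simpa using hf) (by simpa using hg)
  have h0 : 0 ≤ ∫ x, f x * g x ∂μ := integral_nonneg fun x => mul_nonneg (hf0 x) (hg0 x)
  have h1 : 0 ≤ ∫ x, f x ^ 2 ∂μ := integral_nonneg fun x => sq_nonneg _
  have h2 : 0 ≤ ∫ x, g x ^ 2 ∂μ := integral_nonneg fun x => sq_nonneg _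
  simp only [Real.rpow_two] at h
  rw [← Real.sqrt_eq_rpow, ← Real.sqrt_eq_rpow] at h
  calc _ ≤ (√(∫ x, f x ^ 2 ∂μ) * √(∫ x, g x ^ 2 ∂μ)) ^ 2 := by gcongr
    _ = _ := by rw [mul_pow, Real.sq_sqrt h1, Real.sq_sqrt h2]

/-- The unit sphere of `ℝ^d`. -/
abbrev USphere (d : ℕ) := sphere (0 : EuclideanSpace ℝ (Fin d)) 1

section Basic

variable {d : ℕ}

instance [NeZero d] : Nontrivial (EuclideanSpace ℝ (Fin d)) := by
  have : Nonempty (Fin d) := ⟨0⟩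
  infer_instance

instance [NeZero d] : IsProbabilityMeasure (normalizedSphereMeasure d) := by
  constructor
  rw [normalizedSphereMeasure, Measure.smul_apply, smul_eq_mul]
  refine ENNReal.inv_mul_cancel ?_ (measure_ne_top _ _)
  rw [Measure.measure_univ_ne_zero]
  exact Measure.toSphere_ne_zero _

theorem fourierMeasure_eq_charFun (μ : Measure (Euc d)) (ξ : Euc d) :
    fourierMeasure μ ξ = charFun μ (-(2 * Real.pi) • ξ) := by
  simp only [fourierMeasure, charFun_apply, inner_smul_right]
  congr with x
  push_cast
  ring_nf

theorem continuous_fourierMeasure (μ : Measure (Euc d)) [IsFiniteMeasure μ] :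
    Continuous (fourierMeasure μ) := by
  have h : fourierMeasure μ = fun ξ => charFun μ (-(2 * Real.pi) • ξ) :=
    funext (fourierMeasure_eq_charFun μ)
  rw [h]
  fun_prop

theorem norm_fourierMeasure_le (μ : Measure (Euc d)) [IsFiniteMeasure μ] (ξ : Euc d) :
    ‖fourierMeasure μ ξ‖ ≤ μ.real univ := by
  rw [fourierMeasure_eq_charFun]
  exact norm_charFun_le _

theorem continuous_fourierMeasure_sphere (μ : Measure (Euc d)) [IsFiniteMeasure μ] (r : ℝ) :
    Continuous fun ω : USphere d => fourierMeasure μ (r • (ω : Euc d)) :=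
  (continuous_fourierMeasure μ).comp (by fun_prop)

theorem integrable_of_continuous_sphere [NeZero d] {F : Type*} [NormedAddCommGroup F]
    {f : USphere d → F} (hf : Continuous f) : Integrable f (normalizedSphereMeasure d) :=
  hf.integrable_of_hasCompactSupport (HasCompactSupport.of_compactSpace f)

theorem memLp_of_continuous_sphere [NeZero d] {F : Type*} [NormedAddCommGroup F]
    {f : USphere d → F} (hf : Continuous f) (p : ℝ≥0∞) : MemLp f p (normalizedSphereMeasure d) :=
  hf.memLp_of_hasCompactSupport (HasCompactSupport.of_compactSpace f)

theorem integrable_fourierMeasure_integrand (μ : Measure (Euc d)) [IsFiniteMeasure μ] (ξ : Euc d) :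
    Integrable (fun x => Complex.exp (((-2 * Real.pi * ⟪x, ξ⟫ : ℝ) : ℂ) * Complex.I)) μ := by
  refine (integrable_const (1 : ℝ)).mono' (by fun_prop) (ae_of_all _ fun x => ?_)
  rw [Complex.norm_exp_ofReal_mul_I]

theorem fourierMeasure_add (μ ν : Measure (Euc d)) [IsFiniteMeasure μ] [IsFiniteMeasure ν]
    (ξ : Euc d) : fourierMeasure (μ + ν) ξ = fourierMeasure μ ξ + fourierMeasure ν ξ :=
  integral_add_measure (integrable_fourierMeasure_integrand μ ξ)
    (integrable_fourierMeasure_integrand ν ξ)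

theorem fourierMeasure_smul (μ : Measure (Euc d)) (c : ℝ≥0∞) (ξ : Euc d) :
    fourierMeasure (c • μ) ξ = c.toReal * fourierMeasure μ ξ := by
  rw [fourierMeasure, integral_smul_measure]
  simp [fourierMeasure]

theorem sphericalAverage_nonneg (μ : Measure (Euc d)) (r : ℝ) : 0 ≤ sphericalAverage μ r :=
  integral_nonneg fun _ => by positivity

theorem sphericalAverage_smul (μ : Measure (Euc d)) (c : ℝ≥0∞) (r : ℝ) :
    sphericalAverage (c • μ) r = c.toReal ^ 2 * sphericalAverage μ r := by
  simp_rw [sphericalAverage, fourierMeasure_smul, norm_mul, mul_pow]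
  rw [integral_const_mul]
  simp

/-- The extension operator: the inverse Fourier transform of `h dω` on the sphere of radius `r`. -/
noncomputable def sphereExtension (h : USphere d → ℂ) (r : ℝ) (x : Euc d) : ℂ :=
  ∫ ω, h ω * Complex.exp (((2 * Real.pi * ⟪x, r • (ω : Euc d)⟫ : ℝ) : ℂ) * Complex.I)
    ∂(normalizedSphereMeasure d)

theorem norm_sphereExtension_le (h : USphere d → ℂ) (r : ℝ) (x : Euc d) :
    ‖sphereExtension h r x‖ ≤ ∫ ω, ‖h ω‖ ∂(normalizedSphereMeasure d) := by
  refine (norm_integral_le_integral_norm _).trans (le_of_eq ?_)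
  congr with ω
  rw [norm_mul, Complex.norm_exp_ofReal_mul_I, mul_one]

theorem continuous_sphereExtension [NeZero d] {h : USphere d → ℂ} (hh : Continuous h) (r : ℝ) :
    Continuous (sphereExtension h r) := by
  refine continuous_of_dominated (bound := fun ω => ‖h ω‖) (fun x => ?_) (fun x => ?_)
    (integrable_of_continuous_sphere hh.norm) (ae_of_all _ fun ω => by fun_prop)
  · exact Continuous.aestronglyMeasurable (by fun_prop)
  · refine ae_of_all _ fun ω => ?_
    rw [norm_mul, Complex.norm_exp_ofReal_mul_I, mul_one]

/-- Duality between restriction and extension. -/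
theorem integral_sphereExtension [NeZero d] {h : USphere d → ℂ} (hh : Continuous h) (r : ℝ)
    (m : Measure (Euc d)) [IsFiniteMeasure m] :
    ∫ x, sphereExtension h r x ∂m = ∫ ω : USphere d,
      h ω * (starRingEnd ℂ) (fourierMeasure m (r • (ω : Euc d))) ∂(normalizedSphereMeasure d) := by
  unfold sphereExtension
  rw [integral_integral_swap]
  · congr with ω
    rw [integral_const_mul, fourierMeasure, ← integral_conj]
    congr with x
    rw [← Complex.exp_conj, map_mul, Complex.conj_I, Complex.conj_ofReal]
    congr 1
    push_cast
    ring
  · have hcont : Continuous (Function.uncurry fun (x : Euc d) (ω : USphere d) =>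
        h ω * Complex.exp (((2 * Real.pi * ⟪x, r • (ω : Euc d)⟫ : ℝ) : ℂ) * Complex.I)) := by
      unfold Function.uncurry
      fun_prop
    obtain ⟨B, hB⟩ := (isCompact_range hh).isBounded.exists_norm_le
    refine (integrable_const B).mono' hcont.aestronglyMeasurable (ae_of_all _ fun p => ?_)
    rw [Function.uncurry, norm_mul, Complex.norm_exp_ofReal_mul_I, mul_one]
    exact hB _ (mem_range_self _)

theorem sq_norm_integral_sphereExtension_le [NeZero d] {h : USphere d → ℂ} (hh : Continuous h)
    (r : ℝ) (m : Measure (Euc d)) [IsFiniteMeasure m] :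
    ‖∫ x, sphereExtension h r x ∂m‖ ^ 2 ≤
      (∫ ω, ‖h ω‖ ^ 2 ∂(normalizedSphereMeasure d)) * sphericalAverage m r := by
  rw [integral_sphereExtension hh]
  have hc := continuous_fourierMeasure_sphere m r
  calc _ ≤ (∫ ω : USphere d, ‖h ω‖ * ‖fourierMeasure m (r • (ω : Euc d))‖
        ∂(normalizedSphereMeasure d)) ^ 2 := by
        gcongr
        refine (norm_integral_le_integral_norm _).trans (le_of_eq ?_)
        simp
    _ ≤ _ := sq_integral_mul_le (fun _ => norm_nonneg _) (fun _ => norm_nonneg _)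
        (memLp_of_continuous_sphere hh.norm _) (memLp_of_continuous_sphere hc.norm _)

end Basic

/-! ### Mollification -/

section Mollify

variable {d : ℕ}

/-- The uniform probability measure on the ball of radius `δ`. -/
noncomputable def ballMeasure (d : ℕ) (δ : ℝ) : Measure (Euc d) :=
  ProbabilityTheory.cond volume (closedBall 0 δ)

theorem isProbabilityMeasure_ballMeasure {δ : ℝ} (hδ : 0 < δ) :
    IsProbabilityMeasure (ballMeasure d δ) := by
  refine ProbabilityTheory.cond_isProbabilityMeasure_of_finite ?_ measure_closedBall_lt_top.ne
  exact (measure_closedBall_pos _ _ hδ).ne'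

theorem ballMeasure_compl (δ : ℝ) : ballMeasure d δ (closedBall 0 δ)ᶜ = 0 := by
  rw [ballMeasure, ProbabilityTheory.cond_apply isClosed_closedBall.measurableSet]
  simp

theorem ballMeasure_closedBall_le {δ : ℝ} (hδ : 0 < δ) (x : Euc d) {r : ℝ} (hr : 0 ≤ r) :
    ballMeasure d δ (closedBall x r) ≤ ENNReal.ofReal ((r / δ) ^ d) := by
  rw [ballMeasure, ProbabilityTheory.cond_apply isClosed_closedBall.measurableSet,
    ENNReal.inv_mul_le_iff (measure_closedBall_pos _ _ hδ).ne' measure_closedBall_lt_top.ne]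
  refine (measure_mono inter_subset_right).trans ?_
  have hrδ : r = (r / δ) * δ := by field_simp
  conv_lhs => rw [hrδ, Measure.addHaar_closedBall_mul _ _ (by positivity) hδ.le]
  rw [finrank_euclideanSpace_fin, mul_comm]

theorem half_le_norm_fourierMeasure_ballMeasure {δ : ℝ} (hδ : 0 < δ) {ξ : Euc d}
    (hξ : 16 * δ * ‖ξ‖ ≤ 1) : 1 / 2 ≤ ‖fourierMeasure (ballMeasure d δ) ξ‖ := by
  have := isProbabilityMeasure_ballMeasure (d := d) hδ
  have hpi := Real.pi_lt_four
  have h1 : ‖∫ x, (Complex.exp (((-2 * Real.pi * ⟪x, ξ⟫ : ℝ) : ℂ) * Complex.I) - 1)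
      ∂(ballMeasure d δ)‖ ≤ 1 / 2 * (ballMeasure d δ).real univ := by
    refine norm_integral_le_of_norm_le_const ?_
    have : ∀ᵐ x ∂(ballMeasure d δ), x ∈ closedBall (0 : Euc d) δ := ballMeasure_compl δ
    filter_upwards [this] with x hx
    rw [mul_comm _ Complex.I]
    refine (Real.norm_exp_I_mul_ofReal_sub_one_le).trans ?_
    rw [Real.norm_eq_abs, abs_mul, abs_mul, abs_of_pos Real.pi_pos]
    have h2 : |⟪x, ξ⟫| ≤ δ * ‖ξ‖ := (abs_real_inner_le_norm x ξ).trans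
      (mul_le_mul_of_nonneg_right (mem_closedBall_zero_iff.1 hx) (norm_nonneg _))
    have h3 : 0 ≤ δ * ‖ξ‖ := by positivity
    norm_num
    nlinarith [abs_nonneg ⟪x, ξ⟫]
  rw [integral_sub (integrable_fourierMeasure_integrand _ ξ) (integrable_const _)] at h1
  simp only [integral_const, probReal_univ, one_smul, mul_one] at h1
  change ‖fourierMeasure (ballMeasure d δ) ξ - 1‖ ≤ _ at h1
  have h4 := norm_sub_norm_le (1 : ℂ) (1 - fourierMeasure (ballMeasure d δ) ξ)
  rw [norm_sub_rev] at h1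
  rw [norm_one, sub_sub_cancel] at h4
  linarith

theorem fourierMeasure_conv (μ ν : Measure (Euc d)) [IsFiniteMeasure μ] [IsFiniteMeasure ν]
    (ξ : Euc d) :
    fourierMeasure (μ.conv ν) ξ = fourierMeasure μ ξ * fourierMeasure ν ξ := by
  simp only [fourierMeasure_eq_charFun]
  exact charFun_conv _

theorem sphericalAverage_le_conv_ballMeasure [NeZero d] (μ : Measure (Euc d)) [IsFiniteMeasure μ]
    {δ R : ℝ} (hδ : 0 < δ) (hR : 0 ≤ R) (h : 16 * δ * R ≤ 1) :
    sphericalAverage μ R ≤ 4 * sphericalAverage (μ.conv (ballMeasure d δ)) R := by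
  have := isProbabilityMeasure_ballMeasure (d := d) hδ
  rw [sphericalAverage, sphericalAverage, ← integral_const_mul]
  refine integral_mono
    (integrable_of_continuous_sphere ((continuous_fourierMeasure_sphere _ R).norm.pow 2))
    ((integrable_of_continuous_sphere
      ((continuous_fourierMeasure_sphere _ R).norm.pow 2)).const_mul 4) fun ω => ?_
  have h1 := half_le_norm_fourierMeasure_ballMeasure (d := d) (ξ := R • (ω : Euc d)) hδ (by
    rwa [norm_smul, norm_eq_of_mem_sphere, mul_one, Real.norm_of_nonneg hR])
  dsimp only
  rw [fourierMeasure_conv, norm_mul, mul_pow]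
  have h2 : 1 ≤ 4 * ‖fourierMeasure (ballMeasure d δ) (R • (ω : Euc d))‖ ^ 2 := by nlinarith
  nlinarith [sq_nonneg ‖fourierMeasure μ (R • (ω : Euc d))‖]

theorem conv_apply_closedBall_le (μ ν : Measure (Euc d)) [SFinite μ] [SFinite ν]
    {δ : ℝ} (hν : ν (closedBall 0 δ)ᶜ = 0) (x : Euc d) (r : ℝ) {c : ℝ≥0∞}
    (hc : ∀ y, ν (closedBall y r) ≤ c) :
    (μ.conv ν) (closedBall x r) ≤ c * μ (closedBall x (r + δ)) := by
  have hm : MeasurableSet (closedBall x r) := isClosed_closedBall.measurableSet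
  rw [← lintegral_indicator_one hm, Measure.lintegral_conv (measurable_one.indicator hm),
    ← lintegral_indicator_const (isClosed_closedBall (x := x) (ε := r + δ)).measurableSet]
  refine lintegral_mono fun y => ?_
  have h1 : ∫⁻ z, (closedBall x r).indicator 1 (y + z) ∂ν = ν (closedBall (x - y) r) := by
    rw [← lintegral_indicator_one isClosed_closedBall.measurableSet]
    congr with z
    have : y + z ∈ closedBall x r ↔ z ∈ closedBall (x - y) r := by
      rw [mem_closedBall, mem_closedBall, dist_eq_norm, dist_eq_norm]
      congr! 2
      abel
    by_cases hz : z ∈ closedBall (x - y) r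
    · rw [indicator_of_mem hz, indicator_of_mem (this.2 hz), Pi.one_apply, Pi.one_apply]
    · rw [indicator_of_notMem hz, indicator_of_notMem (mt this.1 hz)]
  rw [h1]
  by_cases hy : y ∈ closedBall x (r + δ)
  · rw [indicator_of_mem hy]
    exact hc _
  · rw [indicator_of_notMem hy]
    have hsub : closedBall (x - y) r ⊆ (closedBall 0 δ)ᶜ := by
      intro z hz hzδ
      refine hy ?_
      rw [mem_closedBall, dist_eq_norm] at *
      calc ‖y - x‖ = ‖(z - (x - y)) - (z - 0)‖ := by
            congr 1
            abel
        _ ≤ _ := (norm_sub_le _ _).trans (add_le_add hz hzδ)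
    exact (measure_mono_null hsub hν).le

theorem conv_compl_closedBall (μ ν : Measure (Euc d)) [SFinite μ] [SFinite ν] {M δ : ℝ}
    (hμ : μ (closedBall 0 M)ᶜ = 0) (hν : ν (closedBall 0 δ)ᶜ = 0) :
    (μ.conv ν) (closedBall 0 (M + δ))ᶜ = 0 := by
  have hm : MeasurableSet (closedBall (0 : Euc d) (M + δ))ᶜ :=
    isClosed_closedBall.measurableSet.compl
  rw [← lintegral_indicator_one hm, Measure.lintegral_conv (measurable_one.indicator hm)]
  refine lintegral_eq_zero_of_ae_eq_zero ?_
  have h1 : ∀ᵐ y ∂μ, y ∈ closedBall (0 : Euc d) M := hμ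
  have h2 : ∀ᵐ z ∂ν, z ∈ closedBall (0 : Euc d) δ := hν
  filter_upwards [h1] with y hy
  refine lintegral_eq_zero_of_ae_eq_zero ?_
  filter_upwards [h2] with z hz
  refine indicator_of_notMem (not_not.2 ?_) _
  rw [mem_closedBall_zero_iff] at *
  exact (norm_add_le _ _).trans (add_le_add hy hz)

end Mollify

/-! ### Uniformity of the spherical decay -/

section Uniform

variable {d : ℕ}

theorem SphericalDecay.exists_bound {s b : ℝ} (h : SphericalDecay d s b) {M κ ε : ℝ} (hε : 0 < ε)
    (μ : Measure (Euc d)) [IsFiniteMeasure μ] (hM : μ (closedBall 0 M)ᶜ = 0)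
    (hF : ∀ x r, 0 < r → μ (closedBall x r) ≤ ENNReal.ofReal (κ * r ^ s)) :
    ∃ C : ℝ, 0 ≤ C ∧ ∀ r : ℝ, 1 ≤ r → sphericalAverage μ r ≤ C * r ^ (-b + ε) := by
  by_cases h0 : μ univ = 0
  · refine ⟨0, le_rfl, fun r _ => ?_⟩
    rw [Measure.measure_univ_eq_zero] at h0
    simp [h0, sphericalAverage, fourierMeasure]
  have ht : μ univ ≠ ∞ := measure_ne_top _ _
  have hprob : IsProbabilityMeasure ((μ univ)⁻¹ • μ) := ⟨by
    rw [Measure.smul_apply, smul_eq_mul, ENNReal.inv_mul_cancel h0 ht]⟩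
  obtain ⟨C, hC⟩ := h ((μ univ)⁻¹ • μ) hprob
    ⟨closedBall 0 M, isCompact_closedBall _ _, by rw [Measure.smul_apply, hM, smul_zero]⟩
    ⟨((μ univ)⁻¹).toReal * κ, fun x r hr => by
      rw [Measure.smul_apply, smul_eq_mul, mul_assoc, ENNReal.ofReal_mul ENNReal.toReal_nonneg,
        ENNReal.ofReal_toReal (ENNReal.inv_ne_top.2 h0)]
      gcongr
      exact hF x r hr⟩ ε hε
  have hμ : μ = μ univ • ((μ univ)⁻¹ • μ) := by
    rw [smul_smul, ENNReal.mul_inv_cancel h0 ht, one_smul]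
  have hC0 : 0 ≤ C := by
    have := (sphericalAverage_nonneg _ _).trans (hC 1 le_rfl)
    simpa using this
  refine ⟨(μ univ).toReal ^ 2 * C, by positivity, fun r hr => ?_⟩
  conv_lhs => rw [hμ]
  rw [sphericalAverage_smul, mul_assoc]
  gcongr
  exact hC r hr

theorem sum_smul_apply_le {A : ℝ} {a : ℕ → ℝ} (haA : ∀ n, a n ≤ A)
    (μ : ℕ → Measure (Euc d)) {B : Set (Euc d)} (hB : MeasurableSet B) {t : ℝ} (ht : 0 ≤ t)
    (h : ∀ n, μ n B ≤ ENNReal.ofReal t) :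
    (Measure.sum fun n => ENNReal.ofReal (a n * 2⁻¹ ^ n) • μ n) B
      ≤ ENNReal.ofReal (2 * A * t) := by
  rw [Measure.sum_apply _ hB]
  have hsum : ∑' n : ℕ, ENNReal.ofReal ((2 : ℝ)⁻¹ ^ n) = 2 := by
    rw [← ENNReal.ofReal_tsum_of_nonneg (fun n => by positivity)
      (summable_geometric_of_lt_one (by norm_num) (by norm_num)),
      tsum_geometric_of_lt_one (by norm_num) (by norm_num)]
    norm_num
  calc ∑' n, (ENNReal.ofReal (a n * 2⁻¹ ^ n) • μ n) B
      ≤ ∑' n : ℕ, ENNReal.ofReal A * ENNReal.ofReal t * ENNReal.ofReal ((2 : ℝ)⁻¹ ^ n) := by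
        refine ENNReal.tsum_le_tsum fun n => ?_
        rw [Measure.smul_apply, smul_eq_mul, mul_right_comm,
          ← ENNReal.ofReal_mul' (by positivity : (0 : ℝ) ≤ 2⁻¹ ^ n)]
        gcongr
        exacts [haA n, h n]
    _ = ENNReal.ofReal (2 * A * t) := by
        rw [ENNReal.tsum_mul_left, hsum, mul_assoc 2 A t, ENNReal.ofReal_mul zero_le_two,
          ENNReal.ofReal_mul' ht, mul_comm]
        norm_num

/-- The functional `a ↦ ∑ a_n 2^{-n} g_n` on bounded sequences. -/
noncomputable def weightedSum (g : ℕ → ℝ) (B : ℝ) (hg : ∀ n, |g n| ≤ B) : (ℕ →ᵇ ℝ) →L[ℝ] ℝ :=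
  have hs : ∀ a : ℕ →ᵇ ℝ, Summable fun n => a n * 2⁻¹ ^ n * g n := fun a => by
    refine Summable.of_norm_bounded (g := fun n : ℕ => ‖a‖ * B * 2⁻¹ ^ n)
      ((summable_geometric_of_lt_one (by norm_num) (by norm_num)).mul_left _) fun n => ?_
    rw [norm_mul, norm_mul, mul_right_comm, Real.norm_of_nonneg (by positivity : (0 : ℝ) ≤ 2⁻¹ ^ n)]
    gcongr
    · exact a.norm_coe_le_norm n
    · exact hg n
  LinearMap.mkContinuous
    { toFun := fun a => ∑' n, a n * 2⁻¹ ^ n * g n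
      map_add' := fun a a' => by
        rw [← (hs a).tsum_add (hs a')]
        refine tsum_congr fun n => ?_
        rw [BoundedContinuousFunction.add_apply]
        ring
      map_smul' := fun c a => by
        rw [RingHom.id_apply, smul_eq_mul, ← tsum_mul_left]
        refine tsum_congr fun n => ?_
        rw [BoundedContinuousFunction.smul_apply, smul_eq_mul]
        ring }
    (B * 2) fun a => by
      have h1 : HasSum (fun n : ℕ => ‖a‖ * B * 2⁻¹ ^ n) (‖a‖ * B * 2) := by
        have := (hasSum_geometric_of_lt_one (r := (2 : ℝ)⁻¹) (by norm_num) (by norm_num))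
        have := this.mul_left (‖a‖ * B)
        norm_num at this ⊢
        exact this
      refine (tsum_of_norm_bounded h1 fun n => ?_).trans (by linarith)
      rw [norm_mul, norm_mul, mul_right_comm,
        Real.norm_of_nonneg (by positivity : (0 : ℝ) ≤ 2⁻¹ ^ n)]
      gcongr
      · exact a.norm_coe_le_norm n
      · exact hg n

theorem weightedSum_apply (g : ℕ → ℝ) (B : ℝ) (hg : ∀ n, |g n| ≤ B) (a : ℕ →ᵇ ℝ) :
    weightedSum g B hg a = ∑' n, a n * 2⁻¹ ^ n * g n := rfl

/-- The constant in the spherical decay estimate may be chosen uniformly over all measures in a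
fixed ball with ball condition `μ(B(x,r)) ≤ r^s`. -/
theorem SphericalDecay.uniform [NeZero d] {s b : ℝ} (h : SphericalDecay d s b) (M : ℝ) {ε : ℝ}
    (hε : 0 < ε) :
    ∃ C : ℝ, 0 ≤ C ∧ ∀ R : ℝ, 1 ≤ R → ∀ μ : Measure (Euc d), IsFiniteMeasure μ →
      μ (closedBall 0 M)ᶜ = 0 →
      (∀ x r, 0 < r → μ (closedBall x r) ≤ ENNReal.ofReal (r ^ s)) →
      sphericalAverage μ R ≤ C * R ^ (-b + ε) := by
  by_contra! hcon
  choose R hR μ hμfin hμM hμF hlarge using fun n : ℕ => hcon (16 ^ n) (by positivity)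
  set M' := max M 1 with hM'
  have hM'1 : 1 ≤ M' := le_max_right _ _
  have hball : ∀ n, μ n univ ≤ ENNReal.ofReal (M' ^ s) := by
    intro n
    have h1 : μ n (closedBall 0 M')ᶜ = 0 :=
      measure_mono_null (compl_subset_compl.2 (closedBall_subset_closedBall (le_max_left _ _)))
        (hμM n)
    rw [← measure_of_measure_compl_eq_zero h1]
    exact hμF n 0 M' (by positivity)
  let m : (ℕ → ℝ) → Measure (Euc d) := fun a =>
    Measure.sum fun n => ENNReal.ofReal (a n * 2⁻¹ ^ n) • μ n
  have hmF : ∀ a A, (∀ n, a n ≤ A) → ∀ x r, 0 < r →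
      m a (closedBall x r) ≤ ENNReal.ofReal (2 * A * r ^ s) := fun a A haA x r hr =>
    sum_smul_apply_le haA μ isClosed_closedBall.measurableSet (by positivity)
      fun n => hμF n x r hr
  have hmfin : ∀ a A, (∀ n, a n ≤ A) → IsFiniteMeasure (m a) := fun a A haA =>
    ⟨(sum_smul_apply_le haA μ MeasurableSet.univ (by positivity) hball).trans_lt
      ENNReal.ofReal_lt_top⟩
  have hmM : ∀ a, m a (closedBall 0 M)ᶜ = 0 := fun a => by
    simp only [m, Measure.sum_apply_eq_zero, Measure.smul_apply, hμM, smul_zero, implies_true]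
  let hh : ℕ → USphere d → ℂ := fun j ω => fourierMeasure (μ j) (R j • (ω : Euc d))
  have hhc : ∀ j, Continuous (hh j) := fun j => continuous_fourierMeasure_sphere _ _
  let σ : ℕ → ℝ := fun j => sphericalAverage (μ j) (R j)
  let D : ℕ → ℝ := fun j => R j ^ (-b + ε)
  have hD : ∀ j, 0 < D j := fun j => Real.rpow_pos_of_pos (by linarith [hR j]) _
  have hσ : ∀ j, 16 ^ j * D j < σ j := hlarge
  have hσ0 : ∀ j, 0 < σ j := fun j => lt_of_le_of_lt (by have := hD j; positivity) (hσ j)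
  let G : ℕ → Euc d → ℝ := fun j x => (sphereExtension (hh j) (R j) x).re
  have hGc : ∀ j, Continuous (G j) := fun j =>
    Complex.continuous_re.comp (continuous_sphereExtension (hhc j) _)
  have hGb : ∀ j x, ‖G j x‖ ≤ ∫ ω, ‖hh j ω‖ ∂(normalizedSphereMeasure d) := fun j x =>
    (Complex.abs_re_le_norm _).trans (norm_sphereExtension_le _ _ _)
  have hint : ∀ j (ν : Measure (Euc d)) [IsFiniteMeasure ν], Integrable (G j) ν := fun j ν _ =>
    (integrable_const _).mono' (hGc j).aestronglyMeasurable (ae_of_all _ (hGb j))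
  have hGint : ∀ j (ν : Measure (Euc d)) [IsFiniteMeasure ν],
      ∫ x, G j x ∂ν = (∫ x, sphereExtension (hh j) (R j) x ∂ν).re := by
    intro j ν _
    refine integral_re ((integrable_const _).mono'
      (continuous_sphereExtension (hhc j) _).aestronglyMeasurable
      (ae_of_all _ (norm_sphereExtension_le _ _)))
  let g : ℕ → ℕ → ℝ := fun j n => ∫ x, G j x ∂(μ n)
  let B : ℕ → ℝ := fun j => (∫ ω, ‖hh j ω‖ ∂(normalizedSphereMeasure d)) * M' ^ s
  have hg : ∀ j n, |g j n| ≤ B j := by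
    intro j n
    refine (norm_integral_le_of_norm_le_const (ae_of_all _ (hGb j))).trans ?_
    refine mul_le_mul_of_nonneg_left ?_ (integral_nonneg fun _ => norm_nonneg _)
    · exact ENNReal.toReal_le_of_le_ofReal (by positivity) (hball n)
  let w : ℕ → ℝ := fun j => (√(D j * σ j))⁻¹
  have hw : ∀ j, w j ^ 2 = (D j * σ j)⁻¹ := fun j => by
    rw [inv_pow, Real.sq_sqrt (mul_pos (hD j) (hσ0 j)).le]
  let L : ℕ → (ℕ →ᵇ ℝ) →L[ℝ] ℝ := fun j => w j • weightedSum (g j) (B j) (hg j)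
  have hLpos : ∀ a : ℕ →ᵇ ℝ, (∀ n, 0 ≤ a n) → ∃ C, ∀ j, ‖L j a‖ ≤ C := by
    intro a ha
    have haA : ∀ n, a n ≤ ‖a‖ := fun n => (le_abs_self _).trans (a.norm_coe_le_norm n)
    have := hmfin a ‖a‖ haA
    obtain ⟨C, hC0, hC⟩ := h.exists_bound hε (m a) (hmM a) (hmF a ‖a‖ haA)
    refine ⟨√C, fun j => Real.abs_le_sqrt ?_⟩
    have h1 : weightedSum (g j) (B j) (hg j) a = ∫ x, G j x ∂(m a) := by
      rw [weightedSum_apply, integral_sum_measure (hint j (m a))]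
      refine tsum_congr fun n => ?_
      rw [integral_smul_measure, ENNReal.toReal_ofReal (by have := ha n; positivity), smul_eq_mul]
    have h2 := sq_norm_integral_sphereExtension_le (hhc j) (R j) (m a)
    have h3 : (∫ x, G j x ∂(m a)) ^ 2 ≤ σ j * (C * D j) := by
      rw [hGint]
      calc _ ≤ ‖∫ x, sphereExtension (hh j) (R j) x ∂(m a)‖ ^ 2 := by
            rw [← sq_abs]
            gcongr
            exact Complex.abs_re_le_norm _
        _ ≤ _ := h2
        _ ≤ _ := by
            refine mul_le_mul_of_nonneg_left (hC (R j) (hR j)) (hσ0 j).le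
    change (w j * weightedSum (g j) (B j) (hg j) a) ^ 2 ≤ C
    rw [h1, mul_pow, hw, inv_mul_le_iff₀ (mul_pos (hD j) (hσ0 j))]
    linarith
  have hL : ∀ a : ℕ →ᵇ ℝ, ∃ C, ∀ j, ‖L j a‖ ≤ C := by
    intro a
    obtain ⟨C₁, h₁⟩ := hLpos (a + BoundedContinuousFunction.const ℕ ‖a‖) fun n => by
      have := neg_abs_le (a n)
      have h2 : |a n| ≤ ‖a‖ := a.norm_coe_le_norm n
      simp only [BoundedContinuousFunction.add_apply, BoundedContinuousFunction.const_apply]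
      linarith
    obtain ⟨C₂, h₂⟩ := hLpos (BoundedContinuousFunction.const ℕ ‖a‖) fun n => norm_nonneg a
    refine ⟨C₁ + C₂, fun j => ?_⟩
    have h3 := h₁ j
    rw [map_add] at h3
    calc ‖L j a‖ = ‖(L j a + L j (BoundedContinuousFunction.const ℕ ‖a‖))
          - L j (BoundedContinuousFunction.const ℕ ‖a‖)‖ := by rw [add_sub_cancel_right]
      _ ≤ _ := (norm_sub_le _ _).trans (add_le_add h3 (h₂ j))
  obtain ⟨C, hC⟩ := banach_steinhaus hL
  have hfinal : ∀ j : ℕ, (4 : ℝ) ^ j ≤ C ^ 2 := by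
    intro j
    let e : ℕ →ᵇ ℝ := BoundedContinuousFunction.ofNormedAddCommGroupDiscrete (Pi.single j 1) 1
      fun n => by
        by_cases hn : n = j
        · simp [hn]
        · simp [hn]
    have he : ‖e‖ ≤ 1 := BoundedContinuousFunction.norm_ofNormedAddCommGroup_le _ zero_le_one _
    have h1 : ‖L j e‖ ≤ C := ((L j).le_of_opNorm_le (hC j) e).trans (by
      have hC0 : 0 ≤ C := (norm_nonneg _).trans (hC j)
      nlinarith)
    have h2 : L j e = w j * (2⁻¹ ^ j * σ j) := by
      change w j * weightedSum (g j) (B j) (hg j) e = _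
      rw [weightedSum_apply, tsum_eq_single j]
      · have : g j j = σ j := by
          simp only [g, hGint, σ]
          rw [integral_sphereExtension (hhc j), sphericalAverage, ← RCLike.re_eq_complex_re,
            ← integral_re]
          · congr with ω
            simp only [hh, Complex.mul_conj, RCLike.re_eq_complex_re, Complex.ofReal_re,
              Complex.normSq_eq_norm_sq]
          · exact integrable_of_continuous_sphere
              ((hhc j).mul (Complex.continuous_conj.comp (hhc j)))
        rw [this]
        have : e j = 1 := Pi.single_eq_same j 1
        rw [this, one_mul]
      · intro n hn
        have : e n = 0 := Pi.single_eq_of_ne hn 1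
        rw [this, zero_mul, zero_mul]
    have h3 : (L j e) ^ 2 ≤ C ^ 2 := by
      rw [← sq_abs]
      gcongr
      exact h1
    refine le_trans ?_ h3
    rw [h2, mul_pow, hw, mul_pow, inv_mul_eq_div, le_div_iff₀ (mul_pos (hD j) (hσ0 j)), ← pow_mul,
      mul_comm j 2, pow_mul]
    have h4 := hσ j
    have h5 := hσ0 j
    have h6 : ((2 : ℝ)⁻¹ ^ 2) ^ j * 16 ^ j = 4 ^ j := by
      rw [← mul_pow]
      norm_num
    calc (4 : ℝ) ^ j * (D j * σ j) = ((2 : ℝ)⁻¹ ^ 2) ^ j * (16 ^ j * D j) * σ j := by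
          rw [← h6]
          ring
      _ ≤ ((2 : ℝ)⁻¹ ^ 2) ^ j * σ j * σ j := by gcongr
      _ = _ := by ring
  obtain ⟨j, hj⟩ := pow_unbounded_of_one_lt (C ^ 2) (by norm_num : (1 : ℝ) < 4)
  exact absurd (hfinal j) (not_le.2 hj)

end Uniform

section UniformScale

variable {d : ℕ}

/-- The spherical decay at frequency `R` only depends on the ball condition at scales `≥ 1/R`. -/
theorem SphericalDecay.uniform_scale [NeZero d] {s b : ℝ} (h : SphericalDecay d s b) (hsd : s ≤ d) (M : ℝ) {ε : ℝ} (hε : 0 < ε) :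
    ∃ C : ℝ, 0 ≤ C ∧ ∀ R : ℝ, 1 ≤ R → ∀ κ : ℝ, 0 < κ → ∀ μ : Measure (Euc d), IsFiniteMeasure μ →
      μ (closedBall 0 M)ᶜ = 0 →
      (∀ x r, R⁻¹ ≤ r → μ (closedBall x r) ≤ ENNReal.ofReal (κ * r ^ s)) →
      sphericalAverage μ R ≤ C * κ ^ 2 * R ^ (-b + ε) := by
  obtain ⟨C, hC0, hC⟩ := h.uniform (M + 1) hε
  refine ⟨4 * (32 ^ d) ^ 2 * C, by positivity, fun R hR κ hκ μ _ hM hF => ?_⟩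
  have hR0 : 0 < R := by linarith
  set δ : ℝ := (16 * R)⁻¹ with hδdef
  have hδ : 0 < δ := by positivity
  have hδR : δ ≤ R⁻¹ := by
    rw [hδdef]
    gcongr
    linarith
  have hδ1 : δ ≤ 1 := hδR.trans (inv_le_one_of_one_le₀ hR)
  have := isProbabilityMeasure_ballMeasure (d := d) hδ
  set κ' : ℝ := 32 ^ d * κ with hκ'
  have hκ'0 : 0 < κ' := by positivity
  have h2s : (2 : ℝ) ^ s ≤ 2 ^ d := by
    rw [← Real.rpow_natCast]
    exact Real.rpow_le_rpow_of_exponent_le (by norm_num) hsd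
  have hconv : ∀ x r, 0 < r →
      (μ.conv (ballMeasure d δ)) (closedBall x r) ≤ ENNReal.ofReal (κ' * r ^ s) := by
    intro x r hr
    rcases le_or_gt r R⁻¹ with hrR | hrR
    · refine (conv_apply_closedBall_le μ _ (ballMeasure_compl δ) x r
        (fun y => ballMeasure_closedBall_le hδ y hr.le)).trans ?_
      calc _ ≤ ENNReal.ofReal ((r / δ) ^ d) * ENNReal.ofReal (κ * (2 * R⁻¹) ^ s) := by
            gcongr
            refine (measure_mono (closedBall_subset_closedBall ?_)).trans
              (hF x (2 * R⁻¹) (by have := inv_pos.2 hR0; linarith))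
            linarith
        _ ≤ _ := by
            rw [← ENNReal.ofReal_mul (by positivity)]
            refine ENNReal.ofReal_le_ofReal ?_
            have h1 : (r / δ) ^ d = 16 ^ d * (r * R) ^ d := by
              rw [hδdef, ← mul_pow]
              congr 1
              field_simp
            have h2 : (r * R) ^ d ≤ (r * R) ^ s := by
              rw [← Real.rpow_natCast]
              refine Real.rpow_le_rpow_of_exponent_ge (by positivity) ?_ hsd
              calc r * R ≤ R⁻¹ * R := by gcongr
                _ = 1 := inv_mul_cancel₀ hR0.ne'
            rw [h1, Real.mul_rpow zero_le_two (by positivity), Real.inv_rpow hR0.le]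
            rw [Real.mul_rpow hr.le hR0.le] at h2
            have hRs : 0 < R ^ s := by positivity
            calc 16 ^ d * (r * R) ^ d * (κ * (2 ^ s * (R ^ s)⁻¹))
                ≤ 16 ^ d * (r ^ s * R ^ s) * (κ * (2 ^ d * (R ^ s)⁻¹)) := by gcongr
              _ = (16 ^ d * 2 ^ d) * κ * r ^ s := by
                  field_simp
              _ = _ := by
                  rw [← mul_pow, hκ']
                  norm_num
    · refine (conv_apply_closedBall_le μ _ (ballMeasure_compl δ) x r (c := 1)
        (fun y => prob_le_one)).trans ?_
      rw [one_mul]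
      refine (measure_mono (closedBall_subset_closedBall (by linarith : r + δ ≤ 2 * r))).trans
        ((hF x (2 * r) (by linarith)).trans (ENNReal.ofReal_le_ofReal ?_))
      rw [Real.mul_rpow zero_le_two hr.le, hκ']
      have : (2 : ℝ) ^ d ≤ 32 ^ d := by gcongr; norm_num
      calc κ * (2 ^ s * r ^ s) ≤ κ * (32 ^ d * r ^ s) := by
            gcongr
            exact h2s.trans this
        _ = _ := by ring
  set c : ℝ≥0∞ := ENNReal.ofReal κ' with hc
  have hc0 : c ≠ 0 := (ENNReal.ofReal_pos.2 hκ'0).ne'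
  have hct : c ≠ ∞ := ENNReal.ofReal_ne_top
  have hfin : IsFiniteMeasure (c⁻¹ • μ.conv (ballMeasure d δ)) :=
    Measure.smul_finite _ (ENNReal.inv_ne_top.2 hc0)
  have hmain := hC R hR (c⁻¹ • μ.conv (ballMeasure d δ)) hfin
    (by
      rw [Measure.smul_apply, smul_eq_mul]
      refine mul_eq_zero_of_right _ (measure_mono_null ?_
        (conv_compl_closedBall μ _ hM (ballMeasure_compl δ)))
      exact compl_subset_compl.2 (closedBall_subset_closedBall (by linarith)))
    (fun x r hr => by
      rw [Measure.smul_apply, smul_eq_mul, ENNReal.inv_mul_le_iff hc0 hct, hc,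
        ← ENNReal.ofReal_mul hκ'0.le]
      exact hconv x r hr)
  rw [sphericalAverage_smul, ENNReal.toReal_inv, ENNReal.toReal_ofReal hκ'0.le, inv_pow,
    inv_mul_le_iff₀ (by positivity)] at hmain
  have h1 := sphericalAverage_le_conv_ballMeasure μ hδ hR0.le (by
    rw [hδdef]
    field_simp
    exact le_rfl)
  calc sphericalAverage μ R ≤ 4 * (κ' ^ 2 * (C * R ^ (-b + ε))) := h1.trans (by linarith)
    _ = _ := by rw [hκ']; ring

end UniformScale

/-! ### Superposition of translates -/

section Translates

variable {d : ℕ}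

theorem lintegral_map_add_apply_le (μ : Measure (Euc d)) [SFinite μ] {B : Set (Euc d)}
    (hB : MeasurableSet B) (T : Set (Euc d)) :
    ∫⁻ τ in T, μ.map (· + τ) B ≤ μ univ * volume B := by
  calc ∫⁻ τ in T, μ.map (· + τ) B ≤ ∫⁻ τ, μ.map (· + τ) B := setLIntegral_le_lintegral _ _
    _ = ∫⁻ τ, ∫⁻ y, B.indicator (1 : Euc d → ℝ≥0∞) (y + τ) ∂μ := by
        refine lintegral_congr fun τ => ?_
        rw [← lintegral_indicator_one hB, lintegral_map (measurable_one.indicator hB) (by fun_prop)]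
    _ = ∫⁻ y, (∫⁻ τ, B.indicator (1 : Euc d → ℝ≥0∞) (y + τ)) ∂μ := by
        refine lintegral_lintegral_swap (Measurable.aemeasurable ?_)
        exact (measurable_one.indicator hB).comp (measurable_snd.add measurable_fst)
    _ = ∫⁻ _y, volume B ∂μ := by
        refine lintegral_congr fun y => ?_
        rw [lintegral_add_left_eq_self (fun τ => B.indicator (1 : Euc d → ℝ≥0∞) τ) y,
          lintegral_indicator_one hB]
    _ = _ := by rw [lintegral_const, mul_comm]

theorem measurable_map_add_apply (μ : Measure (Euc d)) [SFinite μ] {B : Set (Euc d)}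
    (hB : MeasurableSet B) : Measurable fun τ : Euc d => μ.map (· + τ) B := by
  have h : ∀ τ : Euc d, μ.map (· + τ) B = ∫⁻ y, B.indicator (1 : Euc d → ℝ≥0∞) (y + τ) ∂μ := fun τ => by
    rw [← lintegral_indicator_one hB, lintegral_map (measurable_one.indicator hB) (by fun_prop)]
  simp_rw [h]
  refine Measurable.lintegral_prod_right' (f := fun p : Euc d × Euc d =>
    B.indicator (1 : Euc d → ℝ≥0∞) (p.2 + p.1)) ?_
  exact (measurable_one.indicator hB).comp (measurable_snd.add measurable_fst)

/-- A translate of `μ` which does not increase an exponential potential by too much. -/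
theorem exists_translate_sum_exp_le {ι : Type*} (μ : Measure (Euc d)) [IsFiniteMeasure μ]
    (S : Finset ι) (B : ι → Set (Euc d)) (hB : ∀ p, MeasurableSet (B p)) (W c : ι → ℝ)
    (hW0 : ∀ p, 0 ≤ W p) (hc : ∀ p, 0 ≤ c p) (hBt : ∀ p, volume (B p) ≠ ∞)
    (hW : ∀ p ∈ S, ∀ τ : Euc d, W p * (μ.map (· + τ)).real (B p) ≤ 1) {V : ℝ}
    (hV : ∀ p ∈ S, W p * volume.real (B p) ≤ V * volume.real (closedBall (0 : Euc d) 1)) :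
    ∃ τ ∈ closedBall (0 : Euc d) 1, ∑ p ∈ S, c p * Real.exp (W p * (μ.map (· + τ)).real (B p)) ≤
      (1 + 2 * V * μ.real univ) * ∑ p ∈ S, c p := by
  set T := closedBall (0 : Euc d) 1 with hT
  have hT0 : volume T ≠ 0 := (measure_closedBall_pos _ _ one_pos).ne'
  have hTt : volume T ≠ ∞ := measure_closedBall_lt_top.ne
  have hTr : 0 < volume.real T := ENNReal.toReal_pos hT0 hTt
  let F : Euc d → ℝ≥0∞ := fun τ => ∑ p ∈ S, ENNReal.ofReal (c p * W p) * μ.map (· + τ) (B p)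
  have hFfin : ∀ τ, F τ = ENNReal.ofReal (∑ p ∈ S, c p * W p * (μ.map (· + τ)).real (B p)) := by
    intro τ
    rw [ENNReal.ofReal_sum_of_nonneg fun p _ =>
      mul_nonneg (mul_nonneg (hc p) (hW0 p)) measureReal_nonneg]
    refine Finset.sum_congr rfl fun p _ => ?_
    rw [ENNReal.ofReal_mul (mul_nonneg (hc p) (hW0 p)), ofReal_measureReal]
  have hFm : Measurable F := Finset.measurable_fun_sum _ fun p _ =>
    (measurable_map_add_apply μ (hB p)).const_mul _
  have hint : ∫⁻ τ in T, F τ ≤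
      ENNReal.ofReal (∑ p ∈ S, c p * W p * (μ.real univ * volume.real (B p))) := by
    simp only [F]
    rw [lintegral_finsetSum _ fun p _ => (measurable_map_add_apply μ (hB p)).const_mul _,
      ENNReal.ofReal_sum_of_nonneg fun p _ =>
      mul_nonneg (mul_nonneg (hc p) (hW0 p)) (by positivity)]
    refine Finset.sum_le_sum fun p _ => ?_
    rw [lintegral_const_mul _ (measurable_map_add_apply μ (hB p)),
      ENNReal.ofReal_mul (mul_nonneg (hc p) (hW0 p)), ENNReal.ofReal_mul measureReal_nonneg,
      ofReal_measureReal, ofReal_measureReal (h := hBt p)]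
    gcongr
    exact lintegral_map_add_apply_le μ (hB p) T
  obtain ⟨τ, hτT, hτ⟩ := exists_le_setLAverage (μ := volume) (s := T) (f := F) hT0
    hTt hFm.aemeasurable
  refine ⟨τ, hτT, ?_⟩
  have h1 : ∑ p ∈ S, c p * W p * (μ.map (· + τ)).real (B p) ≤ V * μ.real univ * ∑ p ∈ S, c p := by
    have h2 : F τ ≤ ENNReal.ofReal (V * μ.real univ * ∑ p ∈ S, c p) := by
      refine hτ.trans ?_
      rw [setLAverage_eq]
      refine ENNReal.div_le_of_le_mul (hint.trans ?_)
      rw [← ofReal_measureReal (h := hTt), ← ENNReal.ofReal_mul' measureReal_nonneg]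
      refine ENNReal.ofReal_le_ofReal ?_
      rw [Finset.mul_sum, Finset.sum_mul]
      refine Finset.sum_le_sum fun p hp => ?_
      have := mul_le_mul_of_nonneg_left (hV p hp)
        (mul_nonneg (hc p) (measureReal_nonneg (μ := μ) (s := univ)))
      linarith
    by_cases hS : 0 ≤ V * μ.real univ * ∑ p ∈ S, c p
    · rwa [hFfin, ENNReal.ofReal_le_ofReal_iff hS] at h2
    · have hV0 : ∀ p ∈ S, 0 ≤ V := fun p hp => by
        have := (mul_nonneg (hW0 p) measureReal_nonneg).trans (hV p hp)
        exact nonneg_of_mul_nonneg_left this hTr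
      refine absurd ?_ hS
      rcases S.eq_empty_or_nonempty with rfl | ⟨p, hp⟩
      · simp
      · exact mul_nonneg (mul_nonneg (hV0 p hp) measureReal_nonneg)
          (Finset.sum_nonneg fun p _ => hc p)
  calc _ ≤ ∑ p ∈ S, (c p + 2 * (c p * W p * (μ.map (· + τ)).real (B p))) := by
        refine Finset.sum_le_sum fun p hp => ?_
        have h3 : 0 ≤ W p * (μ.map (· + τ)).real (B p) := mul_nonneg (hW0 p) measureReal_nonneg
        have h4 := Real.abs_exp_sub_one_le (x := W p * (μ.map (· + τ)).real (B p))
          (by rw [abs_of_nonneg h3]; exact hW p hp τ)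
        rw [abs_of_nonneg h3] at h4
        have h5 := (le_abs_self _).trans h4
        have := mul_le_mul_of_nonneg_left h5 (hc p)
        linarith
    _ = ∑ p ∈ S, c p + 2 * ∑ p ∈ S, c p * W p * (μ.map (· + τ)).real (B p) := by
        rw [Finset.sum_add_distrib, Finset.mul_sum]
    _ ≤ _ := by linarith

theorem norm_fourierMeasure_map_add (μ : Measure (Euc d)) (τ ξ : Euc d) :
    ‖fourierMeasure (μ.map (· + τ)) ξ‖ = ‖fourierMeasure μ ξ‖ := by
  rw [fourierMeasure_eq_charFun, fourierMeasure_eq_charFun, charFun_map_add_const, norm_mul,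
    Complex.norm_exp_ofReal_mul_I, mul_one]

theorem map_add_compl_closedBall {μ : Measure (Euc d)} {M : ℝ} (hμ : μ (closedBall 0 M)ᶜ = 0)
    {τ : Euc d} (hτ : τ ∈ closedBall (0 : Euc d) 1) :
    μ.map (· + τ) (closedBall 0 (M + 1))ᶜ = 0 := by
  rw [Measure.map_apply (by fun_prop) isClosed_closedBall.measurableSet.compl]
  refine measure_mono_null (t := (closedBall 0 M)ᶜ) (fun y hy => fun hyM => hy ?_) hμ
  rw [mem_closedBall_zero_iff] at *
  exact (norm_add_le _ _).trans (add_le_add hyM hτ)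

/-- Signed sums of translates, with controlled concentration and large spherical average. -/
theorem exists_signed_translates [NeZero d] {ι : Type*} (μ : Measure (Euc d)) [IsFiniteMeasure μ]
    {M : ℝ} (hM : μ (closedBall 0 M)ᶜ = 0)
    (S : Finset ι) (B : ι → Set (Euc d)) (hB : ∀ p, MeasurableSet (B p)) (W : ι → ℝ)
    (hW0 : ∀ p, 0 ≤ W p) (hBt : ∀ p, volume (B p) ≠ ∞)
    (hW : ∀ p ∈ S, ∀ τ : Euc d, W p * (μ.map (· + τ)).real (B p) ≤ 1) {V : ℝ} (hV0 : 0 ≤ V)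
    (hV : ∀ p ∈ S, W p * volume.real (B p) ≤ V * volume.real (closedBall (0 : Euc d) 1))
    (R : ℝ) (j : ℕ) :
    ∃ P N : Measure (Euc d), IsFiniteMeasure P ∧ IsFiniteMeasure N ∧
      P (closedBall 0 (M + 1))ᶜ = 0 ∧ N (closedBall 0 (M + 1))ᶜ = 0 ∧
      (P + N) univ = j * μ univ ∧
      ∑ p ∈ S, Real.exp (W p * (P + N).real (B p)) ≤ (1 + 2 * V * μ.real univ) ^ j * S.card ∧
      j * sphericalAverage μ R ≤ ∫ ω : USphere d,
        ‖fourierMeasure P (R • (ω : Euc d)) - fourierMeasure N (R • (ω : Euc d))‖ ^ 2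
          ∂(normalizedSphereMeasure d) := by
  induction j with
  | zero =>
    refine ⟨0, 0, inferInstance, inferInstance, by simp, by simp, by simp, by simp, ?_⟩
    simp only [Nat.cast_zero, zero_mul]
    exact integral_nonneg fun _ => by positivity
  | succ j ih =>
    obtain ⟨P, N, hP, hN, hPM, hNM, hPN, hsum, hav⟩ := ih
    obtain ⟨τ, hτ, hτs⟩ := exists_translate_sum_exp_le μ S B hB W
      (fun p => Real.exp (W p * (P + N).real (B p))) hW0 (fun p => (Real.exp_pos _).le) hBt hW hV
    set ν := μ.map (· + τ) with hν
    have hνfin : IsFiniteMeasure ν := Measure.isFiniteMeasure_map μ _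
    have hνM : ν (closedBall 0 (M + 1))ᶜ = 0 := map_add_compl_closedBall hM hτ
    have hνu : ν univ = μ univ := by
      rw [hν, Measure.map_apply (by fun_prop) MeasurableSet.univ, preimage_univ]
    have hsum' : ∑ p ∈ S, Real.exp (W p * (P + N + ν).real (B p)) ≤
        (1 + 2 * V * μ.real univ) ^ (j + 1) * S.card := by
      calc _ = ∑ p ∈ S, Real.exp (W p * (P + N).real (B p)) * Real.exp (W p * ν.real (B p)) := by
            refine Finset.sum_congr rfl fun p _ => ?_
            rw [← Real.exp_add, measureReal_add_apply, mul_add]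
        _ ≤ _ := hτs
        _ ≤ (1 + 2 * V * μ.real univ) * ((1 + 2 * V * μ.real univ) ^ j * S.card) := by
            gcongr
        _ = _ := by ring
    have hu : (P + N + ν) univ = (j + 1 : ℕ) * μ univ := by
      rw [Measure.add_apply, hPN, hνu]
      push_cast
      ring
    have hpar : (∫ ω : USphere d, ‖fourierMeasure (P + ν) (R • (ω : Euc d)) -
          fourierMeasure N (R • (ω : Euc d))‖ ^ 2 ∂(normalizedSphereMeasure d)) +
        (∫ ω : USphere d, ‖fourierMeasure P (R • (ω : Euc d)) -
          fourierMeasure (N + ν) (R • (ω : Euc d))‖ ^ 2 ∂(normalizedSphereMeasure d)) =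
        2 * (∫ ω : USphere d, ‖fourierMeasure P (R • (ω : Euc d)) -
          fourierMeasure N (R • (ω : Euc d))‖ ^ 2 ∂(normalizedSphereMeasure d)) +
        2 * sphericalAverage μ R := by
      have hc : ∀ Q₁ Q₂ : Measure (Euc d), ∀ [IsFiniteMeasure Q₁] [IsFiniteMeasure Q₂],
          Integrable (fun ω : USphere d => ‖fourierMeasure Q₁ (R • (ω : Euc d)) -
            fourierMeasure Q₂ (R • (ω : Euc d))‖ ^ 2) (normalizedSphereMeasure d) :=
        fun Q₁ Q₂ _ _ => integrable_of_continuous_sphere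
          (((continuous_fourierMeasure_sphere Q₁ R).sub
            (continuous_fourierMeasure_sphere Q₂ R)).norm.pow 2)
      have hd : Integrable (fun ω : USphere d => ‖fourierMeasure μ (R • (ω : Euc d))‖ ^ 2)
          (normalizedSphereMeasure d) :=
        integrable_of_continuous_sphere ((continuous_fourierMeasure_sphere μ R).norm.pow 2)
      rw [← integral_add (hc _ _) (hc _ _), sphericalAverage, ← integral_const_mul,
        ← integral_const_mul, ← integral_add ((hc _ _).const_mul 2)
        (hd.const_mul 2)]
      refine integral_congr_ae (ae_of_all _ fun ω => ?_)
      dsimp only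
      rw [← norm_fourierMeasure_map_add μ τ, ← hν, fourierMeasure_add, fourierMeasure_add]
      have := parallelogram_law_with_norm ℝ
        (fourierMeasure P (R • (ω : Euc d)) - fourierMeasure N (R • (ω : Euc d)))
        (fourierMeasure ν (R • (ω : Euc d)))
      rw [add_sub_right_comm, ← sub_sub]
      nlinarith
    rcases le_total (((j + 1 : ℕ) : ℝ) * sphericalAverage μ R) (∫ ω : USphere d,
      ‖fourierMeasure (P + ν) (R • (ω : Euc d)) - fourierMeasure N (R • (ω : Euc d))‖ ^ 2
        ∂(normalizedSphereMeasure d)) with h | h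
    · have hre : P + ν + N = P + N + ν := by abel
      refine ⟨P + ν, N, inferInstance, hN, by simp [hPM, hνM], hNM, ?_, ?_, h⟩
      · rw [hre, hu]
      · rw [hre]
        exact hsum'
    · refine ⟨P, N + ν, hP, inferInstance, hPM, by simp [hNM, hνM], ?_, ?_, ?_⟩
      · rw [← add_assoc, hu]
      · rw [← add_assoc]
        exact hsum'
      · push_cast at h ⊢
        linarith

end Translates

section LinearBound

variable {d : ℕ}

theorem dyadicCell_subset_closedBall {p : ℕ × (Fin d → ℤ)} {y : Euc d} (hy : y ∈ dyadicCell p) :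
    dyadicCell p ⊆ closedBall y (√d * (2 : ℝ)⁻¹ ^ p.1) :=
  fun _ hx => dist_le_of_mem_dyadicCell hx hy

theorem volume_dyadicCell_ne_top (p : ℕ × (Fin d → ℤ)) : volume (dyadicCell p) ≠ ∞ := by
  obtain ⟨y, hy⟩ := dyadicCell_nonempty p
  exact ne_top_of_le_ne_top measure_closedBall_lt_top.ne
    (measure_mono (dyadicCell_subset_closedBall hy))

theorem volume_real_dyadicCell_le (p : ℕ × (Fin d → ℤ)) :
    volume.real (dyadicCell p) ≤
      (√d * (2 : ℝ)⁻¹ ^ p.1) ^ d * volume.real (closedBall (0 : Euc d) 1) := by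
  obtain ⟨y, hy⟩ := dyadicCell_nonempty p
  refine (measureReal_mono (dyadicCell_subset_closedBall hy)
    measure_closedBall_lt_top.ne).trans (le_of_eq ?_)
  rw [Measure.addHaar_real_closedBall' _ _ (by positivity), finrank_euclideanSpace_fin]

theorem measure_ball_le_of_dyadicCell_le (ν : Measure (Euc d)) {t : ℝ} (k : ℕ)
    (h : ∀ n, ν (dyadicCell (k, n)) ≤ ENNReal.ofReal t) (x : Euc d) :
    ν (ball x ((2 : ℝ)⁻¹ ^ k)) ≤ ENNReal.ofReal (3 ^ d * t) := by
  have hsub : ball x ((2 : ℝ)⁻¹ ^ k) ⊆ ⋃ q ∈ neighbours (k, dyadicLabel k x), dyadicCell q := by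
    intro y hy
    exact mem_iUnion₂.2 ⟨_, mem_neighbours_of_dist_lt (mem_ball'.1 hy), mem_dyadicCell_label k y⟩
  have hw : ∀ q ∈ neighbours (k, dyadicLabel k x), ν (dyadicCell q) ≤ ENNReal.ofReal t := by
    intro q hq
    obtain ⟨v, -, rfl⟩ := Finset.mem_image.1 hq
    exact h _
  refine (measure_mono hsub).trans ((measure_biUnion_finset_le _ _).trans
    ((Finset.sum_le_card_nsmul _ _ _ hw).trans ?_))
  rw [nsmul_eq_mul, ENNReal.ofReal_mul (by positivity)]
  gcongr
  rw [← ENNReal.ofReal_natCast]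
  refine ENNReal.ofReal_le_ofReal ?_
  exact_mod_cast card_neighbours_le _

/-- The labels of the cubes with side between `1/R` and `1` which meet a ball of radius `M`. -/
noncomputable def boxLabels (d : ℕ) (M R : ℝ) : Finset (ℕ × (Fin d → ℤ)) :=
  Finset.range (Nat.log 2 ⌊R⌋₊ + 1) ×ˢ
    Fintype.piFinset fun _ => Finset.Icc (-((⌈R * M⌉₊ + 1 : ℕ) : ℤ)) ((⌈R * M⌉₊ + 1 : ℕ) : ℤ)

theorem pow_le_of_le_log {R : ℝ} (hR : 1 ≤ R) {k : ℕ} (hk : k ≤ Nat.log 2 ⌊R⌋₊) :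
    (2 : ℝ) ^ k ≤ R := by
  have h1 : ⌊R⌋₊ ≠ 0 := (Nat.floor_pos.2 hR).ne'
  have h2 : 2 ^ k ≤ ⌊R⌋₊ :=
    (Nat.pow_le_pow_right two_pos hk).trans (Nat.pow_log_le_self 2 h1)
  calc (2 : ℝ) ^ k = ((2 ^ k : ℕ) : ℝ) := by push_cast; rfl
    _ ≤ ⌊R⌋₊ := by exact_mod_cast h2
    _ ≤ R := Nat.floor_le (by linarith)

theorem le_log_of_pow_le {R : ℝ} {k : ℕ} (hk : (2 : ℝ) ^ k ≤ R) : k ≤ Nat.log 2 ⌊R⌋₊ :=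
  Nat.le_log_of_pow_le one_lt_two (Nat.le_floor (by push_cast; exact hk))

theorem mem_boxLabels {M R : ℝ} (hR : 1 ≤ R) {k : ℕ} (hk : k ≤ Nat.log 2 ⌊R⌋₊)
    {x : Euc d} (hx : ‖x‖ ≤ M) : (k, dyadicLabel k x) ∈ boxLabels d M R := by
  refine Finset.mem_product.2 ⟨Finset.mem_range.2 (Nat.lt_succ_of_le hk), ?_⟩
  refine Fintype.mem_piFinset.2 fun i => ?_
  have h1 : |(2 : ℝ) ^ k * x i| ≤ R * M := by
    rw [abs_mul, abs_of_pos (by positivity)]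
    exact mul_le_mul (pow_le_of_le_log hR hk) ((abs_apply_le_norm x i).trans hx) (abs_nonneg _)
      (by linarith)
  have h2 := Nat.le_ceil (R * M)
  rw [abs_le] at h1
  rw [Finset.mem_Icc]
  simp only [dyadicLabel]
  constructor
  · refine Int.le_floor.2 ?_
    push_cast
    linarith
  · have : (⌊(2 : ℝ) ^ k * x i⌋ : ℝ) ≤ ((⌈R * M⌉₊ + 1 : ℕ) : ℤ) := by
      have := Int.floor_le ((2 : ℝ) ^ k * x i)
      push_cast
      linarith
    exact_mod_cast this

theorem card_boxLabels_le {M R : ℝ} (hM : 0 ≤ M) (hR : 1 ≤ R) :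
    ((boxLabels d M R).card : ℝ) ≤ (2 * M + 5) ^ d * R ^ (d + 1) := by
  have h1 : ((Nat.log 2 ⌊R⌋₊ + 1 : ℕ) : ℝ) ≤ R := by
    refine le_trans ?_ (pow_le_of_le_log hR le_rfl)
    exact_mod_cast Nat.lt_two_pow_self
  have h2 : (2 * ((⌈R * M⌉₊ + 1 : ℕ) : ℝ) + 1) ≤ (2 * M + 5) * R := by
    have := (Nat.ceil_lt_add_one (by positivity : 0 ≤ R * M)).le
    push_cast
    nlinarith
  have h3 : ((Finset.Icc (-((⌈R * M⌉₊ + 1 : ℕ) : ℤ)) ((⌈R * M⌉₊ + 1 : ℕ) : ℤ)).card : ℝ) =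
      2 * ((⌈R * M⌉₊ + 1 : ℕ) : ℝ) + 1 := by
    rw [Int.card_Icc, ← Int.cast_natCast (R := ℝ), Int.toNat_of_nonneg (by omega)]
    push_cast
    ring
  rw [boxLabels, Finset.card_product, Fintype.card_piFinset_const, Finset.card_range,
    Nat.cast_mul, Nat.cast_pow, h3]
  calc _ ≤ R * ((2 * M + 5) * R) ^ d := by gcongr
    _ = _ := by rw [mul_pow, pow_succ]; ring

/-- Sums of `j ~ 1/μ(ℝ^d)` translates of `μ`, with signs, which satisfy the same ball condition up
to a small power of `R`. -/
theorem exists_signed_translates_frostman [NeZero d] {s : ℝ} (hs0 : 0 ≤ s) (hsd : s ≤ d) {M : ℝ}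
    (hM : 1 ≤ M) {η : ℝ} (hη : 0 < η) :
    ∃ C : ℝ, 0 < C ∧ ∀ R : ℝ, 1 ≤ R → ∀ μ : Measure (Euc d), IsFiniteMeasure μ → μ ≠ 0 →
      μ (closedBall 0 M)ᶜ = 0 →
      (∀ x r, R⁻¹ ≤ r → μ (closedBall x r) ≤ ENNReal.ofReal (r ^ s)) →
      ∃ P N : Measure (Euc d), IsFiniteMeasure P ∧ IsFiniteMeasure N ∧
        P (closedBall 0 (M + 1))ᶜ = 0 ∧ N (closedBall 0 (M + 1))ᶜ = 0 ∧
        (∀ x r, R⁻¹ ≤ r → (P + N) (closedBall x r) ≤ ENNReal.ofReal (C * R ^ η * r ^ s)) ∧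
        sphericalAverage μ R ≤ μ.real univ * ∫ ω : USphere d,
          ‖fourierMeasure P (R • (ω : Euc d)) - fourierMeasure N (R • (ω : Euc d))‖ ^ 2
            ∂(normalizedSphereMeasure d) := by
  set A : ℝ := (√d + 1) ^ d with hA
  have hA1 : 1 ≤ A := one_le_pow₀ (by have := Real.sqrt_nonneg (d : ℝ); linarith)
  set C₁ : ℝ := 2 * (1 + M ^ d) + d * Real.log (2 * (M + 1) + 5) + (d + 1) / η with hC₁
  have hlog0 : 0 ≤ Real.log (2 * (M + 1) + 5) := Real.log_nonneg (by linarith)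
  have hC₁0 : 0 < C₁ := by positivity
  refine ⟨3 ^ d * A * 4 ^ d * C₁ + (1 + M ^ d) * 2 ^ d, by positivity,
    fun R hR μ _ hμ0 hμM hμF => ?_⟩
  have hR0 : 0 < R := by linarith
  have hpow : ∀ a : ℝ, 1 ≤ a → a ^ s ≤ a ^ d := fun a ha => by
    rw [← Real.rpow_natCast]
    exact Real.rpow_le_rpow_of_exponent_le ha hsd
  set m : ℝ := μ.real univ with hm
  have hm0 : 0 < m := ENNReal.toReal_pos (Measure.measure_univ_ne_zero.2 hμ0) (measure_ne_top _ _)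
  have hmM : m ≤ M ^ d := by
    refine le_trans ?_ (hpow M hM)
    refine ENNReal.toReal_le_of_le_ofReal (by positivity) ?_
    rw [← measure_of_measure_compl_eq_zero hμM]
    exact hμF 0 M ((inv_le_one_of_one_le₀ hR).trans hM)
  set j : ℕ := ⌈1 / m⌉₊ with hj
  have hj1 : 1 ≤ m * j := by
    have := Nat.le_ceil (1 / m)
    calc 1 = m * (1 / m) := by field_simp
      _ ≤ _ := by gcongr
  have hj2 : j * m ≤ 1 + M ^ d := by
    have := (Nat.ceil_lt_add_one (by positivity : 0 ≤ 1 / m)).le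
    calc j * m ≤ (1 / m + 1) * m := by gcongr
      _ = 1 + m := by field_simp
      _ ≤ _ := by linarith
  set L := Nat.log 2 ⌊R⌋₊ with hL
  let t : ℕ → ℝ := fun k => (2 : ℝ)⁻¹ ^ k
  have ht0 : ∀ k, 0 < t k := fun k => by positivity
  have ht1 : ∀ k, t k ≤ 1 := fun k => pow_le_one₀ (by norm_num) (by norm_num)
  have htR : ∀ k ≤ L, R⁻¹ ≤ t k := fun k hk => by
    simp only [t]
    rw [inv_pow]
    exact inv_anti₀ (by positivity) (pow_le_of_le_log hR hk)
  let W : ℕ × (Fin d → ℤ) → ℝ := fun p => (A * t p.1 ^ s)⁻¹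
  have hW0 : ∀ p, 0 < W p := fun p => by have := ht0 p.1; positivity
  have hS : ∀ p ∈ boxLabels d (M + 1) R, p.1 ≤ L := fun p hp =>
    Nat.lt_succ_iff.1 (Finset.mem_range.1 (Finset.mem_product.1 hp).1)
  have hWμ : ∀ p ∈ boxLabels d (M + 1) R, ∀ τ : Euc d,
      W p * (μ.map (· + τ)).real (dyadicCell p) ≤ 1 := by
    intro p hp τ
    simp only [W]
    rw [inv_mul_le_iff₀ (by have := ht0 p.1; positivity), mul_one]
    have h0 := ht0 p.1
    refine ENNReal.toReal_le_of_le_ofReal (by positivity) ?_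
    rw [Measure.map_apply (by fun_prop) (measurableSet_dyadicCell p)]
    rcases ((· + τ) ⁻¹' dyadicCell p).eq_empty_or_nonempty with he | ⟨y, hy⟩
    · rw [he, measure_empty]
      exact zero_le
    · refine (measure_mono (t := closedBall y ((√d + 1) * t p.1)) fun z hz => ?_).trans
        ((hμF y _ ?_).trans (ENNReal.ofReal_le_ofReal ?_))
      · have h1 := dist_le_of_mem_dyadicCell (mem_preimage.1 hz) (mem_preimage.1 hy)
        rw [dist_add_right] at h1
        refine h1.trans ?_
        have : √d * t p.1 ≤ (√d + 1) * t p.1 := by gcongr; linarith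
        exact this
      · have h1 := htR p.1 (hS p hp)
        have h2 := mul_nonneg (Real.sqrt_nonneg (d : ℝ)) h0.le
        linarith
      · rw [Real.mul_rpow (by positivity) h0.le]
        gcongr
        exact hpow _ (by have := Real.sqrt_nonneg (d : ℝ); linarith)
  have hWV : ∀ p ∈ boxLabels d (M + 1) R,
      W p * volume.real (dyadicCell p) ≤ 1 * volume.real (closedBall (0 : Euc d) 1) := by
    intro p _
    have h0 := ht0 p.1
    simp only [W]
    rw [inv_mul_le_iff₀ (by positivity)]
    refine (volume_real_dyadicCell_le p).trans ?_
    rw [one_mul]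
    gcongr
    rw [mul_pow]
    refine mul_le_mul ?_ ?_ (by positivity) (by positivity)
    · rw [hA]
      gcongr
      linarith
    · rw [← Real.rpow_natCast]
      exact Real.rpow_le_rpow_of_exponent_ge h0 (ht1 _) hsd
  obtain ⟨P, N, hP, hN, hPM, hNM, hPN, hsum, hav⟩ := exists_signed_translates μ hμM
    (boxLabels d (M + 1) R) dyadicCell measurableSet_dyadicCell W (fun p => (hW0 p).le)
    volume_dyadicCell_ne_top hWμ zero_le_one hWV R j
  have hΛ : ∀ p ∈ boxLabels d (M + 1) R, W p * (P + N).real (dyadicCell p) ≤ C₁ * R ^ η := by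
    intro p hp
    have hcard := card_boxLabels_le (d := d) (by linarith : (0 : ℝ) ≤ M + 1) hR
    have h1 : Real.exp (W p * (P + N).real (dyadicCell p)) ≤
        Real.exp (2 * (1 + M ^ d)) * ((2 * (M + 1) + 5) ^ d * R ^ (d + 1)) := by
      refine (Finset.single_le_sum (f := fun p => Real.exp (W p * (P + N).real (dyadicCell p)))
        (fun q _ => (Real.exp_pos _).le) hp).trans (hsum.trans ?_)
      refine mul_le_mul ?_ hcard (by positivity) (by positivity)
      calc (1 + 2 * 1 * m) ^ j ≤ (Real.exp (2 * m)) ^ j := by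
            gcongr
            have := Real.add_one_le_exp (2 * m)
            linarith
        _ = Real.exp (2 * (j * m)) := by rw [← Real.exp_nat_mul]; ring_nf
        _ ≤ _ := by gcongr
    rw [← Real.le_log_iff_exp_le (by positivity), Real.log_mul (by positivity) (by positivity),
      Real.log_exp, Real.log_mul (by positivity) (by positivity), Real.log_pow, Real.log_pow] at h1
    have h2 : Real.log R ≤ R ^ η / η := Real.log_le_rpow_div hR0.le hη
    have h3 : 1 ≤ R ^ η := Real.one_le_rpow hR hη.le
    calc _ ≤ _ := h1
      _ ≤ 2 * (1 + M ^ d) * R ^ η + (d * Real.log (2 * (M + 1) + 5) * R ^ η +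
          (d + 1) * (R ^ η / η)) := by
        refine add_le_add (le_mul_of_one_le_right (by positivity) h3)
          (add_le_add (le_mul_of_one_le_right (by positivity) h3) ?_)
        push_cast
        gcongr
      _ = _ := by rw [hC₁]; ring
  have hcell : ∀ p : ℕ × (Fin d → ℤ), p.1 ≤ L →
      (P + N) (dyadicCell p) ≤ ENNReal.ofReal (C₁ * R ^ η * (A * t p.1 ^ s)) := by
    intro p hp
    by_cases hpS : p ∈ boxLabels d (M + 1) R
    · have h0 := ht0 p.1
      have h1 := hΛ p hpS
      simp only [W] at h1
      rw [inv_mul_le_iff₀ (by positivity)] at h1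
      rw [← ofReal_measureReal]
      exact ENNReal.ofReal_le_ofReal (h1.trans (le_of_eq (mul_comm _ _)))
    · have hPNM : (P + N) (closedBall 0 (M + 1))ᶜ = 0 := by
        rw [Measure.add_apply, hPM, hNM, add_zero]
      refine (le_of_eq (measure_mono_null (fun x hx => ?_) hPNM)).trans zero_le
      intro hxM
      refine hpS ?_
      have h1 := mem_boxLabels (d := d) (M := M + 1) hR hp
        (mem_closedBall_zero_iff.1 hxM)
      rwa [mem_dyadicCell_iff.1 hx] at h1
  refine ⟨P, N, hP, hN, hPM, hNM, fun x r hr => ?_, ?_⟩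
  · have hr0 : 0 < r := (inv_pos.2 hR0).trans_le hr
    rcases le_or_gt (2 * r) 1 with h1 | h1
    · obtain ⟨k, hk1, hk2⟩ := exists_nat_pow_half_near (by positivity) h1
      have hkL : k ≤ L := by
        refine le_log_of_pow_le ?_
        have h2 : R⁻¹ ≤ ((2 : ℝ) ^ k)⁻¹ := by rw [← inv_pow]; linarith
        exact (inv_le_inv₀ hR0 (by positivity)).1 h2
      calc (P + N) (closedBall x r) ≤ (P + N) (ball x (t k)) :=
            measure_mono (closedBall_subset_ball (by simp only [t]; linarith))
        _ ≤ ENNReal.ofReal (3 ^ d * (C₁ * R ^ η * (A * t k ^ s))) :=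
            measure_ball_le_of_dyadicCell_le _ k (fun n => hcell (k, n) hkL) x
        _ ≤ _ := by
            refine ENNReal.ofReal_le_ofReal ?_
            have h3 : t k ^ s ≤ 4 ^ d * r ^ s := by
              have : t k ≤ 4 * r := by
                simp only [t]
                rw [pow_succ] at hk1
                linarith
              calc t k ^ s ≤ (4 * r) ^ s := Real.rpow_le_rpow (ht0 k).le this hs0
                _ = 4 ^ s * r ^ s := Real.mul_rpow (by norm_num) hr0.le
                _ ≤ _ := by
                    gcongr
                    exact hpow 4 (by norm_num)
            have h4 : 0 ≤ (1 + M ^ d) * 2 ^ d * (R ^ η * r ^ s) := by positivity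
            calc _ ≤ 3 ^ d * (C₁ * R ^ η * (A * (4 ^ d * r ^ s))) := by gcongr
              _ ≤ 3 ^ d * (C₁ * R ^ η * (A * (4 ^ d * r ^ s))) +
                  (1 + M ^ d) * 2 ^ d * (R ^ η * r ^ s) := by linarith
              _ = _ := by ring
    · refine (measure_mono (subset_univ _)).trans ?_
      rw [hPN, ← ofReal_measureReal, ← ENNReal.ofReal_natCast, ← ENNReal.ofReal_mul (by positivity)]
      refine ENNReal.ofReal_le_ofReal (hj2.trans ?_)
      have h2 : 1 ≤ 2 ^ d * r ^ s := by
        calc (1 : ℝ) ≤ (2 * r) ^ s := Real.one_le_rpow h1.le hs0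
          _ = 2 ^ s * r ^ s := Real.mul_rpow (by norm_num) hr0.le
          _ ≤ _ := by
              gcongr
              exact hpow 2 (by norm_num)
      have h3 : 1 ≤ R ^ η := Real.one_le_rpow hR hη.le
      have h4 : 0 ≤ 3 ^ d * A * 4 ^ d * C₁ * (R ^ η * r ^ s) := by positivity
      calc 1 + M ^ d = (1 + M ^ d) * 1 * 1 := by ring
        _ ≤ (1 + M ^ d) * R ^ η * (2 ^ d * r ^ s) := by gcongr
        _ ≤ _ := by linarith
  · calc sphericalAverage μ R ≤ (m * j) * sphericalAverage μ R :=
          le_mul_of_one_le_left (sphericalAverage_nonneg _ _) hj1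
      _ = m * (j * sphericalAverage μ R) := by ring
      _ ≤ _ := by gcongr

theorem integral_norm_sub_sq_le [NeZero d] (P N : Measure (Euc d)) [IsFiniteMeasure P]
    [IsFiniteMeasure N] (R : ℝ) :
    ∫ ω : USphere d, ‖fourierMeasure P (R • (ω : Euc d)) - fourierMeasure N (R • (ω : Euc d))‖ ^ 2
      ∂(normalizedSphereMeasure d) ≤ 2 * sphericalAverage P R + 2 * sphericalAverage N R := by
  have hP : Integrable (fun ω : USphere d => ‖fourierMeasure P (R • (ω : Euc d))‖ ^ 2)
      (normalizedSphereMeasure d) :=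
    integrable_of_continuous_sphere ((continuous_fourierMeasure_sphere P R).norm.pow 2)
  have hN : Integrable (fun ω : USphere d => ‖fourierMeasure N (R • (ω : Euc d))‖ ^ 2)
      (normalizedSphereMeasure d) :=
    integrable_of_continuous_sphere ((continuous_fourierMeasure_sphere N R).norm.pow 2)
  rw [sphericalAverage, sphericalAverage, ← integral_const_mul, ← integral_const_mul,
    ← integral_add (hP.const_mul 2) (hN.const_mul 2)]
  refine integral_mono (integrable_of_continuous_sphere
    (((continuous_fourierMeasure_sphere P R).sub
      (continuous_fourierMeasure_sphere N R)).norm.pow 2))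
    ((hP.const_mul 2).add (hN.const_mul 2)) fun ω => ?_
  have h := norm_sub_le (fourierMeasure P (R • (ω : Euc d))) (fourierMeasure N (R • (ω : Euc d)))
  have h2 : ‖fourierMeasure P (R • (ω : Euc d)) - fourierMeasure N (R • (ω : Euc d))‖ ^ 2 ≤
      (‖fourierMeasure P (R • (ω : Euc d))‖ + ‖fourierMeasure N (R • (ω : Euc d))‖) ^ 2 := by
    gcongr
  dsimp only
  nlinarith [sq_nonneg (‖fourierMeasure P (R • (ω : Euc d))‖ -
    ‖fourierMeasure N (R • (ω : Euc d))‖)]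

/-- The spherical decay estimate, with linear dependence on the total mass of the measure and on
the constant in its ball condition at scales `≥ 1/R`. -/
theorem SphericalDecay.linear_bound [NeZero d] {s b : ℝ} (h : SphericalDecay d s b) (hs0 : 0 ≤ s)
    (hsd : s ≤ d) {M : ℝ} (hM : 1 ≤ M) {ε : ℝ} (hε : 0 < ε) :
    ∃ C : ℝ, 0 ≤ C ∧ ∀ R : ℝ, 1 ≤ R → ∀ κ : ℝ, 0 < κ → ∀ μ : Measure (Euc d), IsFiniteMeasure μ →
      μ (closedBall 0 M)ᶜ = 0 →
      (∀ x r, R⁻¹ ≤ r → μ (closedBall x r) ≤ ENNReal.ofReal (κ * r ^ s)) →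
      sphericalAverage μ R ≤ C * κ * μ.real univ * R ^ (-b + ε) := by
  obtain ⟨C₀, hC₀, hdecay⟩ := h.uniform_scale hsd (M + 1) (half_pos hε)
  obtain ⟨C₁, hC₁, htrans⟩ := exists_signed_translates_frostman (d := d) hs0 hsd hM
    (by positivity : 0 < ε / 4)
  have hone : ∀ R : ℝ, 1 ≤ R → ∀ μ : Measure (Euc d), IsFiniteMeasure μ →
      μ (closedBall 0 M)ᶜ = 0 →
      (∀ x r, R⁻¹ ≤ r → μ (closedBall x r) ≤ ENNReal.ofReal (r ^ s)) →
      sphericalAverage μ R ≤ 4 * C₀ * C₁ ^ 2 * μ.real univ * R ^ (-b + ε) := by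
    intro R hR μ hμ hμM hμF
    by_cases hμ0 : μ = 0
    · simp [hμ0, sphericalAverage, fourierMeasure]
    obtain ⟨P, N, hP, hN, hPM, hNM, hF, hav⟩ := htrans R hR μ hμ hμ0 hμM hμF
    have hR0 : 0 < R := by linarith
    have hκ : 0 < C₁ * R ^ (ε / 4) := by positivity
    have h1 := hdecay R hR _ hκ P hP hPM fun x r hr => le_trans le_self_add (hF x r hr)
    have h2 := hdecay R hR _ hκ N hN hNM fun x r hr => le_trans le_add_self (hF x r hr)
    have h3 : (R ^ (ε / 4)) ^ 2 * R ^ (-b + ε / 2) = R ^ (-b + ε) := by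
      rw [← Real.rpow_natCast, ← Real.rpow_mul hR0.le, ← Real.rpow_add hR0]
      congr 1
      push_cast
      ring
    calc sphericalAverage μ R ≤ _ := hav
      _ ≤ μ.real univ * (2 * (C₀ * (C₁ * R ^ (ε / 4)) ^ 2 * R ^ (-b + ε / 2)) +
          2 * (C₀ * (C₁ * R ^ (ε / 4)) ^ 2 * R ^ (-b + ε / 2))) := by
        refine mul_le_mul_of_nonneg_left ?_ measureReal_nonneg
        exact (integral_norm_sub_sq_le P N R).trans (by linarith)
      _ = _ := by
        rw [← h3]
        ring
  refine ⟨4 * C₀ * C₁ ^ 2, by positivity, fun R hR κ hκ μ hμ hμM hμF => ?_⟩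
  set c : ℝ≥0∞ := ENNReal.ofReal κ with hc
  have hc0 : c ≠ 0 := (ENNReal.ofReal_pos.2 hκ).ne'
  have hct : c ≠ ∞ := ENNReal.ofReal_ne_top
  have hfin : IsFiniteMeasure (c⁻¹ • μ) := Measure.smul_finite _ (ENNReal.inv_ne_top.2 hc0)
  have hmain := hone R hR (c⁻¹ • μ) hfin (by rw [Measure.smul_apply, hμM, smul_zero])
    (fun x r hr => by
      rw [Measure.smul_apply, smul_eq_mul, ENNReal.inv_mul_le_iff hc0 hct, hc,
        ← ENNReal.ofReal_mul hκ.le]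
      exact hμF x r hr)
  rw [sphericalAverage_smul, ENNReal.toReal_inv, ENNReal.toReal_ofReal hκ.le, inv_pow,
    inv_mul_le_iff₀ (by positivity), measureReal_ennreal_smul_apply, ENNReal.toReal_inv,
    ENNReal.toReal_ofReal hκ.le] at hmain
  refine hmain.trans (le_of_eq ?_)
  field_simp

end LinearBound

/-! ### `L²` bounds for the extension operator -/

section LayerCake

theorem sq_posPart_le_sum {t B : ℝ} (htB : t ≤ B) (hB : 0 ≤ B) (n : ℕ) :
    (max t 0) ^ 2 ≤ 4⁻¹ ^ n * B ^ 2 +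
      ∑ k ∈ Finset.range n, 4⁻¹ ^ k * B ^ 2 * {u : ℝ | 2⁻¹ ^ (k + 1) * B ≤ u}.indicator 1 t := by
  induction n with
  | zero =>
    simp only [pow_zero, one_mul, Finset.range_zero, Finset.sum_empty, add_zero]
    gcongr
    exact max_le htB hB
  | succ n ih =>
    rw [Finset.sum_range_succ]
    have hsum : 0 ≤ ∑ k ∈ Finset.range n,
        4⁻¹ ^ k * B ^ 2 * {u : ℝ | 2⁻¹ ^ (k + 1) * B ≤ u}.indicator 1 t :=
      Finset.sum_nonneg fun k _ => mul_nonneg (by positivity)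
        (indicator_nonneg (fun _ _ => zero_le_one) _)
    by_cases h : 2⁻¹ ^ (n + 1) * B ≤ t
    · have h1 : {u : ℝ | 2⁻¹ ^ (n + 1) * B ≤ u}.indicator (1 : ℝ → ℝ) t = 1 :=
        indicator_of_mem (s := {u : ℝ | 2⁻¹ ^ (n + 1) * B ≤ u}) h 1
      rw [h1, mul_one]
      have : 0 ≤ 4⁻¹ ^ (n + 1) * B ^ 2 := by positivity
      linarith
    · have h1 : {u : ℝ | 2⁻¹ ^ (n + 1) * B ≤ u}.indicator (1 : ℝ → ℝ) t = 0 :=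
        indicator_of_notMem (s := {u : ℝ | 2⁻¹ ^ (n + 1) * B ≤ u}) h 1
      rw [h1, mul_zero, add_zero]
      have h2 : max t 0 ≤ 2⁻¹ ^ (n + 1) * B := max_le (not_le.1 h).le (by positivity)
      have h3 : (max t 0) ^ 2 ≤ (2⁻¹ ^ (n + 1) * B) ^ 2 := by gcongr
      have h4 : (2⁻¹ ^ (n + 1) * B) ^ 2 = 4⁻¹ ^ (n + 1) * B ^ 2 := by
        rw [mul_pow, ← pow_mul, mul_comm (n + 1) 2, pow_mul]
        norm_num
      linarith

/-- A bounded function in weak `L²` is in `L²`, up to a logarithm. -/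
theorem integral_sq_posPart_le {X : Type*} [MeasurableSpace X] (μ : Measure X) [IsFiniteMeasure μ]
    {f : X → ℝ} (hf : Measurable f) {B K : ℝ} (hB : 0 ≤ B) (hfB : ∀ x, f x ≤ B)
    (hK : ∀ τ, 0 ≤ τ → τ ^ 2 * μ.real {x | τ ≤ f x} ≤ K) (n : ℕ) :
    ∫ x, (max (f x) 0) ^ 2 ∂μ ≤ 4⁻¹ ^ n * B ^ 2 * μ.real univ + n * (4 * K) := by
  have hms : ∀ τ, MeasurableSet {x | τ ≤ f x} := fun τ => measurableSet_le measurable_const hf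
  have hind : ∀ τ x, {u : ℝ | τ ≤ u}.indicator (1 : ℝ → ℝ) (f x) =
      {x | τ ≤ f x}.indicator (1 : X → ℝ) x := fun τ x => by
    simp only [indicator, mem_ofPred_eq, Pi.one_apply]
  have hint : ∀ k, Integrable (fun x => 4⁻¹ ^ k * B ^ 2 *
      {x | 2⁻¹ ^ (k + 1) * B ≤ f x}.indicator (1 : X → ℝ) x) μ := fun k =>
    ((integrable_const (1 : ℝ)).indicator (hms _)).const_mul _
  calc ∫ x, (max (f x) 0) ^ 2 ∂μ
      ≤ ∫ x, (4⁻¹ ^ n * B ^ 2 + ∑ k ∈ Finset.range n, 4⁻¹ ^ k * B ^ 2 *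
          {x | 2⁻¹ ^ (k + 1) * B ≤ f x}.indicator (1 : X → ℝ) x) ∂μ := by
        refine integral_mono_of_nonneg (ae_of_all _ fun x => sq_nonneg _)
          ((integrable_const _).add (integrable_finsetSum _ fun k _ => hint k))
          (ae_of_all _ fun x => ?_)
        refine (sq_posPart_le_sum (hfB x) hB n).trans (le_of_eq ?_)
        simp_rw [hind]
    _ = 4⁻¹ ^ n * B ^ 2 * μ.real univ + ∑ k ∈ Finset.range n, 4⁻¹ ^ k * B ^ 2 *
          μ.real {x | 2⁻¹ ^ (k + 1) * B ≤ f x} := by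
        rw [integral_add (integrable_const _) (integrable_finsetSum _ fun k _ => hint k),
          integral_finsetSum _ fun k _ => hint k, integral_const, smul_eq_mul, mul_comm]
        congr 1
        refine Finset.sum_congr rfl fun k _ => ?_
        rw [integral_const_mul, integral_indicator_one (hms _)]
    _ ≤ _ := by
        gcongr
        refine (Finset.sum_le_card_nsmul _ _ (4 * K) fun k _ => ?_).trans (by simp)
        have h1 := hK (2⁻¹ ^ (k + 1) * B) (by positivity)
        have h2 : (2⁻¹ ^ (k + 1) * B) ^ 2 = 4⁻¹ * (4⁻¹ ^ k * B ^ 2) := by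
          rw [mul_pow, ← pow_mul, mul_comm (k + 1) 2, pow_mul, pow_succ]
          norm_num
          ring
        rw [h2] at h1
        linarith

end LayerCake

section ExtensionL2

variable {d : ℕ}

/-- The weak `L²` bound for the extension operator. -/
theorem SphericalDecay.weak_bound [NeZero d] {s b : ℝ} (h : SphericalDecay d s b) (hs0 : 0 ≤ s)
    (hsd : s ≤ d) {ε : ℝ} (hε : 0 < ε) (l : Measure (Euc d)) [IsFiniteMeasure l] {M : ℝ}
    (hM : 1 ≤ M) (hl : l (closedBall 0 M)ᶜ = 0) {s' κ : ℝ} (hs' : s' ≤ s) (hκ : 0 < κ)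
    (hF : ∀ x r, 0 < r → l (closedBall x r) ≤ ENNReal.ofReal (κ * r ^ s')) :
    ∃ C : ℝ, 0 ≤ C ∧ ∀ R : ℝ, 1 ≤ R → ∀ g : USphere d → ℂ, Continuous g → ∀ τ : ℝ, 0 ≤ τ →
      τ ^ 2 * l.real {x | τ ≤ (sphereExtension g R x).re} ≤
        C * R ^ (-b + ε + (s - s')) * ∫ ω, ‖g ω‖ ^ 2 ∂(normalizedSphereMeasure d) := by
  obtain ⟨C, hC0, hC⟩ := h.linear_bound hs0 hsd hM hε
  refine ⟨C * κ, by positivity, fun R hR g hg τ hτ => ?_⟩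
  have hR0 : 0 < R := by linarith
  have hcont := continuous_sphereExtension hg R
  have hmeas : MeasurableSet {x | τ ≤ (sphereExtension g R x).re} :=
    measurableSet_le measurable_const (Complex.measurable_re.comp hcont.measurable)
  set A := {x | τ ≤ (sphereExtension g R x).re} with hA
  set H := ∫ ω, ‖g ω‖ ^ 2 ∂(normalizedSphereMeasure d) with hH
  have hH0 : 0 ≤ H := integral_nonneg fun _ => by positivity
  have hν := hC R hR (κ * R ^ (s - s')) (by positivity) (l.restrict A) inferInstance
    (nonpos_iff_eq_zero.1 ((Measure.restrict_apply_le _ _).trans hl.le)) (fun x r hr => by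
      have hr0 : 0 < r := (inv_pos.2 hR0).trans_le hr
      refine (Measure.restrict_apply_le _ _).trans ((hF x r hr0).trans
        (ENNReal.ofReal_le_ofReal ?_))
      rw [mul_assoc]
      gcongr
      have h1 : 1 ≤ (R * r) ^ (s - s') := by
        refine Real.one_le_rpow ?_ (by linarith)
        calc 1 = R * R⁻¹ := (mul_inv_cancel₀ hR0.ne').symm
          _ ≤ R * r := by gcongr
      calc r ^ s' ≤ (R * r) ^ (s - s') * r ^ s' := le_mul_of_one_le_left (by positivity) h1
        _ = R ^ (s - s') * (r ^ (s - s') * r ^ s') := by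
            rw [Real.mul_rpow hR0.le hr0.le]
            ring
        _ = _ := by rw [← Real.rpow_add hr0, sub_add_cancel])
  have hd := sq_norm_integral_sphereExtension_le hg R (l.restrict A)
  have hint : Integrable (sphereExtension g R) l :=
    (integrable_const _).mono' hcont.aestronglyMeasurable
      (ae_of_all _ (norm_sphereExtension_le g R))
  have h1 : τ * l.real A ≤ ‖∫ x in A, sphereExtension g R x ∂l‖ := by
    calc τ * l.real A = ∫ _x in A, τ ∂l := by
          rw [setIntegral_const, smul_eq_mul, mul_comm]
      _ ≤ ∫ x in A, (sphereExtension g R x).re ∂l :=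
          setIntegral_mono_on (integrable_const _) hint.re.integrableOn hmeas fun x hx => hx
      _ = (∫ x in A, sphereExtension g R x ∂l).re := integral_re hint.integrableOn
      _ ≤ _ := Complex.re_le_norm _
  have h2 : (τ * l.real A) ^ 2 ≤ H * (C * (κ * R ^ (s - s')) * l.real A * R ^ (-b + ε)) := by
    have hu : (l.restrict A).real univ = l.real A := by simp [measureReal_def]
    rw [hu] at hν
    have h0 : 0 ≤ τ * l.real A := by positivity
    calc _ ≤ ‖∫ x in A, sphereExtension g R x ∂l‖ ^ 2 := by gcongr
      _ ≤ _ := hd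
      _ ≤ _ := by gcongr
  rw [Real.rpow_add hR0]
  rcases (measureReal_nonneg (μ := l) (s := A)).eq_or_lt with h0 | h0
  · rw [← h0, mul_zero]
    positivity
  · refine le_of_mul_le_mul_right ?_ h0
    calc _ = (τ * l.real A) ^ 2 := by ring
      _ ≤ _ := h2
      _ = _ := by ring

theorem sq_norm_eq_sum_posPart (z : ℂ) :
    ‖z‖ ^ 2 = (max z.re 0) ^ 2 + (max (-z).re 0) ^ 2 + (max (Complex.I * z).re 0) ^ 2 +
      (max (-Complex.I * z).re 0) ^ 2 := by
  have h : ∀ t : ℝ, (max t 0) ^ 2 + (max (-t) 0) ^ 2 = t ^ 2 := fun t => by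
    rcases le_total t 0 with ht | ht
    · rw [max_eq_right ht, max_eq_left (by linarith)]
      ring
    · rw [max_eq_left ht, max_eq_right (by linarith)]
      ring
  have h1 : (Complex.I * z).re = -z.im := by simp
  have h2 : (-Complex.I * z).re = z.im := by simp
  rw [← Complex.normSq_eq_norm_sq, Complex.normSq_apply, h1, h2, Complex.neg_re]
  have := h z.re
  have := h z.im
  linarith

theorem sphereExtension_const_mul (u : ℂ) (g : USphere d → ℂ) (r : ℝ) (x : Euc d) :
    sphereExtension (fun ω => u * g ω) r x = u * sphereExtension g r x := by
  simp only [sphereExtension, mul_assoc]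
  exact integral_const_mul _ _

/-- The `L²` bound for the extension operator with respect to a Frostman measure. -/
theorem SphericalDecay.extension_bound [NeZero d] {s b : ℝ} (h : SphericalDecay d s b)
    (hs0 : 0 ≤ s) (hsd : s ≤ d) {ε : ℝ} (hε : 0 < ε) (l : Measure (Euc d)) [IsFiniteMeasure l]
    {M : ℝ} (hM : 1 ≤ M) (hl : l (closedBall 0 M)ᶜ = 0) {s' κ : ℝ} (hs' : s' ≤ s) (hκ : 0 < κ)
    (hF : ∀ x r, 0 < r → l (closedBall x r) ≤ ENNReal.ofReal (κ * r ^ s')) :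
    ∃ C : ℝ, 0 ≤ C ∧ ∀ R : ℝ, 1 ≤ R → ∀ g : USphere d → ℂ, Continuous g →
      ∫ x, ‖sphereExtension g R x‖ ^ 2 ∂l ≤
        C * R ^ (-b + ε + (s - s')) * ∫ ω, ‖g ω‖ ^ 2 ∂(normalizedSphereMeasure d) := by
  obtain ⟨C, hC0, hC⟩ := h.weak_bound hs0 hsd (half_pos hε) l hM hl hs' hκ hF
  set T : ℝ := |b| / (ε / 2) + 1 with hT
  have hT0 : 0 ≤ T := by positivity
  refine ⟨4 * (l.real univ + T * (4 * C)) + 4 * (4 * C), by positivity, fun R hR g hg => ?_⟩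
  have hR0 : 0 < R := by linarith
  set H := ∫ ω, ‖g ω‖ ^ 2 ∂(normalizedSphereMeasure d) with hH
  have hH0 : 0 ≤ H := integral_nonneg fun _ => by positivity
  set K := C * R ^ (-b + ε / 2 + (s - s')) * H with hKdef
  have hK0 : 0 ≤ K := by positivity
  set n : ℕ := ⌈|b| * Real.log R⌉₊ with hn
  have hlog : 0 ≤ Real.log R := Real.log_nonneg hR
  have hn1 : (4⁻¹ : ℝ) ^ n ≤ R ^ (-b) := by
    have h1 : Real.exp (b * Real.log R) ≤ 4 ^ n := by
      calc Real.exp (b * Real.log R) ≤ Real.exp n := by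
            refine Real.exp_le_exp.2 (le_trans ?_ (Nat.le_ceil _))
            gcongr
            exact le_abs_self b
        _ = Real.exp 1 ^ n := by rw [← Real.exp_nat_mul, mul_one]
        _ ≤ 4 ^ n := by
            gcongr
            have := Real.exp_one_lt_d9
            linarith
    rw [inv_pow, Real.rpow_neg hR0.le, Real.rpow_def_of_pos hR0, mul_comm (Real.log R)]
    exact inv_anti₀ (Real.exp_pos _) h1
  have hRe : 1 ≤ R ^ (ε / 2) := Real.one_le_rpow hR (by positivity)
  have hn2 : (n : ℝ) ≤ T * R ^ (ε / 2) := by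
    have h1 := (Nat.ceil_lt_add_one (by positivity : 0 ≤ |b| * Real.log R)).le
    have h2 : Real.log R ≤ R ^ (ε / 2) / (ε / 2) := Real.log_le_rpow_div hR0.le (by positivity)
    calc (n : ℝ) ≤ |b| * Real.log R + 1 := h1
      _ ≤ |b| * (R ^ (ε / 2) / (ε / 2)) + R ^ (ε / 2) := by gcongr
      _ = _ := by rw [hT]; ring
  have hnorm : ∫ ω, ‖g ω‖ ∂(normalizedSphereMeasure d) ≤ √H := by
    refine Real.le_sqrt_of_sq_le ?_
    have h1 := sq_integral_mul_le (μ := normalizedSphereMeasure d) (f := fun ω => ‖g ω‖)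
      (g := fun _ => (1 : ℝ)) (fun _ => norm_nonneg _) (fun _ => zero_le_one)
      (memLp_of_continuous_sphere hg.norm 2) (memLp_of_continuous_sphere continuous_const 2)
    simpa using h1
  have hdir : ∀ u : ℂ, ‖u‖ = 1 → ∫ x, (max (u * sphereExtension g R x).re 0) ^ 2 ∂l ≤
      4⁻¹ ^ n * H * l.real univ + n * (4 * K) := by
    intro u hu
    have hgu : ∫ ω, ‖u * g ω‖ ^ 2 ∂(normalizedSphereMeasure d) = H := by
      simp [hu, hH]
    have h1 := integral_sq_posPart_le l (f := fun x => (u * sphereExtension g R x).re)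
      (B := √H) (K := K) ((Complex.measurable_re.comp
        ((continuous_sphereExtension hg R).measurable.const_mul u))) (Real.sqrt_nonneg _)
      (fun x => (Complex.re_le_norm _).trans (by
        rw [norm_mul, hu, one_mul]
        exact (norm_sphereExtension_le g R x).trans hnorm))
      (fun τ hτ => by
        have := hC R hR (fun ω => u * g ω) (continuous_const.mul hg) τ hτ
        simp only [sphereExtension_const_mul, hgu] at this
        exact this) n
    rwa [Real.sq_sqrt hH0] at h1
  have hbdd : ∀ u : ℂ, ‖u‖ = 1 →
      Integrable (fun x => (max (u * sphereExtension g R x).re 0) ^ 2) l := by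
    intro u hu
    refine (integrable_const (√H ^ 2)).mono' ?_ (ae_of_all _ fun x => ?_)
    · have := continuous_sphereExtension hg R
      exact Continuous.aestronglyMeasurable (by fun_prop)
    · rw [Real.norm_of_nonneg (sq_nonneg _)]
      gcongr
      refine max_le ((Complex.re_le_norm _).trans ?_) (Real.sqrt_nonneg _)
      rw [norm_mul, hu, one_mul]
      exact (norm_sphereExtension_le g R x).trans hnorm
  have hb1 := hbdd 1 (by simp)
  have hb2 := hbdd (-1) (by simp)
  have hb3 := hbdd Complex.I (by simp)
  have hb4 := hbdd (-Complex.I) (by simp)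
  have hd1 := hdir 1 (by simp)
  have hd2 := hdir (-1) (by simp)
  have hd3 := hdir Complex.I (by simp)
  have hd4 := hdir (-Complex.I) (by simp)
  simp only [one_mul, neg_mul] at hb1 hb2 hb3 hb4 hd1 hd2 hd3 hd4
  have htotal : ∫ x, ‖sphereExtension g R x‖ ^ 2 ∂l ≤
      4 * (4⁻¹ ^ n * H * l.real univ + n * (4 * K)) := by
    simp_rw [sq_norm_eq_sum_posPart, neg_mul]
    have hb12 : Integrable (fun x => max (sphereExtension g R x).re 0 ^ 2 +
      max (-sphereExtension g R x).re 0 ^ 2) l := hb1.add hb2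
    have hb123 : Integrable (fun x => max (sphereExtension g R x).re 0 ^ 2 +
      max (-sphereExtension g R x).re 0 ^ 2 +
      max (Complex.I * sphereExtension g R x).re 0 ^ 2) l := hb12.add hb3
    rw [integral_add hb123 hb4, integral_add hb12 hb3, integral_add hb1 hb2]
    linarith
  have hRb : R ^ (-b) ≤ R ^ (-b + ε + (s - s')) :=
    Real.rpow_le_rpow_of_exponent_le hR (by linarith)
  have hRK : R ^ (ε / 2) * K = C * R ^ (-b + ε + (s - s')) * H := by
    rw [hKdef, show -b + ε + (s - s') = ε / 2 + (-b + ε / 2 + (s - s')) by ring,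
      Real.rpow_add hR0 (ε / 2)]
    ring
  set Q := R ^ (-b + ε + (s - s')) with hQ
  have hQ0 : 0 ≤ Q := by positivity
  calc _ ≤ _ := htotal
    _ ≤ 4 * (Q * H * l.real univ + (T * R ^ (ε / 2)) * (4 * K)) := by
        gcongr
        exact hn1.trans hRb
    _ = 4 * (Q * H * l.real univ + T * 4 * (R ^ (ε / 2) * K)) := by ring
    _ ≤ 4 * (Q * H * l.real univ + T * 4 * (C * Q * H)) + 4 * (4 * C) * Q * H := by
        rw [hRK]
        have : 0 ≤ 4 * (4 * C) * Q * H := by positivity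
        linarith
    _ = _ := by ring

end ExtensionL2

/-! ### Polar coordinates -/

section Polar

variable {d : ℕ}

/-- The total surface measure of the unit sphere. -/
noncomputable def sphereMass (d : ℕ) : ℝ≥0∞ :=
  (volume : Measure (EuclideanSpace ℝ (Fin d))).toSphere univ

theorem sphereMass_ne_top : sphereMass d ≠ ∞ := measure_ne_top _ _

theorem sphereMass_ne_zero [NeZero d] : sphereMass d ≠ 0 := by
  rw [sphereMass, Measure.measure_univ_ne_zero]
  exact Measure.toSphere_ne_zero _

theorem toSphere_eq_smul [NeZero d] :
    (volume : Measure (EuclideanSpace ℝ (Fin d))).toSphere =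
      sphereMass d • normalizedSphereMeasure d := by
  rw [normalizedSphereMeasure, smul_smul]
  change _ = (sphereMass d * (sphereMass d)⁻¹) • _
  rw [ENNReal.mul_inv_cancel sphereMass_ne_zero sphereMass_ne_top, one_smul]

theorem lintegral_volumeIoiPow (n : ℕ) {f : ℝ → ℝ≥0∞} (hf : Measurable f) :
    ∫⁻ r, f r ∂(Measure.volumeIoiPow n) = ∫⁻ r in Ioi (0 : ℝ), ENNReal.ofReal (r ^ n) * f r := by
  have h : Measurable fun r : Ioi (0 : ℝ) => f r := hf.comp measurable_subtype_coe
  rw [Measure.volumeIoiPow, lintegral_withDensity_eq_lintegral_mul _ (by fun_prop) h]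
  exact lintegral_subtype_comap measurableSet_Ioi fun r => ENNReal.ofReal (r ^ n) * f r

theorem lintegral_polar [NeZero d] {f : Euc d → ℝ≥0∞} (hf : Measurable f) :
    ∫⁻ x, f x = sphereMass d * ∫⁻ r in Ioi (0 : ℝ), ENNReal.ofReal (r ^ (d - 1)) *
      ∫⁻ ω : USphere d, f (r • (ω : Euc d)) ∂(normalizedSphereMeasure d) := by
  have hmeas : Measurable fun p : USphere d × ℝ => f (p.2 • (p.1 : Euc d)) := by fun_prop
  have h1 : ∫⁻ x, f x = ∫⁻ p : USphere d × Ioi (0 : ℝ), f ((p.2 : ℝ) • (p.1 : Euc d))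
      ∂((volume : Measure (Euc d)).toSphere.prod (Measure.volumeIoiPow (d - 1))) := by
    have h2 := (volume : Measure (Euc d)).measurePreserving_homeomorphUnitSphereProd
    rw [finrank_euclideanSpace_fin] at h2
    have h3 : ∫⁻ x, f x = ∫⁻ x : ({0}ᶜ : Set (Euc d)), f x ∂(Measure.comap Subtype.val volume) := by
      rw [lintegral_subtype_comap (measurableSet_singleton _).compl, restrict_compl_singleton]
    rw [← h2.lintegral_comp_emb (Homeomorph.measurableEmbedding _), h3]
    refine lintegral_congr fun x => ?_
    have hx : ‖(x : Euc d)‖ ≠ 0 := norm_ne_zero_iff.2 x.2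
    congr 1
    simp [smul_smul, hx]
  rw [h1, lintegral_prod_symm _ (by fun_prop)]
  rw [toSphere_eq_smul]
  simp_rw [lintegral_smul_measure, smul_eq_mul]
  have hm2 : Measurable fun r : ℝ =>
      ∫⁻ ω : USphere d, f (r • (ω : Euc d)) ∂(normalizedSphereMeasure d) :=
    hmeas.lintegral_prod_left'
  have hm3 : Measurable fun r : Ioi (0 : ℝ) =>
      ∫⁻ ω : USphere d, f ((r : ℝ) • (ω : Euc d)) ∂(normalizedSphereMeasure d) :=
    hm2.comp measurable_subtype_coe
  rw [lintegral_const_mul _ hm3]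
  congr 1
  exact lintegral_volumeIoiPow _ hm2

theorem enorm_integral_polar_le [NeZero d] {f : Euc d → ℂ} (hf : Continuous f)
    (hfi : Integrable f) :
    ‖∫ x, f x‖ₑ ≤ sphereMass d * ∫⁻ r in Ioi (0 : ℝ), ENNReal.ofReal (r ^ (d - 1)) *
      ‖∫ ω : USphere d, f (r • (ω : Euc d)) ∂(normalizedSphereMeasure d)‖ₑ := by
  have h2 := (volume : Measure (Euc d)).measurePreserving_homeomorphUnitSphereProd
  rw [finrank_euclideanSpace_fin] at h2
  have hemb : MeasurableEmbedding (homeomorphUnitSphereProd (Euc d)) :=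
    Homeomorph.measurableEmbedding _
  let g : USphere d × Ioi (0 : ℝ) → ℂ := fun p => f ((p.2 : ℝ) • (p.1 : Euc d))
  have hg : ∀ x : ({0}ᶜ : Set (Euc d)), g (homeomorphUnitSphereProd (Euc d) x) = f x := by
    intro x
    have hx : ‖(x : Euc d)‖ ≠ 0 := norm_ne_zero_iff.2 x.2
    simp [g, smul_smul, hx]
  have hgi : Integrable g ((volume : Measure (Euc d)).toSphere.prod
      (Measure.volumeIoiPow (d - 1))) := by
    rw [← h2.integrable_comp_emb hemb]
    have : g ∘ homeomorphUnitSphereProd (Euc d) = f ∘ Subtype.val := funext hg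
    rw [this, ← integrableOn_iff_comap_subtypeVal (measurableSet_singleton _).compl]
    exact hfi.integrableOn
  have h1 : ∫ x, f x = ∫ p, g p
      ∂((volume : Measure (Euc d)).toSphere.prod (Measure.volumeIoiPow (d - 1))) := by
    have h3 : ∫ x, f x = ∫ x : ({0}ᶜ : Set (Euc d)), f x ∂(Measure.comap Subtype.val volume) := by
      rw [integral_subtype_comap (measurableSet_singleton _).compl, restrict_compl_singleton]
    rw [← h2.integral_comp hemb, h3]
    exact integral_congr_ae (ae_of_all _ fun x => (hg x).symm)
  have hcont : Continuous fun r : ℝ => ∫ ω : USphere d, f (r • (ω : Euc d))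
      ∂(normalizedSphereMeasure d) := by
    have h := continuous_parametric_integral_of_continuous (μ := normalizedSphereMeasure d)
      (f := fun (r : ℝ) (ω : USphere d) => f (r • (ω : Euc d)))
      (by unfold Function.uncurry; fun_prop) (s := univ) isCompact_univ
    simpa using h
  rw [h1, integral_prod_symm _ hgi]
  refine (enorm_integral_le_lintegral_enorm _).trans (le_of_eq ?_)
  simp_rw [g]
  rw [toSphere_eq_smul]
  simp_rw [integral_smul_measure, enorm_smul]
  have hm : Measurable fun r : Ioi (0 : ℝ) =>
      ‖∫ ω : USphere d, f ((r : ℝ) • (ω : Euc d)) ∂(normalizedSphereMeasure d)‖ₑ :=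
    hcont.enorm.measurable.comp measurable_subtype_coe
  rw [lintegral_const_mul _ hm]
  congr 1
  · rw [Real.enorm_of_nonneg ENNReal.toReal_nonneg, ENNReal.ofReal_toReal sphereMass_ne_top]
  · exact lintegral_volumeIoiPow _ hcont.enorm.measurable

end Polar

/-! ### Energy estimates -/

section Energy

variable {d : ℕ}

theorem exists_bound_lintegral_exp_neg_sq {α : ℝ} (ρ : Measure (Euc d))
    {C : ℝ} (hC : 0 ≤ C) (hρ : ∀ r, 0 < r → ρ (closedBall 0 r) ≤ ENNReal.ofReal (C * r ^ α)) :
    ∃ C' : ℝ, 0 ≤ C' ∧ ∀ R : ℝ, 0 < R →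
      ∫⁻ z, ENNReal.ofReal (Real.exp (-Real.pi * (R * ‖z‖) ^ 2)) ∂ρ ≤
        ENNReal.ofReal (C' * R ^ (-α)) := by
  let a : ℕ → ℝ := fun k => Real.exp (-(k : ℝ)) * ((k : ℝ) + 1) ^ α
  have ha0 : ∀ k, 0 ≤ a k := fun k => by positivity
  have ha : Summable a := by
    have h1 := Real.summable_pow_mul_exp_neg_nat_mul (⌈α⌉₊) one_pos
    have h2 := ((summable_nat_add_iff 1).2 h1).mul_left (Real.exp 1)
    refine Summable.of_nonneg_of_le ha0 (fun k => ?_) h2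
    have h3 : ((k : ℝ) + 1) ^ α ≤ ((k : ℝ) + 1) ^ ⌈α⌉₊ := by
      rw [← Real.rpow_natCast]
      exact Real.rpow_le_rpow_of_exponent_le (by linarith [(Nat.cast_nonneg k : (0 : ℝ) ≤ k)])
        (Nat.le_ceil α)
    have h4 : Real.exp 1 * Real.exp (-1 * ((k + 1 : ℕ) : ℝ)) = Real.exp (-(k : ℝ)) := by
      rw [← Real.exp_add]
      congr 1
      push_cast
      ring
    calc a k ≤ Real.exp (-(k : ℝ)) * ((k : ℝ) + 1) ^ ⌈α⌉₊ := by
          simp only [a]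
          gcongr
      _ = _ := by
          rw [← h4]
          push_cast
          ring
  refine ⟨C * ∑' k, a k, mul_nonneg hC (tsum_nonneg ha0), fun R hR => ?_⟩
  calc ∫⁻ z, ENNReal.ofReal (Real.exp (-Real.pi * (R * ‖z‖) ^ 2)) ∂ρ
      ≤ ∫⁻ z, ∑' k : ℕ, (closedBall (0 : Euc d) ((k + 1) / R)).indicator
          (fun _ => ENNReal.ofReal (Real.exp (-(k : ℝ)))) z ∂ρ := by
        refine lintegral_mono fun z => ?_
        refine le_trans ?_ (ENNReal.le_tsum ⌊R * ‖z‖⌋₊)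
        have h1 := Nat.floor_le (by positivity : 0 ≤ R * ‖z‖)
        have h2 := (Nat.lt_floor_add_one (R * ‖z‖)).le
        rw [indicator_of_mem]
        · refine ENNReal.ofReal_le_ofReal (Real.exp_le_exp.2 ?_)
          have h3 := Real.pi_gt_three
          have h4 : ((⌊R * ‖z‖⌋₊ : ℕ) : ℝ) ≤ ((⌊R * ‖z‖⌋₊ : ℕ) : ℝ) ^ 2 := by
            exact_mod_cast Nat.le_self_pow two_ne_zero _
          have h5 : ((⌊R * ‖z‖⌋₊ : ℕ) : ℝ) ^ 2 ≤ (R * ‖z‖) ^ 2 := by gcongr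
          nlinarith [sq_nonneg (R * ‖z‖)]
        · rw [mem_closedBall_zero_iff, le_div_iff₀ hR, mul_comm]
          exact h2
    _ = ∑' k : ℕ, ENNReal.ofReal (Real.exp (-(k : ℝ))) *
          ρ (closedBall (0 : Euc d) ((k + 1) / R)) := by
        rw [lintegral_tsum fun k =>
          (measurable_const.indicator isClosed_closedBall.measurableSet).aemeasurable]
        refine tsum_congr fun k => ?_
        rw [lintegral_indicator_const isClosed_closedBall.measurableSet]
    _ ≤ ∑' k : ℕ, ENNReal.ofReal (C * R ^ (-α) * a k) := by
        refine ENNReal.tsum_le_tsum fun k => ?_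
        calc _ ≤ ENNReal.ofReal (Real.exp (-(k : ℝ))) *
              ENNReal.ofReal (C * (((k : ℝ) + 1) / R) ^ α) := by
              gcongr
              exact hρ _ (by positivity)
          _ = _ := by
              rw [← ENNReal.ofReal_mul (Real.exp_pos _).le]
              congr 1
              rw [Real.div_rpow (by positivity) hR.le, Real.rpow_neg hR.le]
              simp only [a]
              ring
    _ = ENNReal.ofReal (C * R ^ (-α) * ∑' k, a k) := by
        rw [← ENNReal.ofReal_tsum_of_nonneg (fun k => by have := ha0 k; positivity)
          (ha.mul_left _), tsum_mul_left]
    _ = _ := by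
        congr 1
        ring

/-- The self-difference measure `ν ∗ ν̃`, whose Fourier transform is `|ν̂|²`. -/
noncomputable def differenceMeasure (ν : Measure (Euc d)) : Measure (Euc d) :=
  ν.conv (ν.map fun x => -x)

instance (ν : Measure (Euc d)) [IsFiniteMeasure ν] : IsFiniteMeasure (differenceMeasure ν) := by
  have : IsFiniteMeasure (ν.map fun x => -x) := Measure.isFiniteMeasure_map ν _
  unfold differenceMeasure
  infer_instance

theorem fourierMeasure_differenceMeasure (ν : Measure (Euc d)) [IsFiniteMeasure ν] (ξ : Euc d) :
    fourierMeasure (differenceMeasure ν) ξ = ((‖fourierMeasure ν ξ‖ ^ 2 : ℝ) : ℂ) := by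
  have : IsFiniteMeasure (ν.map fun x => -x) := Measure.isFiniteMeasure_map ν _
  have h1 : fourierMeasure (ν.map fun x => -x) ξ = (starRingEnd ℂ) (fourierMeasure ν ξ) := by
    rw [fourierMeasure, integral_map (by fun_prop) (by fun_prop), fourierMeasure, ← integral_conj]
    congr with x
    rw [← Complex.exp_conj, map_mul, Complex.conj_I, Complex.conj_ofReal, inner_neg_left]
    congr 1
    push_cast
    ring
  rw [differenceMeasure, fourierMeasure_conv, h1, Complex.mul_conj, Complex.normSq_eq_norm_sq]

theorem differenceMeasure_closedBall_le {α C : ℝ} (ν : Measure (Euc d)) [IsProbabilityMeasure ν]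
    (hν : ∀ x r, 0 < r → ν (closedBall x r) ≤ ENNReal.ofReal (C * r ^ α)) {r : ℝ} (hr : 0 < r) :
    differenceMeasure ν (closedBall 0 r) ≤ ENNReal.ofReal (C * r ^ α) := by
  have : IsFiniteMeasure (ν.map fun x => -x) := Measure.isFiniteMeasure_map ν _
  have hm : MeasurableSet (closedBall (0 : Euc d) r) := isClosed_closedBall.measurableSet
  rw [differenceMeasure, ← lintegral_indicator_one hm,
    Measure.lintegral_conv (measurable_one.indicator hm)]
  calc _ ≤ ∫⁻ _x, ENNReal.ofReal (C * r ^ α) ∂ν := by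
        refine lintegral_mono fun x => ?_
        rw [lintegral_map (f := fun y => (closedBall (0 : Euc d) r).indicator 1 (x + y))
          ((measurable_one.indicator hm).comp (measurable_const_add x)) (by fun_prop)]
        refine le_trans (le_of_eq ?_) (hν x r hr)
        rw [← lintegral_indicator_one isClosed_closedBall.measurableSet]
        refine lintegral_congr fun y => ?_
        have h : x + -y ∈ closedBall (0 : Euc d) r ↔ y ∈ closedBall x r := by
          rw [mem_closedBall_zero_iff, mem_closedBall', dist_eq_norm, sub_eq_add_neg]
        by_cases hy : y ∈ closedBall x r
        · rw [indicator_of_mem hy, indicator_of_mem (h.2 hy), Pi.one_apply, Pi.one_apply]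
        · rw [indicator_of_notMem hy, indicator_of_notMem (mt h.1 hy)]
    _ = _ := by simp

theorem integrable_gaussian {c : ℝ} (hc : 0 < c) :
    Integrable fun ξ : Euc d => Complex.exp (-(c : ℂ) * ‖ξ‖ ^ 2) := by
  have := GaussianFourier.integrable_cexp_neg_mul_sq_norm_add (V := Euc d) (b := (c : ℂ))
    (by simpa using hc) 0 0
  simpa using this

theorem integral_gaussian_mul_fourierMeasure (ρ : Measure (Euc d)) [IsFiniteMeasure ρ] {R : ℝ}
    (hR : 0 < R) :
    ‖∫ ξ, Complex.exp (-((Real.pi / R ^ 2 : ℝ) : ℂ) * ‖ξ‖ ^ 2) * fourierMeasure ρ ξ‖ ≤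
      R ^ d * ∫ z, Real.exp (-Real.pi * (R * ‖z‖) ^ 2) ∂ρ := by
  set c : ℝ := Real.pi / R ^ 2 with hc
  have hc0 : 0 < c := by positivity
  have hg := integrable_gaussian (d := d) hc0
  have hswap : ∫ ξ, Complex.exp (-(c : ℂ) * ‖ξ‖ ^ 2) * fourierMeasure ρ ξ =
      ∫ z, (∫ ξ, Complex.exp (-(c : ℂ) * ‖ξ‖ ^ 2) *
        Complex.exp (((-2 * Real.pi * ⟪z, ξ⟫ : ℝ) : ℂ) * Complex.I)) ∂ρ := by
    rw [← integral_integral_swap]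
    · congr with ξ
      rw [integral_const_mul]
      rfl
    · refine Integrable.mono' (hg.norm.comp_fst ρ) (Continuous.aestronglyMeasurable ?_)
        (ae_of_all _ fun p => ?_)
      · unfold Function.uncurry
        fun_prop
      · rw [Function.uncurry, norm_mul, Complex.norm_exp_ofReal_mul_I, mul_one]
  rw [hswap]
  have hgauss : ∀ z : Euc d, ‖∫ ξ, Complex.exp (-(c : ℂ) * ‖ξ‖ ^ 2) *
      Complex.exp (((-2 * Real.pi * ⟪z, ξ⟫ : ℝ) : ℂ) * Complex.I)‖ =
      R ^ d * Real.exp (-Real.pi * (R * ‖z‖) ^ 2) := by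
    intro z
    have h1 := fourier_gaussian_innerProductSpace (V := Euc d) (b := (c : ℂ))
      (by simpa using hc0) z
    rw [Real.fourier_eq'] at h1
    have h2 : ∫ ξ, Complex.exp (-(c : ℂ) * ‖ξ‖ ^ 2) *
        Complex.exp (((-2 * Real.pi * ⟪z, ξ⟫ : ℝ) : ℂ) * Complex.I) =
        ∫ v, Complex.exp (((-2 * Real.pi * ⟪v, z⟫ : ℝ) : ℂ) * Complex.I) •
          Complex.exp (-(c : ℂ) * ‖v‖ ^ 2) := by
      congr with v
      rw [smul_eq_mul, mul_comm, real_inner_comm]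
    rw [h2, h1, norm_mul, finrank_euclideanSpace_fin]
    congr 1
    · have h3 : ((Real.pi : ℂ) / (c : ℂ)) = ((R ^ 2 : ℝ) : ℂ) := by
        rw [← Complex.ofReal_div, hc]
        congr 1
        field_simp
      rw [h3, Complex.norm_cpow_eq_rpow_re_of_pos (by positivity)]
      have h4 : ((d : ℂ) / 2).re = (d : ℝ) / 2 := by simp
      rw [h4, ← Real.rpow_natCast, ← Real.rpow_natCast, ← Real.rpow_mul hR.le]
      congr 1
      push_cast
      ring
    · rw [Complex.norm_exp]
      congr 1
      have h5 : (-(Real.pi : ℂ) ^ 2 * (‖z‖ : ℂ) ^ 2 / (c : ℂ)) =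
          ((-Real.pi * (R * ‖z‖) ^ 2 : ℝ) : ℂ) := by
        rw [hc]
        push_cast
        field_simp
      rw [h5, Complex.ofReal_re]
  refine (norm_integral_le_integral_norm _).trans (le_of_eq ?_)
  simp_rw [hgauss]
  rw [integral_const_mul]

/-- The `L²` norm of the Fourier transform of an `α`-dimensional measure over balls. -/
theorem exists_lintegral_fourierMeasure_sq_le {α C : ℝ} (hC : 0 ≤ C)
    (ν : Measure (Euc d)) [IsProbabilityMeasure ν]
    (hν : ∀ x r, 0 < r → ν (closedBall x r) ≤ ENNReal.ofReal (C * r ^ α)) :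
    ∃ C' : ℝ, 0 ≤ C' ∧ ∀ R : ℝ, 0 < R →
      ∫⁻ ξ in closedBall 0 R, ENNReal.ofReal (‖fourierMeasure ν ξ‖ ^ 2) ≤
        ENNReal.ofReal (C' * R ^ ((d : ℝ) - α)) := by
  obtain ⟨C', hC'0, hC'⟩ := exists_bound_lintegral_exp_neg_sq (differenceMeasure ν) hC
    (fun r hr => differenceMeasure_closedBall_le ν hν hr)
  refine ⟨Real.exp Real.pi * C', by positivity, fun R hR => ?_⟩
  set c : ℝ := Real.pi / R ^ 2 with hc
  have hc0 : 0 < c := by positivity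
  have hcexp : ∀ ξ : Euc d, Complex.exp (-(c : ℂ) * ‖ξ‖ ^ 2) =
      ((Real.exp (-c * ‖ξ‖ ^ 2) : ℝ) : ℂ) := fun ξ => by push_cast; rfl
  have hprod : ∀ ξ, Complex.exp (-(c : ℂ) * ‖ξ‖ ^ 2) * fourierMeasure (differenceMeasure ν) ξ =
      ((Real.exp (-c * ‖ξ‖ ^ 2) * ‖fourierMeasure ν ξ‖ ^ 2 : ℝ) : ℂ) := fun ξ => by
    rw [hcexp, fourierMeasure_differenceMeasure]
    push_cast
    rfl
  have hcont := continuous_fourierMeasure ν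
  have hint : Integrable fun ξ : Euc d =>
      Real.exp (-c * ‖ξ‖ ^ 2) * ‖fourierMeasure ν ξ‖ ^ 2 := by
    have hg : Integrable fun ξ : Euc d => Real.exp (-c * ‖ξ‖ ^ 2) := by
      refine (integrable_gaussian (d := d) hc0).norm.congr (ae_of_all _ fun ξ => ?_)
      dsimp only
      rw [hcexp, Complex.norm_real, Real.norm_of_nonneg (Real.exp_pos _).le]
    refine hg.mono' (Continuous.aestronglyMeasurable (by fun_prop)) (ae_of_all _ fun ξ => ?_)
    rw [Real.norm_of_nonneg (by positivity)]
    refine mul_le_of_le_one_right (Real.exp_pos _).le (pow_le_one₀ (norm_nonneg _) ?_)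
    simpa using norm_fourierMeasure_le ν ξ
  have hmain := integral_gaussian_mul_fourierMeasure (differenceMeasure ν) hR
  simp_rw [← hc, hprod] at hmain
  rw [integral_complex_ofReal, Complex.norm_real] at hmain
  have hmain := (le_abs_self _).trans hmain
  have hρ : ∫ z, Real.exp (-Real.pi * (R * ‖z‖) ^ 2) ∂(differenceMeasure ν) ≤ C' * R ^ (-α) := by
    rw [integral_eq_lintegral_of_nonneg_ae (ae_of_all _ fun z => (Real.exp_pos _).le)
      (Continuous.aestronglyMeasurable (by fun_prop))]
    exact ENNReal.toReal_le_of_le_ofReal (by positivity) (hC' R hR)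
  calc ∫⁻ ξ in closedBall 0 R, ENNReal.ofReal (‖fourierMeasure ν ξ‖ ^ 2)
      ≤ ∫⁻ ξ in closedBall 0 R, ENNReal.ofReal
          (Real.exp Real.pi * (Real.exp (-c * ‖ξ‖ ^ 2) * ‖fourierMeasure ν ξ‖ ^ 2)) := by
        refine setLIntegral_mono (by fun_prop) fun ξ hξ => ENNReal.ofReal_le_ofReal ?_
        rw [← mul_assoc, ← Real.exp_add]
        refine le_mul_of_one_le_left (by positivity) (Real.one_le_exp ?_)
        rw [mem_closedBall_zero_iff] at hξ
        have h1 : ‖ξ‖ ^ 2 ≤ R ^ 2 := by gcongr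
        have h2 : c * ‖ξ‖ ^ 2 ≤ Real.pi := by
          calc c * ‖ξ‖ ^ 2 ≤ c * R ^ 2 := by gcongr
            _ = Real.pi := by rw [hc]; field_simp
        linarith
    _ ≤ ∫⁻ ξ : Euc d, ENNReal.ofReal
          (Real.exp Real.pi * (Real.exp (-c * ‖ξ‖ ^ 2) * ‖fourierMeasure ν ξ‖ ^ 2)) :=
        setLIntegral_le_lintegral _ _
    _ = ENNReal.ofReal (Real.exp Real.pi *
          ∫ ξ : Euc d, Real.exp (-c * ‖ξ‖ ^ 2) * ‖fourierMeasure ν ξ‖ ^ 2) := by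
        rw [← integral_const_mul, ofReal_integral_eq_lintegral_ofReal (hint.const_mul _)
          (ae_of_all _ fun ξ => by positivity)]
    _ ≤ _ := by
        refine ENNReal.ofReal_le_ofReal ?_
        rw [mul_assoc]
        gcongr
        calc _ ≤ _ := hmain
          _ ≤ R ^ d * (C' * R ^ (-α)) := by gcongr
          _ = C' * (R ^ (d : ℝ) * R ^ (-α)) := by rw [Real.rpow_natCast]; ring
          _ = _ := by rw [← Real.rpow_add hR, sub_eq_add_neg]

/-- Finiteness of the energy of an `α`-dimensional measure. -/
theorem lintegral_rpow_mul_fourierMeasure_sq_lt_top {α C θ : ℝ} (hαd : α ≤ d)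
    (hC : 0 ≤ C) (hθ : (d : ℝ) - α < θ) (ν : Measure (Euc d)) [IsProbabilityMeasure ν]
    (hν : ∀ x r, 0 < r → ν (closedBall x r) ≤ ENNReal.ofReal (C * r ^ α)) :
    ∫⁻ ξ in (closedBall (0 : Euc d) 1)ᶜ,
      ENNReal.ofReal (‖ξ‖ ^ (-θ) * ‖fourierMeasure ν ξ‖ ^ 2) < ∞ := by
  obtain ⟨C', hC'0, hC'⟩ := exists_lintegral_fourierMeasure_sq_le hC ν hν
  have hθ0 : 0 < θ := by linarith
  let S : ℕ → Set (Euc d) := fun k => closedBall 0 (2 ^ (k + 1)) \ ball 0 (2 ^ k)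
  have hcov : (closedBall (0 : Euc d) 1)ᶜ ⊆ ⋃ k, S k := by
    intro ξ hξ
    rw [mem_compl_iff, mem_closedBall_zero_iff, not_le] at hξ
    obtain ⟨k, hk1, hk2⟩ := exists_nat_pow_near hξ.le one_lt_two
    refine mem_iUnion.2 ⟨k, ?_, ?_⟩
    · exact mem_closedBall_zero_iff.2 hk2.le
    · rw [mem_ball_zero_iff, not_lt]
      exact hk1
  set q : ℝ := 2 ^ ((d : ℝ) - α - θ) with hq
  have hq1 : q < 1 := Real.rpow_lt_one_of_one_lt_of_neg one_lt_two (by linarith)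
  have hq0 : 0 < q := by positivity
  have hpk : ∀ k : ℕ, ∫⁻ ξ in S k, ENNReal.ofReal (‖ξ‖ ^ (-θ) * ‖fourierMeasure ν ξ‖ ^ 2) ≤
      ENNReal.ofReal (C' * 2 ^ ((d : ℝ) - α) * q ^ k) := by
    intro k
    have hk0 : (0 : ℝ) < 2 ^ k := by positivity
    have hms : MeasurableSet (S k) :=
      isClosed_closedBall.measurableSet.diff isOpen_ball.measurableSet
    have hcont := continuous_fourierMeasure ν
    calc _ ≤ ∫⁻ ξ in S k, ENNReal.ofReal (((2 : ℝ) ^ k) ^ (-θ)) *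
          ENNReal.ofReal (‖fourierMeasure ν ξ‖ ^ 2) := by
          refine setLIntegral_mono (by fun_prop) fun ξ hξ => ?_
          rw [← ENNReal.ofReal_mul (by positivity)]
          refine ENNReal.ofReal_le_ofReal ?_
          gcongr ?_ * _
          refine Real.rpow_le_rpow_of_nonpos hk0 ?_ (by linarith)
          have := hξ.2
          rwa [mem_ball_zero_iff, not_lt] at this
      _ = ENNReal.ofReal (((2 : ℝ) ^ k) ^ (-θ)) *
          ∫⁻ ξ in S k, ENNReal.ofReal (‖fourierMeasure ν ξ‖ ^ 2) :=
          lintegral_const_mul _ (by fun_prop)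
      _ ≤ ENNReal.ofReal (((2 : ℝ) ^ k) ^ (-θ)) *
          ENNReal.ofReal (C' * (2 ^ (k + 1)) ^ ((d : ℝ) - α)) := by
          gcongr
          exact (lintegral_mono_set sdiff_subset).trans (hC' _ (by positivity))
      _ = _ := by
          rw [← ENNReal.ofReal_mul (by positivity)]
          congr 1
          rw [hq, ← Real.rpow_natCast, ← Real.rpow_natCast, ← Real.rpow_natCast,
            ← Real.rpow_mul zero_le_two, ← Real.rpow_mul zero_le_two, ← Real.rpow_mul zero_le_two]
          rw [mul_left_comm, ← Real.rpow_add two_pos, mul_assoc, ← Real.rpow_add two_pos]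
          congr 2
          push_cast
          ring
  calc _ ≤ ∫⁻ ξ in ⋃ k, S k, ENNReal.ofReal (‖ξ‖ ^ (-θ) * ‖fourierMeasure ν ξ‖ ^ 2) :=
        lintegral_mono_set hcov
    _ ≤ ∑' k, ∫⁻ ξ in S k, ENNReal.ofReal (‖ξ‖ ^ (-θ) * ‖fourierMeasure ν ξ‖ ^ 2) :=
        lintegral_iUnion_le _ _
    _ ≤ ∑' k : ℕ, ENNReal.ofReal (C' * 2 ^ ((d : ℝ) - α) * q ^ k) := ENNReal.tsum_le_tsum hpk
    _ = ENNReal.ofReal (∑' k : ℕ, C' * 2 ^ ((d : ℝ) - α) * q ^ k) :=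
        (ENNReal.ofReal_tsum_of_nonneg (fun k => by positivity)
          ((summable_geometric_of_lt_one hq0.le hq1).mul_left _)).symm
    _ < ∞ := ENNReal.ofReal_lt_top

end Energy

/-! ### Pinned distance sets of measure zero -/

section Pinned

variable {d : ℕ}

theorem volume_norm_mem_eq_zero [NeZero d] {N : Set ℝ} (hN : MeasurableSet N)
    (h0 : volume N = 0) : volume {z : Euc d | ‖z‖ ∈ N} = 0 := by
  have hm : MeasurableSet {z : Euc d | ‖z‖ ∈ N} := measurable_norm hN
  rw [← lintegral_indicator_one hm, lintegral_polar (measurable_one.indicator hm)]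
  refine mul_eq_zero_of_right _ ?_
  rw [lintegral_eq_zero_iff' ?_]
  · have h1 : ∀ᵐ r : ℝ, r ∉ N := by
      rw [ae_iff]
      simpa using h0
    filter_upwards [ae_restrict_mem measurableSet_Ioi, ae_restrict_of_ae h1] with r hr hrN
    refine mul_eq_zero_of_right _ ?_
    have h2 : ∀ ω : USphere d,
        ({z : Euc d | ‖z‖ ∈ N}.indicator (1 : Euc d → ℝ≥0∞)) (r • (ω : Euc d)) = 0 := by
      intro ω
      refine indicator_of_notMem ?_ _
      rw [mem_ofPred_eq, norm_smul, norm_eq_of_mem_sphere ω, mul_one,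
        Real.norm_of_nonneg (le_of_lt hr)]
      exact hrN
    simp_rw [h2]
    simp
  · have h3 : Measurable fun p : USphere d × ℝ =>
        ({z : Euc d | ‖z‖ ∈ N}.indicator (1 : Euc d → ℝ≥0∞)) (p.2 • (p.1 : Euc d)) :=
      (measurable_one.indicator hm).comp (by fun_prop)
    have h4 : Measurable fun r : ℝ => ∫⁻ ω : USphere d,
        ({z : Euc d | ‖z‖ ∈ N}.indicator (1 : Euc d → ℝ≥0∞)) (r • (ω : Euc d))
          ∂(normalizedSphereMeasure d) := h3.lintegral_prod_left'
    exact (Measurable.mul (by fun_prop) h4).aemeasurable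

/-- A radial bump function equal to one where `‖z‖` lies in a given null compact set, and with
small `L²` norm. -/
theorem exists_radial_schwartzMap [NeZero d] {T : Set ℝ} (hT : IsCompact T)
    (hT0 : ∀ t ∈ T, 0 ≤ t) (hnull : volume T = 0) {δ : ℝ≥0∞} (hδ : 0 < δ) :
    ∃ ψ : 𝓢(Euc d, ℂ), (∀ z w, ‖z‖ = ‖w‖ → ψ z = ψ w) ∧ (∀ z, ‖z‖ ∈ T → ψ z = 1) ∧
      ∫⁻ z, ‖ψ z‖ₑ ^ 2 ≤ δ := by
  obtain ⟨M, hM0, hM⟩ : ∃ M : ℝ, 0 ≤ M ∧ T ⊆ ball 0 M := by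
    obtain ⟨M, hM⟩ := hT.isBounded.subset_ball 0
    exact ⟨|M|, abs_nonneg M, hM.trans (ball_subset_ball (le_abs_self M))⟩
  let Q : Set ℝ := (fun t => t ^ 2) '' T
  have hQ : IsCompact Q := hT.image (by fun_prop)
  let q : Euc d → ℝ := fun z => ‖z‖ ^ 2
  have hq : Continuous q := by fun_prop
  let m : Measure ℝ := (volume.restrict (ball (0 : Euc d) M)).map q
  have : IsFiniteMeasure (volume.restrict (ball (0 : Euc d) M)) :=
    ⟨by rw [Measure.restrict_apply_univ]; exact measure_ball_lt_top⟩
  have : IsFiniteMeasure m := Measure.isFiniteMeasure_map _ _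
  have hqQ : ∀ z, q z ∈ Q ↔ ‖z‖ ∈ T := by
    intro z
    constructor
    · rintro ⟨t, ht, htz⟩
      have : t = ‖z‖ := (pow_left_inj₀ (hT0 t ht) (norm_nonneg z) two_ne_zero).1 htz
      exact this ▸ ht
    · exact fun h => ⟨_, h, rfl⟩
  have hmQ : m Q = 0 := by
    rw [Measure.map_apply hq.measurable hQ.measurableSet]
    refine measure_mono_null (fun z hz => (hqQ z).1 hz) ?_ |> fun h => h
    exact le_antisymm ((Measure.restrict_apply_le _ _).trans
      (volume_norm_mem_eq_zero hT.measurableSet hnull).le) zero_le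
  obtain ⟨U, hQU, hUo, hU⟩ := Q.exists_isOpen_lt_of_lt (μ := m) δ (by rwa [hmQ])
  let V : Set ℝ := U ∩ Iio (M ^ 2)
  have hVo : IsOpen V := hUo.inter isOpen_Iio
  have hQV : Q ⊆ V := by
    refine subset_inter hQU ?_
    rintro _ ⟨t, ht, rfl⟩
    have h1 := hM ht
    rw [mem_ball_zero_iff, Real.norm_of_nonneg (hT0 t ht)] at h1
    exact pow_lt_pow_left₀ h1 (hT0 t ht) two_ne_zero
  obtain ⟨ρ, hρ0, hρ1, hρ⟩ := exists_contMDiffMap_zero_one_of_isClosed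
    (modelWithCornersSelf ℝ ℝ) (n := (⊤ : ℕ∞)) hVo.isClosed_compl hQ.isClosed
    (disjoint_compl_left_iff_subset.2 hQV)
  have hρs : ContDiff ℝ (⊤ : ℕ∞) ρ := ρ.contMDiff.contDiff
  let f : Euc d → ℂ := fun z => ((ρ (q z) : ℝ) : ℂ)
  have hfs : ContDiff ℝ (⊤ : ℕ∞) f :=
    Complex.ofRealCLM.contDiff.comp (hρs.comp (contDiff_norm_sq ℝ))
  have hf0 : ∀ z, q z ∉ V → f z = 0 := fun z hz => by
    simp only [f]
    rw [hρ0 hz]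
    simp
  have hMV : ∀ z, q z ∈ V → z ∈ ball (0 : Euc d) M := fun z hz => by
    rw [mem_ball_zero_iff]
    exact lt_of_pow_lt_pow_left₀ 2 hM0 hz.2
  have hfc : HasCompactSupport f := by
    refine HasCompactSupport.intro (isCompact_closedBall (0 : Euc d) M) fun z hz => hf0 z ?_
    exact fun h => hz (ball_subset_closedBall (hMV z h))
  refine ⟨hfc.toSchwartzMap hfs, fun z w hzw => ?_, fun z hz => ?_, ?_⟩
  · change f z = f w
    simp only [f, q, hzw]
  · change f z = 1
    simp only [f]
    rw [hρ1 ((hqQ z).2 hz)]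
    simp
  · change ∫⁻ z, ‖f z‖ₑ ^ 2 ≤ δ
    calc ∫⁻ z, ‖f z‖ₑ ^ 2 ≤ ∫⁻ z, (q ⁻¹' U ∩ ball 0 M).indicator 1 z := by
          refine lintegral_mono fun z => ?_
          by_cases hz : q z ∈ V
          · rw [indicator_of_mem (show z ∈ q ⁻¹' U ∩ ball 0 M from ⟨hz.1, hMV z hz⟩),
              Pi.one_apply]
            refine pow_le_one₀ zero_le ?_
            rw [← ofReal_norm, ENNReal.ofReal_le_one, Complex.norm_real,
              Real.norm_of_nonneg (hρ _).1]
            exact (hρ _).2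
          · dsimp only
            rw [hf0 z hz]
            simp
      _ = m U := by
          rw [lintegral_indicator_one ((hq.measurable hUo.measurableSet).inter measurableSet_ball),
            Measure.map_apply hq.measurable hUo.measurableSet,
            Measure.restrict_apply (hq.measurable hUo.measurableSet)]
      _ ≤ δ := hU.le

theorem fourier_eq_of_norm_eq {f : Euc d → ℂ} (hf : ∀ z w, ‖z‖ = ‖w‖ → f z = f w)
    {ξ η : Euc d} (h : ‖ξ‖ = ‖η‖) : 𝓕 f ξ = 𝓕 f η := by
  have h1 := Real.fourier_comp_linearIsometry (ℝ ∙ (ξ - η))ᗮ.reflection f ξ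
  rw [Submodule.reflection_sub h] at h1
  rw [← h1]
  refine congrArg (fun g : Euc d → ℂ => 𝓕 g ξ) ?_
  exact funext fun z => (hf _ z ((ℝ ∙ (ξ - η))ᗮ.reflection.norm_map z)).symm

/-- The weighted `L²` norm of the radial frequency profile of a measure, seen from `x`. -/
noncomputable def pinnedEnergy (ν : Measure (Euc d)) (x : Euc d) : ℝ≥0∞ :=
  ∫⁻ r in Ioi (0 : ℝ), ENNReal.ofReal (r ^ (d - 1)) *
    ‖sphereExtension (fun ω => fourierMeasure ν (r • (ω : Euc d))) r x‖ₑ ^ 2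

theorem sq_lintegral_mul_le {α : Type*} [MeasurableSpace α] (μ : Measure α) {w f g : α → ℝ≥0∞}
    (hw : Measurable w) (hf : Measurable f) (hg : Measurable g) :
    (∫⁻ a, w a * (f a * g a) ∂μ) ^ 2 ≤ (∫⁻ a, w a * f a ^ 2 ∂μ) * ∫⁻ a, w a * g a ^ 2 ∂μ := by
  have h := ENNReal.lintegral_mul_le_Lp_mul_Lq (μ.withDensity w) Real.HolderConjugate.two_two
    hf.aemeasurable hg.aemeasurable
  rw [lintegral_withDensity_eq_lintegral_mul _ hw (hf.mul hg),
    lintegral_withDensity_eq_lintegral_mul _ hw (hf.pow_const _),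
    lintegral_withDensity_eq_lintegral_mul _ hw (hg.pow_const _)] at h
  simp only [Pi.mul_apply, ENNReal.rpow_two] at h
  calc _ ≤ _ := pow_le_pow_left₀ zero_le h 2
    _ = _ := by
      rw [mul_pow, ← ENNReal.rpow_two, ← ENNReal.rpow_two, ← ENNReal.rpow_mul, ← ENNReal.rpow_mul]
      norm_num

theorem continuous_sphereExtension_fourierMeasure [NeZero d] (ν : Measure (Euc d))
    [IsFiniteMeasure ν] {X : Type*} [TopologicalSpace X] [FirstCountableTopology X] {ρ : X → ℝ}
    {y : X → Euc d} (hρ : Continuous ρ) (hy : Continuous y) : Continuous fun a =>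
      sphereExtension (fun ω => fourierMeasure ν (ρ a • (ω : Euc d))) (ρ a) (y a) := by
  have hc := continuous_fourierMeasure ν
  refine continuous_of_dominated (bound := fun _ => ν.real univ)
    (fun p => Continuous.aestronglyMeasurable (by fun_prop)) (fun p => ae_of_all _ fun ω => ?_)
    (integrable_const _) (ae_of_all _ fun ω => by fun_prop)
  rw [norm_mul, Complex.norm_exp_ofReal_mul_I, mul_one]
  exact norm_fourierMeasure_le ν _

theorem measurable_pinnedEnergy [NeZero d] (ν : Measure (Euc d)) [IsFiniteMeasure ν] :
    Measurable (pinnedEnergy ν) := by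
  have hc := continuous_sphereExtension_fourierMeasure ν (continuous_fst (X := ℝ) (Y := Euc d))
    continuous_snd
  have h : Measurable fun p : ℝ × Euc d => ENNReal.ofReal (p.1 ^ (d - 1)) *
      ‖sphereExtension (fun ω => fourierMeasure ν (p.1 • (ω : Euc d))) p.1 p.2‖ₑ ^ 2 :=
    (by fun_prop : Measurable fun p : ℝ × Euc d => ENNReal.ofReal (p.1 ^ (d - 1))).mul
      (hc.enorm.measurable.pow_const 2)
  exact h.lintegral_prod_left'

theorem integral_schwartzMap_sub (ν : Measure (Euc d)) [IsFiniteMeasure ν] (ψ : 𝓢(Euc d, ℂ))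
    (x : Euc d) : ∫ y, ψ (x - y) ∂ν = ∫ ξ, (𝓕 ψ) ξ *
      (fourierMeasure ν ξ * Complex.exp (((2 * Real.pi * ⟪x, ξ⟫ : ℝ) : ℂ) * Complex.I)) := by
  have hinv : ∀ z, ψ z = ∫ ξ, (𝓕 ψ) ξ *
      Complex.exp (((2 * Real.pi * ⟪ξ, z⟫ : ℝ) : ℂ) * Complex.I) := by
    intro z
    have h1 : ψ z = 𝓕⁻ ((𝓕 ψ : 𝓢(Euc d, ℂ)) : Euc d → ℂ) z := by
      rw [← SchwartzMap.fourierInv_coe, FourierTransform.fourierInv_fourier_eq]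
    rw [h1, Real.fourierInv_eq']
    congr with ξ
    rw [smul_eq_mul, mul_comm]
  simp_rw [hinv]
  rw [integral_integral_swap]
  · congr with ξ
    rw [integral_const_mul]
    congr 1
    rw [fourierMeasure, ← integral_mul_const]
    congr with y
    rw [← Complex.exp_add]
    congr 1
    rw [inner_sub_right, real_inner_comm, real_inner_comm y]
    push_cast
    ring
  · have hc := (𝓕 ψ : 𝓢(Euc d, ℂ)).continuous
    have hi : Integrable (𝓕 ψ : 𝓢(Euc d, ℂ)) := (𝓕 ψ).integrable
    refine (hi.norm.comp_snd ν).mono' (Continuous.aestronglyMeasurable ?_)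
      (ae_of_all _ fun p => ?_)
    · unfold Function.uncurry
      fun_prop
    · rw [Function.uncurry, norm_mul, Complex.norm_exp_ofReal_mul_I, mul_one]

theorem lintegral_enorm_sq_fourier (ψ : 𝓢(Euc d, ℂ)) :
    ∫⁻ ξ, ‖(𝓕 ψ) ξ‖ₑ ^ 2 = ∫⁻ z, ‖ψ z‖ₑ ^ 2 := by
  have h : ∀ φ : 𝓢(Euc d, ℂ), ∫⁻ z, ‖φ z‖ₑ ^ 2 = ENNReal.ofReal (∫ z, ‖φ z‖ ^ 2) := by
    intro φ
    rw [ofReal_integral_eq_lintegral_ofReal (MemLp.integrable_norm_pow (p := 2)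
      (by exact_mod_cast φ.memLp 2 volume) two_ne_zero)
      (ae_of_all _ fun z => by positivity)]
    refine lintegral_congr fun z => ?_
    rw [← ofReal_norm, ENNReal.ofReal_pow (norm_nonneg _)]
  rw [h, h, SchwartzMap.integral_norm_sq_fourier]

theorem one_le_of_sq_le {S X P J δ : ℝ≥0∞} (h1 : 1 ≤ S * X) (h2 : X ^ 2 ≤ P * J)
    (h3 : S * P ≤ δ) : 1 ≤ S * δ * J :=
  calc (1 : ℝ≥0∞) = 1 ^ 2 := by simp
    _ ≤ (S * X) ^ 2 := pow_le_pow_left₀ zero_le h1 2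
    _ = S ^ 2 * X ^ 2 := mul_pow _ _ _
    _ ≤ S ^ 2 * (P * J) := by gcongr
    _ = S * (S * P) * J := by ring
    _ ≤ S * δ * J := by gcongr

/-- A radial Schwartz function with small `L²` norm, paired with the Fourier transform of a
measure, bounds the pinned energy from below. -/
theorem one_le_pinnedEnergy_of_radial [NeZero d] (ν : Measure (Euc d))
    [IsProbabilityMeasure ν] (x : Euc d) (φ : 𝓢(Euc d, ℂ))
    (hrad : ∀ ξ η, ‖ξ‖ = ‖η‖ → φ ξ = φ η) (h1 : ∫ ξ, φ ξ * (fourierMeasure ν ξ *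
      Complex.exp (((2 * Real.pi * ⟪x, ξ⟫ : ℝ) : ℂ) * Complex.I)) = 1) {δ : ℝ≥0∞}
    (hsmall : ∫⁻ ξ, ‖φ ξ‖ₑ ^ 2 ≤ δ) : 1 ≤ sphereMass d * δ * pinnedEnergy ν x := by
  obtain ⟨e⟩ : Nonempty (USphere d) := NormedSpace.sphere_nonempty.2 zero_le_one |>.to_subtype
  have hc := φ.continuous
  have hi : Integrable φ := φ.integrable
  have hcν := continuous_fourierMeasure ν
  obtain ⟨h, hh, hFrad⟩ : ∃ h : ℝ → ℂ, Continuous h ∧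
      ∀ (r : ℝ) (ω : USphere d), φ (r • (ω : Euc d)) = h r := by
    refine ⟨fun r => φ (r • (e : Euc d)), by fun_prop, fun r ω => hrad _ _ ?_⟩
    rw [norm_smul, norm_smul, norm_eq_of_mem_sphere, norm_eq_of_mem_sphere]
  have hpol := enorm_integral_polar_le (d := d) (f := fun ξ => φ ξ *
    (fourierMeasure ν ξ * Complex.exp (((2 * Real.pi * ⟪x, ξ⟫ : ℝ) : ℂ) * Complex.I)))
    (by fun_prop) (by
      refine hi.norm.mono' (Continuous.aestronglyMeasurable (by fun_prop))
        (ae_of_all _ fun ξ => ?_)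
      rw [norm_mul, norm_mul, Complex.norm_exp_ofReal_mul_I, mul_one]
      refine mul_le_of_le_one_right (norm_nonneg _) ?_
      simpa using norm_fourierMeasure_le ν ξ)
  rw [h1, enorm_one] at hpol
  have hrw : ∀ r : ℝ, ‖∫ ω : USphere d, φ (r • (ω : Euc d)) *
      (fourierMeasure ν (r • (ω : Euc d)) * Complex.exp
        (((2 * Real.pi * ⟪x, r • (ω : Euc d)⟫ : ℝ) : ℂ) * Complex.I))
          ∂(normalizedSphereMeasure d)‖ₑ =
      ‖h r‖ₑ *
        ‖sphereExtension (fun ω => fourierMeasure ν (r • (ω : Euc d))) r x‖ₑ := by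
    intro r
    simp_rw [hFrad]
    rw [integral_const_mul, enorm_mul]
    rfl
  simp_rw [hrw] at hpol
  have hm1 : Measurable fun r : ℝ => ‖h r‖ₑ := hh.enorm.measurable
  have hcx : Continuous fun r : ℝ =>
      sphereExtension (fun ω => fourierMeasure ν (r • (ω : Euc d))) r x :=
    continuous_sphereExtension_fourierMeasure (ρ := fun r => r) (y := fun _ => x) ν continuous_id
      continuous_const
  have hm2 : Measurable fun r : ℝ =>
      ‖sphereExtension (fun ω => fourierMeasure ν (r • (ω : Euc d))) r x‖ₑ :=
    hcx.enorm.measurable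
  have hw : Measurable fun r : ℝ => ENNReal.ofReal (r ^ (d - 1)) := by fun_prop
  have hcs := sq_lintegral_mul_le (volume.restrict (Ioi (0 : ℝ))) hw hm1 hm2
  have hpl : sphereMass d * ∫⁻ r in Ioi (0 : ℝ), ENNReal.ofReal (r ^ (d - 1)) *
      ‖h r‖ₑ ^ 2 ≤ δ := by
    have h2 := lintegral_polar (f := fun ξ => ‖φ ξ‖ₑ ^ 2) (hc.enorm.measurable.pow_const 2)
    simp_rw [hFrad, lintegral_const, measure_univ, mul_one] at h2
    rwa [← h2]
  exact one_le_of_sq_le hpol hcs hpl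

/-- If the pinned distance set at `x` is Lebesgue null then the pinned energy at `x` is infinite. -/
theorem pinnedEnergy_eq_top [NeZero d] {K : Set (Euc d)} (hK : IsCompact K) (ν : Measure (Euc d))
    [IsProbabilityMeasure ν] (hν : ν Kᶜ = 0) {x : Euc d}
    (hx : volume (pinnedDistanceSet x K) = 0) : pinnedEnergy ν x = ∞ := by
  have hpin : pinnedDistanceSet x K = (fun y => dist x y) '' K := by
    ext t
    simp only [pinnedDistanceSet, mem_ofPred_eq, mem_image, eq_comm]
  have hT : IsCompact (pinnedDistanceSet x K) := by
    rw [hpin]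
    exact hK.image (by fun_prop)
  have hT0 : ∀ t ∈ pinnedDistanceSet x K, 0 ≤ t := by
    rintro t ⟨y, -, rfl⟩
    exact dist_nonneg
  have key : ∀ δ : ℝ≥0∞, 0 < δ → 1 ≤ sphereMass d * δ * pinnedEnergy ν x := by
    intro δ hδ
    obtain ⟨ψ, hrad, hone, hsmall⟩ := exists_radial_schwartzMap (d := d) hT hT0 hx hδ
    have h1 : ∫ y, ψ (x - y) ∂ν = 1 := by
      have : ∀ᵐ y ∂ν, ψ (x - y) = 1 := by
        filter_upwards [mem_ae_iff.2 hν] with y hy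
        exact hone _ ⟨y, hy, (dist_eq_norm x y).symm⟩
      rw [integral_congr_ae this]
      simp
    refine one_le_pinnedEnergy_of_radial ν x (𝓕 ψ) (fun ξ η h => ?_) ?_
      ((lintegral_enorm_sq_fourier ψ).le.trans hsmall)
    · rw [SchwartzMap.fourier_coe]
      exact fourier_eq_of_norm_eq hrad h
    · rw [← integral_schwartzMap_sub, h1]
  by_contra hne
  set A := sphereMass d * pinnedEnergy ν x with hA
  have hAt : A ≠ ∞ := ENNReal.mul_ne_top sphereMass_ne_top hne
  have h1 := key (A + 1)⁻¹ (ENNReal.inv_pos.2 (ENNReal.add_ne_top.2 ⟨hAt, ENNReal.one_ne_top⟩))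
  rw [mul_right_comm, ← hA, ← div_eq_mul_inv, ENNReal.le_div_iff_mul_le (by simp) (by simp [hAt]),
    one_mul] at h1
  exact absurd h1 (not_le.2 (ENNReal.lt_add_right hAt one_ne_zero))

end Pinned

/-! ### The dimension of the set of pins with null distance sets -/

section Main

variable {d : ℕ}

theorem lintegral_Ioi_one_lt_top [NeZero d] {G : Euc d → ℝ≥0∞} (hG : Measurable G)
    (h : ∫⁻ ξ in (closedBall (0 : Euc d) 1)ᶜ, G ξ < ∞) :
    ∫⁻ r in Ioi (1 : ℝ), ENNReal.ofReal (r ^ (d - 1)) *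
      ∫⁻ ω : USphere d, G (r • (ω : Euc d)) ∂(normalizedSphereMeasure d) < ∞ := by
  have hm : MeasurableSet (closedBall (0 : Euc d) 1)ᶜ := isClosed_closedBall.measurableSet.compl
  rw [← lintegral_indicator hm, lintegral_polar (hG.indicator hm)] at h
  have h1 := ENNReal.lt_top_of_mul_ne_top_right h.ne sphereMass_ne_zero
  refine lt_of_le_of_lt ?_ h1
  refine le_trans (le_of_eq ?_) (lintegral_mono_set (Ioi_subset_Ioi zero_le_one))
  refine setLIntegral_congr_fun measurableSet_Ioi fun r hr => ?_
  congr 1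
  refine lintegral_congr fun ω => (indicator_of_mem ?_ _).symm
  rw [mem_compl_iff, mem_closedBall_zero_iff, norm_smul, norm_eq_of_mem_sphere, mul_one, not_le,
    Real.norm_of_nonneg (zero_le_one.trans (le_of_lt hr))]
  exact hr

theorem enorm_sphereExtension_fourierMeasure_le_one [NeZero d] (ν : Measure (Euc d))
    [IsProbabilityMeasure ν] (r : ℝ) (x : Euc d) :
    ‖sphereExtension (fun ω => fourierMeasure ν (r • (ω : Euc d))) r x‖ₑ ≤ 1 := by
  rw [← ofReal_norm, ENNReal.ofReal_le_one]
  refine (norm_sphereExtension_le _ _ _).trans ?_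
  calc _ ≤ ∫ _ω : USphere d, (1 : ℝ) ∂(normalizedSphereMeasure d) := by
        refine integral_mono
          (integrable_of_continuous_sphere (continuous_fourierMeasure_sphere ν r).norm)
          (integrable_const _) fun ω => ?_
        simpa using norm_fourierMeasure_le ν (r • (ω : Euc d))
    _ = 1 := by simp

/-- The pinned energy is integrable against measures satisfying an extension estimate. -/
theorem lintegral_pinnedEnergy_lt_top [NeZero d] (ν l : Measure (Euc d))
    [IsProbabilityMeasure ν] [IsProbabilityMeasure l] {θ C : ℝ} (hC : 0 ≤ C)
    (hl : ∀ R : ℝ, 1 ≤ R → ∀ g : USphere d → ℂ, Continuous g →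
      ∫ x, ‖sphereExtension g R x‖ ^ 2 ∂l ≤
        C * R ^ (-θ) * ∫ ω, ‖g ω‖ ^ 2 ∂(normalizedSphereMeasure d))
    (hν : ∫⁻ ξ in (closedBall (0 : Euc d) 1)ᶜ,
      ENNReal.ofReal (‖ξ‖ ^ (-θ) * ‖fourierMeasure ν ξ‖ ^ 2) < ∞) :
    ∫⁻ x, pinnedEnergy ν x ∂l < ∞ := by
  have hcν := continuous_fourierMeasure ν
  let F : ℝ → Euc d → ℝ≥0∞ := fun r x => ENNReal.ofReal (r ^ (d - 1)) *
    ‖sphereExtension (fun ω => fourierMeasure ν (r • (ω : Euc d))) r x‖ₑ ^ 2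
  have hc := continuous_sphereExtension_fourierMeasure ν (continuous_fst (X := ℝ) (Y := Euc d))
    continuous_snd
  have hF : Measurable fun p : ℝ × Euc d => F p.1 p.2 :=
    (by fun_prop : Measurable fun p : ℝ × Euc d => ENNReal.ofReal (p.1 ^ (d - 1))).mul
      (hc.enorm.measurable.pow_const 2)
  have hsmall : ∀ r ∈ Ioc (0 : ℝ) 1, ∫⁻ x, F r x ∂l ≤ 1 := by
    intro r hr
    calc ∫⁻ x, F r x ∂l ≤ ∫⁻ _x, 1 ∂l := by
          refine lintegral_mono fun x => mul_le_one' ?_ ?_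
          · exact ENNReal.ofReal_le_one.2 (pow_le_one₀ hr.1.le hr.2)
          · exact pow_le_one₀ zero_le (enorm_sphereExtension_fourierMeasure_le_one ν r x)
      _ = 1 := by simp
  have hG : Measurable fun ξ : Euc d => ENNReal.ofReal (‖ξ‖ ^ (-θ) * ‖fourierMeasure ν ξ‖ ^ 2) := by
    have := hcν.norm.measurable
    fun_prop
  have hlarge : ∀ r ∈ Ioi (1 : ℝ), ∫⁻ x, F r x ∂l ≤ ENNReal.ofReal C *
      (ENNReal.ofReal (r ^ (d - 1)) * ∫⁻ ω : USphere d, ENNReal.ofReal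
        (‖r • (ω : Euc d)‖ ^ (-θ) * ‖fourierMeasure ν (r • (ω : Euc d))‖ ^ 2)
          ∂(normalizedSphereMeasure d)) := by
    intro r hr
    have hr0 : 0 < r := zero_lt_one.trans hr
    have hgc := continuous_fourierMeasure_sphere ν r
    have hext := continuous_sphereExtension hgc r
    have h1 : ∫⁻ x, ‖sphereExtension (fun ω => fourierMeasure ν (r • (ω : Euc d))) r x‖ₑ ^ 2 ∂l =
        ENNReal.ofReal
          (∫ x, ‖sphereExtension (fun ω => fourierMeasure ν (r • (ω : Euc d))) r x‖ ^ 2 ∂l) := by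
      rw [ofReal_integral_eq_lintegral_ofReal _ (ae_of_all _ fun x => by positivity)]
      · refine lintegral_congr fun x => ?_
        rw [← ofReal_norm, ENNReal.ofReal_pow (norm_nonneg _)]
      · refine (integrable_const (1 : ℝ)).mono' (hext.norm.pow 2).aestronglyMeasurable
          (ae_of_all _ fun x => ?_)
        rw [norm_pow, norm_norm]
        refine pow_le_one₀ (norm_nonneg _) ?_
        have := enorm_sphereExtension_fourierMeasure_le_one ν r x
        rwa [← ofReal_norm, ENNReal.ofReal_le_one] at this
    have h2 : ∫⁻ ω : USphere d, ENNReal.ofReal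
        (‖r • (ω : Euc d)‖ ^ (-θ) * ‖fourierMeasure ν (r • (ω : Euc d))‖ ^ 2)
          ∂(normalizedSphereMeasure d) = ENNReal.ofReal (r ^ (-θ) *
            ∫ ω : USphere d, ‖fourierMeasure ν (r • (ω : Euc d))‖ ^ 2
              ∂(normalizedSphereMeasure d)) := by
      have hi : Integrable (fun ω : USphere d => r ^ (-θ) *
          ‖fourierMeasure ν (r • (ω : Euc d))‖ ^ 2) (normalizedSphereMeasure d) :=
        (integrable_of_continuous_sphere (hgc.norm.pow 2)).const_mul _
      rw [← integral_const_mul, ofReal_integral_eq_lintegral_ofReal hi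
        (ae_of_all _ fun ω => by positivity)]
      refine lintegral_congr fun ω => ?_
      rw [norm_smul, norm_eq_of_mem_sphere, mul_one, Real.norm_of_nonneg hr0.le]
    simp only [F]
    rw [lintegral_const_mul _ (hext.enorm.measurable.pow_const 2), h1, h2, mul_left_comm,
      ← ENNReal.ofReal_mul hC]
    gcongr
    refine (hl r (le_of_lt hr) _ hgc).trans (le_of_eq (mul_assoc _ _ _))
  calc ∫⁻ x, pinnedEnergy ν x ∂l = ∫⁻ r in Ioi (0 : ℝ), ∫⁻ x, F r x ∂l :=
        lintegral_lintegral_swap (hF.comp measurable_swap).aemeasurable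
    _ = ∫⁻ r in Ioc (0 : ℝ) 1 ∪ Ioi 1, ∫⁻ x, F r x ∂l := by
        rw [Ioc_union_Ioi_eq_Ioi zero_le_one]
    _ ≤ (∫⁻ r in Ioc (0 : ℝ) 1, ∫⁻ x, F r x ∂l) + ∫⁻ r in Ioi (1 : ℝ), ∫⁻ x, F r x ∂l :=
        lintegral_union_le _ _ _
    _ ≤ (∫⁻ _r in Ioc (0 : ℝ) 1, 1) + ∫⁻ r in Ioi (1 : ℝ), ENNReal.ofReal C *
      (ENNReal.ofReal (r ^ (d - 1)) * ∫⁻ ω : USphere d, ENNReal.ofReal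
        (‖r • (ω : Euc d)‖ ^ (-θ) * ‖fourierMeasure ν (r • (ω : Euc d))‖ ^ 2)
          ∂(normalizedSphereMeasure d)) :=
        add_le_add (setLIntegral_mono' measurableSet_Ioc hsmall)
          (setLIntegral_mono' measurableSet_Ioi hlarge)
    _ < ∞ := by
        rw [lintegral_const_mul' _ _ ENNReal.ofReal_ne_top]
        refine ENNReal.add_lt_top.2 ⟨by simp, ENNReal.mul_lt_top ENNReal.ofReal_lt_top ?_⟩
        exact lintegral_Ioi_one_lt_top hG hν

/-- An upper bound for the dimension of the set of pins with null distance sets. -/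
theorem SphericalDecay.dimH_null_pins_le [NeZero d] {s s' b α C : ℝ} (h : SphericalDecay d s b)
    (hsd : s ≤ d) (hs'0 : 0 ≤ s') (hs' : s' ≤ s) {K : Set (Euc d)} (hK : IsCompact K)
    (ν : Measure (Euc d)) [IsProbabilityMeasure ν] (hνK : ν Kᶜ = 0) (hαd : α ≤ d) (hC : 0 ≤ C)
    (hν : ∀ x r, 0 < r → ν (closedBall x r) ≤ ENNReal.ofReal (C * r ^ α))
    (hdim : (d : ℝ) < α + b - (s - s')) :
    dimH {x : Euc d | volume (pinnedDistanceSet x K) = 0} ≤ ENNReal.ofReal s' := by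
  by_contra! hlt
  have hsub : {x : Euc d | volume (pinnedDistanceSet x K) = 0} ⊆ pinnedEnergy ν ⁻¹' {∞} :=
    fun x hx => pinnedEnergy_eq_top hK ν hνK hx
  have hmeas : MeasurableSet (pinnedEnergy ν ⁻¹' {∞}) :=
    measurable_pinnedEnergy ν (measurableSet_singleton _)
  obtain ⟨σ, hσ1, hσ2⟩ := ENNReal.lt_iff_exists_nnreal_btwn.1 (hlt.trans_le (dimH_mono hsub))
  have hσs : s' < σ := by
    rwa [ENNReal.ofReal_lt_coe_iff hs'0] at hσ1
  have hσ0 : 0 < σ := by exact_mod_cast hs'0.trans_lt hσs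
  obtain ⟨L, l, hL, hLsub, hlp, hlL, κ₀, hκ₀⟩ := exists_frostman_measure hσ0 hmeas.analyticSet hσ2
  set κ : ℝ := max κ₀ 1 with hκ
  have hκ1 : 1 ≤ κ := le_max_right _ _
  have hF : ∀ x r, 0 < r → l (closedBall x r) ≤ ENNReal.ofReal (κ * r ^ s') := by
    intro x r hr
    rcases le_total r 1 with hr1 | hr1
    · refine (hκ₀ x r hr).trans (ENNReal.ofReal_le_ofReal ?_)
      have h1 : r ^ (σ : ℝ) ≤ r ^ s' := Real.rpow_le_rpow_of_exponent_ge hr hr1 hσs.le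
      have h2 : 0 ≤ r ^ (σ : ℝ) := by positivity
      calc κ₀ * r ^ (σ : ℝ) ≤ κ * r ^ (σ : ℝ) := by
            gcongr
            exact le_max_left _ _
        _ ≤ _ := by gcongr
    · refine prob_le_one.trans (ENNReal.one_le_ofReal.2 ?_)
      exact one_le_mul_of_one_le_of_one_le hκ1 (Real.one_le_rpow hr1 hs'0)
  obtain ⟨M₀, hM₀⟩ := hL.isBounded.subset_closedBall (0 : Euc d)
  have hlM : l (closedBall 0 (max M₀ 1))ᶜ = 0 :=
    measure_mono_null (compl_subset_compl.2
      (hM₀.trans (closedBall_subset_closedBall (le_max_left _ _)))) hlL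
  set ε : ℝ := (α + b - (s - s') - d) / 2 with hε
  have hε0 : 0 < ε := by
    rw [hε]
    linarith
  obtain ⟨C₁, hC₁, hext⟩ := h.extension_bound (hs'0.trans hs') hsd hε0 l (le_max_right M₀ 1) hlM
    hs' (zero_lt_one.trans_le hκ1) hF
  have hfin := lintegral_pinnedEnergy_lt_top ν l (θ := b - ε - (s - s')) hC₁
    (fun R hR g hg => by
      have := hext R hR g hg
      rwa [show -b + ε + (s - s') = -(b - ε - (s - s')) by ring] at this)
    (lintegral_rpow_mul_fourierMeasure_sq_lt_top hαd hC (by rw [hε]; linarith) ν hν)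
  have h1 : ∀ᵐ x ∂l, pinnedEnergy ν x < ∞ := ae_lt_top (measurable_pinnedEnergy ν) hfin.ne
  have h2 : ∀ᵐ x ∂l, x ∈ L := mem_ae_iff.2 hlL
  obtain ⟨x, hx1, hx2⟩ := (h1.and h2).exists
  exact hx1.ne (hLsub hx2)

theorem pinnedDistanceSet_mono {x : Euc d} {A B : Set (Euc d)} (h : A ⊆ B) :
    pinnedDistanceSet x A ⊆ pinnedDistanceSet x B :=
  fun _ ⟨y, hy, ht⟩ => ⟨y, h hy, ht⟩

/-- The bound for analytic sets of positive dimension. -/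
theorem SphericalDecay.dimH_null_pins_le_of_analyticSet [NeZero d] {s s' b : ℝ}
    (h : SphericalDecay d s b) (hsd : s ≤ d) (hs'0 : 0 ≤ s') (hs' : s' ≤ s) {E : Set (Euc d)}
    (hE : AnalyticSet E) (hE0 : 0 < dimH E) (hdim : (d : ℝ) < (dimH E).toReal + b - (s - s')) :
    dimH {x : Euc d | volume (pinnedDistanceSet x E) = 0} ≤ ENNReal.ofReal s' := by
  have hEd : dimH E ≤ d := by
    have := dimH_mono (subset_univ E)
    rwa [Real.dimH_univ_eq_finrank, finrank_euclideanSpace_fin] at this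
  have hEt : dimH E ≠ ∞ := ne_top_of_le_ne_top (ENNReal.natCast_ne_top d) hEd
  have hlt : ENNReal.ofReal (d - b + (s - s')) < dimH E := by
    rw [← ENNReal.ofReal_toReal hEt, ENNReal.ofReal_lt_ofReal_iff (ENNReal.toReal_pos hE0.ne' hEt)]
    linarith
  obtain ⟨α, hα1, hα2⟩ := ENNReal.lt_iff_exists_nnreal_btwn.1 hlt
  have hα0 : 0 < α := by exact_mod_cast zero_le.trans_lt hα1
  have hα3 : (d : ℝ) - b + (s - s') < α := by
    by_contra! hle
    refine hα1.not_ge ?_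
    rw [← ENNReal.ofReal_coe_nnreal]
    exact ENNReal.ofReal_le_ofReal hle
  have hαd : (α : ℝ) ≤ d := by exact_mod_cast hα2.le.trans hEd
  obtain ⟨K, ν, hK, hKE, hν, hνK, C, hC⟩ := exists_frostman_measure hα0 hE hα2
  refine (dimH_mono fun x hx => ?_).trans (h.dimH_null_pins_le hsd hs'0 hs' hK ν hνK hαd
    (le_max_right C 0) (fun x r hr => (hC x r hr).trans (ENNReal.ofReal_le_ofReal ?_))
    (by linarith))
  · exact measure_mono_null (pinnedDistanceSet_mono hKE) hx
  · have : 0 ≤ r ^ (α : ℝ) := by positivity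
    gcongr
    exact le_max_left _ _

/-- Applied to a point mass, the bound shows that the decay exponent cannot exceed the dimension
of the ambient space, except trivially. -/
theorem SphericalDecay.dim_le_of_dim_lt [NeZero d] {s s' b : ℝ} (h : SphericalDecay d s b)
    (hsd : s ≤ d) (hs'0 : 0 ≤ s') (hs' : s' ≤ s) (hdim : (d : ℝ) < b - (s - s')) :
    (d : ℝ) ≤ s' := by
  have h1 := h.dimH_null_pins_le (K := {0}) (α := 0) (C := 1) hsd hs'0 hs' isCompact_singleton
    (Measure.dirac 0) (by simp) (Nat.cast_nonneg d) zero_le_one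
    (fun x r _ => by
      rw [Real.rpow_zero, mul_one, ENNReal.ofReal_one]
      exact prob_le_one) (by linarith)
  have h2 : {x : Euc d | volume (pinnedDistanceSet x {0}) = 0} = univ := by
    refine eq_univ_of_forall fun x => ?_
    have : pinnedDistanceSet x {(0 : Euc d)} ⊆ {dist x 0} := by
      rintro t ⟨y, rfl, rfl⟩
      rfl
    exact measure_mono_null this (by simp)
  rw [h2, Real.dimH_univ_eq_finrank, finrank_euclideanSpace_fin, ← ENNReal.ofReal_natCast,
    ENNReal.ofReal_le_ofReal_iff hs'0] at h1
  exact h1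

end Main

theorem theorem1p3 (d : ℕ) (hd : 2 ≤ d) (β : ℝ → ℝ)
    (hβ : ∀ s ∈ Set.Icc (0 : ℝ) d, SphericalDecay d s (β s))
    (E : Set (EuclideanSpace ℝ (Fin d))) (hE : MeasureTheory.AnalyticSet E) :
    dimH {x : EuclideanSpace ℝ (Fin d) | volume (pinnedDistanceSet x E) = 0} ≤
        ⨅ s ∈ {s : ℝ | s ∈ Set.Icc (0 : ℝ) d ∧ (d : ℝ) < (dimH E).toReal + β s},
          ENNReal.ofReal s
      ∧ ((d : ℝ) < (dimH E).toReal + β (dimH E).toReal →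
          ∃ x ∈ E, 0 < volume (pinnedDistanceSet x E)) := by
  have : NeZero d := ⟨by omega⟩
  have hd0 : (0 : ℝ) < d := by exact_mod_cast (by omega : 0 < d)
  have hle : ∀ A : Set (Euc d), dimH A ≤ d := fun A => by
    have := dimH_mono (subset_univ A)
    rwa [Real.dimH_univ_eq_finrank, finrank_euclideanSpace_fin] at this
  refine ⟨le_iInf₂ fun s ⟨hs, hsE⟩ => ?_, fun hsE => ?_⟩
  · rcases eq_or_ne (dimH E) 0 with h0 | h0
    · rw [h0, ENNReal.toReal_zero, zero_add] at hsE
      have h1 := (hβ s hs).dim_le_of_dim_lt hs.2 hs.1 le_rfl (by linarith)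
      refine (hle _).trans ?_
      rw [← ENNReal.ofReal_natCast]
      exact ENNReal.ofReal_le_ofReal h1
    · exact (hβ s hs).dimH_null_pins_le_of_analyticSet hs.2 hs.1 le_rfl hE (pos_iff_ne_zero.2 h0)
        (by linarith)
  · have hEt : dimH E ≠ ∞ := ne_top_of_le_ne_top (ENNReal.natCast_ne_top d) (hle E)
    set s := (dimH E).toReal with hs
    have hsI : s ∈ Icc (0 : ℝ) d := by
      refine ⟨ENNReal.toReal_nonneg, ?_⟩
      have := ENNReal.toReal_mono (ENNReal.natCast_ne_top d) (hle E)
      simpa using this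
    rcases eq_or_lt_of_le hsI.1 with h0 | h0
    · have h1 := (hβ s hsI).dim_le_of_dim_lt hsI.2 hsI.1 le_rfl (by linarith)
      linarith
    · by_contra! hnull
      obtain ⟨s', hs'1, hs'2⟩ := exists_between
        (max_lt_iff.2 ⟨h0, by linarith⟩ : max 0 ((d : ℝ) - β s) < s)
      have h0' := (le_max_left _ _).trans hs'1.le
      have h1 := (hβ s hsI).dimH_null_pins_le_of_analyticSet (s' := s') hsI.2 h0' hs'2.le hE
        (ENNReal.toReal_pos_iff.1 h0).1 (by linarith [(le_max_right _ _).trans_lt hs'1])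
      have h2 : E ⊆ {x : Euc d | volume (pinnedDistanceSet x E) = 0} :=
        fun x hx => le_antisymm (hnull x hx) zero_le
      have h3 := (dimH_mono h2).trans h1
      rw [← ENNReal.ofReal_toReal hEt, ENNReal.ofReal_le_ofReal_iff h0'] at h3
      linarith
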